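/- All graphs are finite, simple and undirected; their vertices are labelled by atoms, where the atoms are the propositional variables $a$ and their formal duals $\bar a$ (and $\bar{\bar a}=a$). Graphs are considered up to label-preserving isomorphism. Write $\emptyset$ for the empty graph, $G⅋H$ for the disjoint union and $G\otimes H$ for the join of $G$ and $H$. For a graph $B$ and $S\subseteq V_B$ let $B\langle A\rangle_S$ be the disjoint union of $B$ and $A$ together with all edges between $S$ and $V_A$. For an unlabelled graph $P$ with vertices $v_1,\dots,v_n$ let $P\langle H_1,\dots,H_n\rangle$ be the graph obtained by replacing each $v_i$ by $H_i$, with all edges between $H_i$ and $H_j$ whenever $v_iv_j$ is an edge of $P$; $\bar P$ is the complement of $P$. A module of a graph is a set $M$ of vertices such that each vertex outside $M$ is adjacent to all or to none of the vertices of $M$; a graph with at least two vertices is prime if its only modules are $\emptyset$, the singletons and the whole vertex set. The system $\mathsf{GS}\cup\{\mathsf{ss}{\uparrow}\}$ consists of the following inference rules. - $\mathsf{ai}{\downarrow}$: from $\emptyset$ infer $\bar a⅋a$, for an atom $a$. - $\mathsf{ss}{\downarrow}$: from $B\langle A\rangle_S$ infer $B⅋A$, where $\emptyset\neq S\subseteq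 V_B$ and $A\neq\emptyset$. - $\mathsf{p}{\downarrow}$: from $(M_1⅋N_1)\otimes\cdots\otimes(M_n⅋N_n)$ infer $\bar P\langle M_1,\dots,M_n\rangle⅋P\langle N_1,\dots,N_n\rangle$, where $P$ is prime, $n=|V_P|\ge 4$ and $M_1,\dots,M_n$ are non-empty. - $\mathsf{ss}{\uparrow}$: from $B\otimes A$ infer $B\langle A\rangle_S$, where $S\subsetneq V_B$ and $A\neq\emptyset$. Derivations, each with a premise and a conclusion, are generated as follows: a graph $G$ is a derivation from $G$ to $G$; if $\mathcal D_i$ is a derivation from $G_i$ to $H_i$ for $i=1,\dots,n$ and $P$ is a graph with $n$ vertices, then $P\langle\mathcal D_1,\dots,\mathcal D_n\rangle$ is a derivation from $P\langle G_1,\dots,G_n\rangle$ to $P\langle H_1,\dots,H_n\rangle$; a derivation from $G_1$ to $H_1$ and a derivation from $G_2$ to $H_2$ compose to a derivation from $G_1$ to $H_2$ if $G_2$ follows from $H_1$ by an instance of an inference rule, or if $H_1\cong G_2$. The graphs occurring in a derivation are: $G$, in the derivation $G$; the graphs occurring in some $\mathcal D_i$ and all $P\langle X_1,\dots,X_n\rangle$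 with $X_i$ occurring in $\mathcal D_i$, in the derivation $P\langle\mathcal D_1,\dots,\mathcal D_n\rangle$; the graphs occurring in either part, in a vertical composition. A proof of $G$ is a derivation with premise $\emptyset$ and conclusion $G$, and $G$ is provable if it has a proof. A prime graph $P$ is a connector of $G$ if it occurs in the modular decomposition of $G$, that is, if $G\cong Q\langle A_1,\dots,A_n\rangle$ for some prime graph $Q$ and non-empty graphs $A_1,\dots,A_n$ such that $P\cong Q$ or, recursively, $P$ is a connector of some $A_i$. (The prime graphs with two vertices are $⅋$ and $\otimes$.) A subconnector of $G$ is a prime graph that is isomorphic to an induced subgraph of a connector of $G$. **Theorem (Analyticity).** Let $G$ be a graph that is provable in $\mathsf{GS}\cup\{\mathsf{ss}{\uparrow}\}$. Then $G$ has a proof $\tilde{\mathcal D}$ in $\mathsf{GS}\cup\{\mathsf{ss}{\uparrow}\}$ such that every connector of every graph occurring in $\tilde{\mathcal D}$ is a subconnector of $G$. -/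

import Mathlib

universe u

namespace GraphLogic

/-- Atoms over a type of propositional variables: the disjoint union of the variables and of
their duals. -/
inductive Atom (𝒱 : Type u) : Type u
  | pos : 𝒱 → Atom 𝒱
  | neg : 𝒱 → Atom 𝒱

/-- The dual of an atom. -/
def Atom.dual {𝒱 : Type u} : Atom 𝒱 → Atom 𝒱
  | .pos a => .neg a
  | .neg a => .pos a

/-- A graph in the sense of the logic: a finite simple undirected graph whose vertices are
labelled by atoms. -/
structure LGraph (𝒱 : Type u) : Type (max u 1) where
  V : Type
  finite : Finite V
  graph : SimpleGraph V
  label : V → Atom 𝒱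

attribute [instance] LGraph.finite

namespace LGraph

variable {𝒱 : Type u}

/-- A label-preserving graph isomorphism. -/
structure Iso (G H : LGraph 𝒱) : Type where
  toIso : G.graph ≃g H.graph
  label_eq : ∀ v, H.label (toIso v) = G.label v

/-- The empty graph. -/
def empty : LGraph 𝒱 where
  V := Empty
  finite := inferInstance
  graph := ⊥
  label := fun v => v.elim

/-- The single-vertex graph whose vertex is labelled by `a`. -/
def single (a : Atom 𝒱) : LGraph 𝒱 where
  V := Unit
  finite := inferInstance
  graph := ⊥
  label := fun _ => a

/-- A graph is non-empty if it has a vertex. -/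
def IsNonempty (G : LGraph 𝒱) : Prop := Nonempty G.V

/-- Adjacency in `B⟨A⟩_S`: the edges of `B`, the edges of `A`, and all edges between a vertex
of `S` and a vertex of `A`. -/
def plugAdj (B : LGraph 𝒱) (S : Set B.V) (A : LGraph 𝒱) : B.V ⊕ A.V → B.V ⊕ A.V → Prop
  | .inl b, .inl b' => B.graph.Adj b b'
  | .inr a, .inr a' => A.graph.Adj a a'
  | .inl b, .inr _ => b ∈ S
  | .inr _, .inl b => b ∈ S

/-- The graph `B⟨A⟩_S`: the module `A` placed in the context `B⟨·⟩_S`, where `S` is the set of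
neighbours of the hole. -/
def plug (B : LGraph 𝒱) (S : Set B.V) (A : LGraph 𝒱) : LGraph 𝒱 where
  V := B.V ⊕ A.V
  finite := inferInstance
  graph :=
    { Adj := plugAdj B S A
      symm := ⟨by
        rintro (x | x) (y | y) h
        · exact SimpleGraph.Adj.symm h
        · exact h
        · exact h
        · exact SimpleGraph.Adj.symm h⟩
      loopless := ⟨by
        rintro (x | x) h
        · exact B.graph.irrefl h
        · exact A.graph.irrefl h⟩ }
  label := Sum.elim B.label A.label

/-- The par `G ⅋ H`, i.e. the disjoint union: no edge is added between `G` and `H`. -/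
def par (G H : LGraph 𝒱) : LGraph 𝒱 := G.plug ∅ H

/-- The tensor `G ⊗ H`, i.e. the join: all edges between `G` and `H` are added. -/
def tensor (G H : LGraph 𝒱) : LGraph 𝒱 := G.plug Set.univ H

/-- The composition `P⟨H₁,…,Hₙ⟩` of the graphs `Hᵢ` via the graph `P`: the vertex `i` of `P` is
replaced by `Hᵢ`. Labels on `P` would play no role, so `P` is an unlabelled graph. -/
def comp {ι : Type} [Finite ι] (P : SimpleGraph ι) (H : ι → LGraph 𝒱) : LGraph 𝒱 where
  V := Σ i, (H i).V
  finite := inferInstance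
  graph :=
    { Adj := fun x y =>
        (∃ (i : ι) (u v : (H i).V), x = ⟨i, u⟩ ∧ y = ⟨i, v⟩ ∧ (H i).graph.Adj u v) ∨
          P.Adj x.1 y.1
      symm := ⟨by
        rintro x y (⟨i, u, v, rfl, rfl, h⟩ | h)
        · exact Or.inl ⟨i, v, u, rfl, rfl, SimpleGraph.Adj.symm h⟩
        · exact Or.inr (SimpleGraph.Adj.symm h)⟩
      loopless := ⟨by
        rintro x (⟨i, u, v, hu, hv, h⟩ | h)
        · obtain rfl : u = v := by
            have := hu.symm.trans hv
            simpa using this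
          exact (H i).graph.irrefl h
        · exact P.irrefl h⟩ }
  label := fun x => (H x.1).label x.2

end LGraph

/-- A set `M` of vertices (with its induced subgraph) is a module if every vertex outside `M` is
adjacent to all or to none of the vertices in `M`. -/
def IsModule {ι : Type} (P : SimpleGraph ι) (M : Set ι) : Prop :=
  ∀ v, v ∉ M → ∀ x ∈ M, ∀ y ∈ M, (P.Adj v x ↔ P.Adj v y)

/-- A finite graph is prime if it has at least two vertices and all its modules are trivial.
(`Nat.card` of an infinite type is `0`, so a prime graph is finite.) -/
def IsPrime {ι : Type} (P : SimpleGraph ι) : Prop :=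
  2 ≤ Nat.card ι ∧
    ∀ M : Set ι, IsModule P M → M = ∅ ∨ (∃ x, M = {x}) ∨ M = Set.univ

/-- `IsConnector P G`: the prime graph `P` occurs, up to isomorphism, as an inner node of a modular
decomposition of `G`. A modular decomposition of a graph with at least two vertices presents it
as `Q⟨A₁,…,Aₙ⟩` with `Q` prime and all `Aᵢ` non-empty and then decomposes the `Aᵢ`; the prime
graphs with two vertices are `⅋` and `⊗`. -/
inductive IsConnector {𝒱 : Type u} {ι : Type} (P : SimpleGraph ι) : LGraph 𝒱 → Prop
  | root [Finite ι] {G : LGraph 𝒱} (hP : IsPrime P) (A : ι → LGraph 𝒱)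
      (hA : ∀ i, (A i).IsNonempty) (e : G.Iso (LGraph.comp P A)) : IsConnector P G
  | child {κ : Type} [Finite κ] {G : LGraph 𝒱} (Q : SimpleGraph κ) (hQ : IsPrime Q)
      (A : κ → LGraph 𝒱) (hA : ∀ k, (A k).IsNonempty) (e : G.Iso (LGraph.comp Q A))
      (k : κ) (h : IsConnector P (A k)) : IsConnector P G

/-- A subconnector of `G` is a prime graph that is (isomorphic to) an induced subgraph of a
connector of `G`. -/
def IsSubconnector {𝒱 : Type u} {ι : Type} (P : SimpleGraph ι) (G : LGraph 𝒱) : Prop :=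
  IsPrime P ∧ ∃ (κ : Type) (Q : SimpleGraph κ), IsConnector Q G ∧ Nonempty (P ↪g Q)

/-- An inference rule, given by its instances: `r G H` says that there is an instance of `r` with
premise `G` and conclusion `H`. -/
abbrev Rule (𝒱 : Type u) : Type (max u 1) := LGraph 𝒱 → LGraph 𝒱 → Prop

/-- An inference system is a set of inference rules. -/
abbrev System (𝒱 : Type u) : Type (max u 1) := Set (Rule 𝒱)

section Rules

variable {𝒱 : Type u}

/-- Atomic identity down `ai↓`: from `∅` infer `aᗮ ⅋ a`. -/
inductive aiDown : Rule 𝒱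
  | mk (a : Atom 𝒱) : aiDown LGraph.empty ((LGraph.single a.dual).par (LGraph.single a))

/-- Super switch down `ss↓`: from `B⟨A⟩_S` infer `B ⅋ A`, for `S` and `A` non-empty. -/
inductive ssDown : Rule 𝒱
  | mk (B A : LGraph 𝒱) (S : Set B.V) (hS : S ≠ ∅) (hA : A.IsNonempty) :
      ssDown (B.plug S A) (B.par A)

/-- Super switch up `ss↑`: from `B ⊗ A` infer `B⟨A⟩_S`, for `S` not the set of all vertices of `B`
and `A` non-empty. -/
inductive ssUp : Rule 𝒱
  | mk (B A : LGraph 𝒱) (S : Set B.V) (hS : S ≠ Set.univ) (hA : A.IsNonempty) :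
      ssUp (B.tensor A) (B.plug S A)

/-- Prime down `p↓`: from `(M₁ ⅋ N₁) ⊗ ⋯ ⊗ (Mₙ ⅋ Nₙ)` infer `Pᗮ⟨M₁,…,Mₙ⟩ ⅋ P⟨N₁,…,Nₙ⟩`, for `P`
prime with at least four vertices and all `Mᵢ` non-empty. The `n`-ary tensor is the composition
via the complete graph, and `Pᗮ` is the complement of `P`. -/
inductive pDown : Rule 𝒱
  | mk {ι : Type} [Finite ι] (P : SimpleGraph ι) (hP : IsPrime P) (hcard : 4 ≤ Nat.card ι)
      (M N : ι → LGraph 𝒱) (hM : ∀ i, (M i).IsNonempty) :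
      pDown (LGraph.comp (⊤ : SimpleGraph ι) fun i => (M i).par (N i))
        ((LGraph.comp Pᶜ M).par (LGraph.comp P N))

/-- The system `GS`. -/
def GS (𝒱 : Type u) : System 𝒱 := {aiDown, ssDown, pDown}

end Rules

/-- Derivations in the inference system `S` (open deduction), with given premise and conclusion. -/
inductive Deriv {𝒱 : Type u} (S : System 𝒱) : LGraph 𝒱 → LGraph 𝒱 → Type (max u 1)
  /-- Every graph is a derivation. -/
  | graph (G : LGraph 𝒱) : Deriv S G G
  /-- Derivations can be composed horizontally via any graph. -/
  | comp {ι : Type} [Finite ι] (P : SimpleGraph ι) {A B : ι → LGraph 𝒱}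
      (D : ∀ i, Deriv S (A i) (B i)) : Deriv S (LGraph.comp P A) (LGraph.comp P B)
  /-- Derivations can be composed vertically with an inference step. -/
  | step {G₁ H₁ G₂ H₂ : LGraph 𝒱} (D₁ : Deriv S G₁ H₁) (r : Rule 𝒱) (hr : r ∈ S)
      (h : r H₁ G₂) (D₂ : Deriv S G₂ H₂) : Deriv S G₁ H₂
  /-- Derivations can be composed vertically along an isomorphism. -/
  | iso {G₁ H₁ G₂ H₂ : LGraph 𝒱} (D₁ : Deriv S G₁ H₁) (f : H₁.Iso G₂)
      (D₂ : Deriv S G₂ H₂) : Deriv S G₁ H₂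

/-- The graphs occurring in a derivation. In a horizontal composition `P⟨D₁,…,Dₙ⟩` these are the
graphs occurring in the `Dᵢ` and all graphs `P⟨X₁,…,Xₙ⟩` with `Xᵢ` occurring in `Dᵢ`, so that every
graph occurring in any sequential form of the derivation is included. -/
def Deriv.occurring {𝒱 : Type u} {S : System 𝒱} :
    {G H : LGraph 𝒱} → Deriv S G H → Set (LGraph 𝒱)
  | _, _, .graph G => {G}
  | _, _, @Deriv.comp _ _ ι _ P _ _ D =>
      {Y | ∃ X : ι → LGraph 𝒱, (∀ i, X i ∈ (D i).occurring) ∧ Y = LGraph.comp P X} ∪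
        ⋃ i, (D i).occurring
  | _, _, .step D₁ _ _ _ D₂ => D₁.occurring ∪ D₂.occurring
  | _, _, .iso D₁ _ D₂ => D₁.occurring ∪ D₂.occurring

/-- A proof of `G` is a derivation with empty premise and conclusion `G`. -/
abbrev Proof {𝒱 : Type u} (S : System 𝒱) (G : LGraph 𝒱) : Type (max u 1) :=
  Deriv S LGraph.empty G

/-- `G` is provable in `S`. -/
def Provable {𝒱 : Type u} (S : System 𝒱) (G : LGraph 𝒱) : Prop := Nonempty (Proof S G)

end GraphLogic

namespace GraphLogic

/-! The proof passes through a cut-free calculus `Seq`, whose rules act on vertex sets of one fixed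
graph `E`. Its premises are graphs induced by `E` on subsets of the conclusion, so a proof of `G` in
`Seq` only mentions induced subgraphs of `G`.

Soundness. A derivation from `G` to `H` yields a `Seq` proof of the disjoint union of the dual of
`G` and `H` (`Imp.of_deriv`). Each inference rule gives such an implication directly. Vertical
composition needs transitivity, hence cut admissibility (`IsCut.seq`). The cut formula is a module
`M` inside a context, and the induction is on the size of `M` and then on the size of the two
contexts. The cut is pushed up until `M` is principal on both sides. Two facts make this work: a
graph or its complement is connected (`Conn.of_dual`), and a module of a prime composition that
meets two fibres is the whole composition (`IsPrime.module_eq`). The latter matches the fibres of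
two principal prime rules, so that their cut splits into smaller cuts (`IsNormalCut.prime_prime`).
`Seq.composed` restores prime rules that have lost some of their components.

Analyticity. A `Seq` proof is translated back into open deduction (`Seq.anProvable`); the
translation uses the rules of `GS` only, never `ssUp`. The graphs that arise are in general not
induced subgraphs of `G`, but each is `Good`: all its prime induced subgraphs embed into `G`. The
reason is that a prime graph inside a composition lies in a single component or meets each component
at most once (`Good.comp`, `IsComposed.good`). A connector of a graph is a prime induced subgraph of
it, and a prime induced subgraph of `G` embeds into some connector of `G`
(`IsPrime.exists_connector`), so connectors of good graphs are subconnectors of `G`. -/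

theorem Atom.dual_dual {𝒱 : Type u} (a : Atom 𝒱) : a.dual.dual = a := by
  cases a <;> rfl

/-! ### The cut-free calculus and its generalised prime rule. -/

section Sequents

variable {𝒱 : Type u} {V : Type}

/-- `W` and `B` are disjoint, and the edges between them are those between `W ∩ K`, which is
isolated from the rest of `W`, and `B ∩ S`. -/
structure IsPlug (E : SimpleGraph V) (W B K S : Set V) : Prop where
  disj : ∀ x ∈ W, x ∉ B
  adj : ∀ w ∈ W, ∀ b ∈ B, (E.Adj w b ↔ w ∈ K ∧ b ∈ S)
  sep : ∀ x ∈ W, ∀ y ∈ W, x ∈ K → y ∉ K → ¬ E.Adj x y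

/-- The graph induced on `W` is the disjoint union of a composition via the complement of `P` (the
vertices of sort `some false`), a composition via `P` (the vertices of sort `some true`), and graphs
that each live over one vertex of `P` (the vertices of sort `none`). -/
structure IsComposed {ι : Type} (E : SimpleGraph V) (P : SimpleGraph ι) (π : V → ι)
    (s : V → Option Bool) (W : Set V) : Prop where
  adj : ∀ x ∈ W, ∀ y ∈ W, π x ≠ π y →
    (E.Adj x y ↔ ∃ b, s x = some b ∧ s y = some b ∧ (P.Adj (π x) (π y) ↔ b = true))
  sort : ∀ x ∈ W, ∀ y ∈ W, E.Adj x y → s x = s y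

/-- Cut-free provability of the graphs induced by `E` on sets of vertices, in the style of a
sequent calculus: every premise is an induced subgraph of the conclusion. -/
inductive Seq (E : SimpleGraph V) (lab : V → Atom 𝒱) : Set V → Prop
  | empty : Seq E lab ∅
  | ax {x y : V} (hne : x ≠ y) (h : ¬ E.Adj x y) (hl : lab y = (lab x).dual) : Seq E lab {x, y}
  | plug {W B K S : Set V} (h : IsPlug E W B K S) (hW : W.Nonempty) (hB : B.Nonempty)
      (hTW : Seq E lab W) (hTB : Seq E lab B) : Seq E lab (W ∪ B)
  | prime {ι : Type} [Finite ι] {P : SimpleGraph ι} {π : V → ι} {s : V → Option Bool} {W : Set V}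
      (hP : IsPrime P) (hcard : 4 ≤ Nat.card ι) (h : IsComposed E P π s W)
      (hne : ∀ i b, ∃ x ∈ W, π x = i ∧ s x = some b)
      (hT : ∀ i, Seq E lab (W ∩ π ⁻¹' {i})) : Seq E lab W

theorem IsPlug.pullback {V' : Type} {E : SimpleGraph V} {E' : SimpleGraph V'} {g : V' → V}
    {W B K S : Set V} (h : IsPlug E W B K S) {X : Set V'}
    (hadj : ∀ x ∈ X, ∀ y ∈ X, (E'.Adj x y ↔ E.Adj (g x) (g y))) :
    IsPlug E' (X ∩ g ⁻¹' W) (X ∩ g ⁻¹' B) (g ⁻¹' K) (g ⁻¹' S) where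
  disj x hx hb := h.disj _ hx.2 hb.2
  adj w hw b hb := (hadj _ hw.1 _ hb.1).trans (h.adj _ hw.2 _ hb.2)
  sep x hx y hy hxK hyK ha := h.sep _ hx.2 _ hy.2 hxK hyK ((hadj _ hx.1 _ hy.1).1 ha)

/-- Provability is transported backwards along label-preserving embeddings. -/
theorem Seq.pullback {V' : Type} {E : SimpleGraph V} {lab : V → Atom 𝒱} {W : Set V}
    (h : Seq E lab W) {E' : SimpleGraph V'} {lab' : V' → Atom 𝒱} (g : V' → V) {X : Set V'}
    (hinj : Set.InjOn g X) (hX : g '' X = W)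
    (hadj : ∀ x ∈ X, ∀ y ∈ X, (E'.Adj x y ↔ E.Adj (g x) (g y)))
    (hlab : ∀ x ∈ X, lab' x = lab (g x)) : Seq E' lab' X := by
  induction h generalizing X with
  | empty =>
    obtain rfl : X = ∅ := by simpa using hX
    exact .empty
  | @ax x y hne h hl =>
    obtain ⟨x', hx', rfl⟩ : x ∈ g '' X := by rw [hX]; simp
    obtain ⟨y', hy', rfl⟩ : y ∈ g '' X := by rw [hX]; simp
    have hXe : X = {x', y'} := by
      ext z
      constructor
      · intro hz
        have : g z ∈ g '' X := ⟨z, hz, rfl⟩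
        rw [hX] at this
        rcases this with h1 | h1
        · exact Or.inl (hinj hz hx' h1)
        · exact Or.inr (hinj hz hy' h1)
      · rintro (rfl | rfl) <;> assumption
    rw [hXe]
    refine .ax (fun h => hne (by rw [h])) ?_ ?_
    · rwa [hadj _ hx' _ hy']
    · rw [hlab _ hx', hlab _ hy', hl]
  | @plug W B K S h hW hB hTW hTB ihW ihB =>
    have hXe : X = (X ∩ g ⁻¹' W) ∪ (X ∩ g ⁻¹' B) := by
      rw [← Set.inter_union_distrib_left, ← Set.preimage_union, ← hX]
      exact (Set.inter_eq_left.2 (Set.subset_preimage_image g X)).symm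
    have hWi : g '' (X ∩ g ⁻¹' W) = W := by
      rw [Set.image_inter_preimage, hX]; simp
    have hBi : g '' (X ∩ g ⁻¹' B) = B := by
      rw [Set.image_inter_preimage, hX]; simp
    rw [hXe]
    refine .plug (h.pullback hadj) ?_ ?_ ?_ ?_
    · rw [← hWi] at hW; exact hW.of_image
    · rw [← hBi] at hB; exact hB.of_image
    · exact ihW (hinj.mono Set.inter_subset_left) hWi (fun x hx y hy => hadj x hx.1 y hy.1)
        fun x hx => hlab x hx.1
    · exact ihB (hinj.mono Set.inter_subset_left) hBi (fun x hx y hy => hadj x hx.1 y hy.1)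
        fun x hx => hlab x hx.1
  | @prime ι _ P π s W hP hcard h hne hT ih =>
    subst hX
    refine .prime (P := P) (π := π ∘ g) (s := s ∘ g) hP hcard ⟨?_, ?_⟩ ?_ ?_
    · intro x hx y hy hxy
      rw [hadj x hx y hy]
      exact h.adj _ ⟨x, hx, rfl⟩ _ ⟨y, hy, rfl⟩ hxy
    · intro x hx y hy hxy
      exact h.sort _ ⟨x, hx, rfl⟩ _ ⟨y, hy, rfl⟩ ((hadj x hx y hy).1 hxy)
    · intro i b
      obtain ⟨_, ⟨x, hx, rfl⟩, h1, h2⟩ := hne i b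
      exact ⟨x, hx, h1, h2⟩
    · intro i
      refine ih i (hinj.mono Set.inter_subset_left) ?_ (fun x hx y hy => hadj x hx.1 y hy.1)
        fun x hx => hlab x hx.1
      rw [Set.preimage_comp, Set.image_inter_preimage]

theorem Seq.congr {E E' : SimpleGraph V} {lab : V → Atom 𝒱} {W : Set V} (h : Seq E lab W)
    (hadj : ∀ x ∈ W, ∀ y ∈ W, (E'.Adj x y ↔ E.Adj x y)) : Seq E' lab W :=
  h.pullback id (Set.injOn_id _) (Set.image_id _) hadj fun _ _ => rfl

/-- Provability is transported along label-preserving embeddings. -/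
theorem Seq.image {V' : Type} {E : SimpleGraph V} {lab : V → Atom 𝒱} {W : Set V}
    (h : Seq E lab W) {E' : SimpleGraph V'} {lab' : V' → Atom 𝒱} (f : V → V')
    (hinj : Set.InjOn f W) (hadj : ∀ x ∈ W, ∀ y ∈ W, (E'.Adj (f x) (f y) ↔ E.Adj x y))
    (hlab : ∀ x ∈ W, lab' (f x) = lab x) : Seq E' lab' (f '' W) := by
  rcases W.eq_empty_or_nonempty with rfl | ⟨w, hw⟩
  · simpa using Seq.empty
  have : Nonempty V := ⟨w⟩
  have hinv := hinj.leftInvOn_invFunOn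
  refine h.pullback (Function.invFunOn f W) ?_ ?_ ?_ ?_
  · rintro _ ⟨x, hx, rfl⟩ _ ⟨y, hy, rfl⟩ hxy
    rw [hinv hx, hinv hy] at hxy
    rw [hxy]
  · exact hinv.image_image
  · rintro _ ⟨x, hx, rfl⟩ _ ⟨y, hy, rfl⟩
    rw [hinv hx, hinv hy, hadj x hx y hy]
  · rintro _ ⟨x, hx, rfl⟩
    rw [hinv hx, hlab x hx]

theorem Seq.plug_of {E : SimpleGraph V} {lab : V → Atom 𝒱} {W B K S X : Set V}
    (hTW : Seq E lab W) (hTB : Seq E lab B) (h : IsPlug E W B K S)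
    (hX : X = W ∪ B) : Seq E lab X := by
  subst hX
  rcases W.eq_empty_or_nonempty with rfl | hW
  · simpa using hTB
  rcases B.eq_empty_or_nonempty with rfl | hB
  · simpa using hTW
  exact .plug h hW hB hTW hTB

theorem IsComposed.mono {ι : Type} {E : SimpleGraph V} {P : SimpleGraph ι} {π : V → ι}
    {s : V → Option Bool} {W W' : Set V} (h : IsComposed E P π s W) (hW : W' ⊆ W) :
    IsComposed E P π s W' :=
  ⟨fun x hx y hy => h.adj x (hW hx) y (hW hy), fun x hx y hy => h.sort x (hW hx) y (hW hy)⟩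

/-- On three vertices, no two of them may form a module, so each vertex is adjacent to exactly one
of the other two. Three vertices of degree one contradict parity. -/
theorem IsPrime.four_le_card {ι : Type} {P : SimpleGraph ι} (hP : IsPrime P)
    (h : 3 ≤ Nat.card ι) : 4 ≤ Nat.card ι := by
  by_contra hlt
  have h3 : Nat.card ι = 3 := by omega
  have key : ∀ x y z : ι, (∀ w, w = x ∨ w = y ∨ w = z) → x ≠ y → x ≠ z → y ≠ z →
      ¬ (P.Adj z x ↔ P.Adj z y) := by
    intro x y z hall hxy hxz hyz hadj
    have hm : IsModule P {x, y} := by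
      intro v hv a ha b hb
      obtain rfl : v = z := by
        rcases hall v with rfl | rfl | rfl <;> simp_all
      rcases ha with rfl | rfl <;> rcases hb with rfl | rfl <;> simp [hadj]
    rcases hP.2 _ hm with h | ⟨w, h⟩ | h
    · have : x ∈ (∅ : Set ι) := h ▸ (by simp)
      exact this
    · have h1 : x ∈ ({w} : Set ι) := h ▸ (by simp)
      have h2 : y ∈ ({w} : Set ι) := h ▸ (by simp)
      exact hxy (h1.trans h2.symm)
    · have : z ∈ ({x, y} : Set ι) := h ▸ Set.mem_univ z
      rcases this with h | h
      · exact hxz h.symm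
      · exact hyz h.symm
  have : Finite ι := Nat.finite_of_card_ne_zero (by omega)
  obtain ⟨e⟩ : Nonempty (ι ≃ Fin 3) := ⟨Finite.equivFinOfCardEq h3⟩
  have hall : ∀ w, w = e.symm 0 ∨ w = e.symm 1 ∨ w = e.symm 2 := by
    intro w
    obtain ⟨k, rfl⟩ := e.symm.surjective w
    fin_cases k <;> simp
  have n01 : e.symm 0 ≠ e.symm 1 := by simp
  have n02 : e.symm 0 ≠ e.symm 2 := by simp
  have n12 : e.symm 1 ≠ e.symm 2 := by simp
  have h1 := key _ _ _ hall n01 n02 n12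
  have h2 := key (e.symm 0) (e.symm 2) (e.symm 1)
    (fun w => by rcases hall w with h | h | h <;> simp [h]) n02 n01 n12.symm
  have h3 := key (e.symm 1) (e.symm 2) (e.symm 0)
    (fun w => by rcases hall w with h | h | h <;> simp [h]) n12 n01.symm n02.symm
  simp only [P.adj_comm] at h1 h2 h3
  have c1 := P.adj_comm (e.symm 0) (e.symm 1)
  have c2 := P.adj_comm (e.symm 0) (e.symm 2)
  have c3 := P.adj_comm (e.symm 1) (e.symm 2)
  tauto

/-- Auxiliary form of `Seq.composed`, by induction on the number of vertices of `Q` in use. -/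
theorem Seq.composed_aux {ι : Type} [Finite ι] {E : SimpleGraph V} {lab : V → Atom 𝒱}
    {Q : SimpleGraph ι} {s : V → Option Bool} (n : ℕ) :
    ∀ (J : Set ι) (π : V → ι) (W : Set V), J.ncard = n → (∀ x ∈ W, π x ∈ J) →
      IsComposed E Q π s W → (∀ i ∈ J, Seq E lab (W ∩ π ⁻¹' {i})) → Seq E lab W := by
  induction n using Nat.strong_induction_on with
  | _ n ih =>
  intro J π W hJ hW h hT
  have hsub : ∀ I ⊆ J, I.ncard < n → Seq E lab (W ∩ π ⁻¹' I) := by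
    intro I hI hlt
    refine ih _ hlt I π _ rfl (fun x hx => hx.2) (h.mono Set.inter_subset_left) fun i hi => ?_
    convert hT i (hI hi) using 1
    ext x
    simp only [Set.mem_inter_iff, Set.mem_preimage, Set.mem_singleton_iff]
    constructor
    · rintro ⟨⟨h1, h2⟩, h3⟩; exact ⟨h1, h3⟩
    · rintro ⟨h1, rfl⟩; exact ⟨⟨h1, hi⟩, rfl⟩
  -- splitting off one vertex whose edges to the rest have a single sort
  have hsplit : ∀ i ∈ J, ∀ b, (∀ x ∈ W, ∀ y ∈ W, π x = i → π y ≠ i → E.Adj x y → s x = some b) →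
      Seq E lab W := by
    intro i hi b hb
    have hlt : (J \ {i}).ncard < n := by
      rw [← hJ]; exact Set.ncard_sdiff_singleton_lt_of_mem hi
    refine Seq.plug_of (hT i hi) (hsub _ Set.sdiff_subset hlt)
      (K := {x | s x = some b})
      (S := {y | s y = some b ∧ (Q.Adj i (π y) ↔ b = true)}) ⟨?_, ?_, ?_⟩ ?_
    · rintro x ⟨_, h1⟩ ⟨_, h2⟩
      exact h2.2 h1
    · rintro w ⟨hw, hwi⟩ y ⟨hy, hyi⟩
      have hwi' : π w = i := hwi
      subst hwi'
      have hne : π w ≠ π y := fun h => hyi.2 h.symm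
      constructor
      · intro ha
        have hs := hb w hw y hy rfl hne.symm ha
        obtain ⟨b', h1, h2, h3⟩ := (h.adj w hw y hy hne).1 ha
        obtain rfl : b = b' := by simpa using hs.symm.trans h1
        exact ⟨h1, h2, h3⟩
      · rintro ⟨h1, h2, h3⟩
        exact (h.adj w hw y hy hne).2 ⟨b, h1, h2, h3⟩
    · rintro x ⟨hx, -⟩ y ⟨hy, -⟩ h1 h2 ha
      exact h2 ((h.sort x hx y hy ha).symm.trans h1)
    · ext x
      simp only [Set.mem_union, Set.mem_inter_iff, Set.mem_preimage, Set.mem_singleton_iff,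
        Set.mem_sdiff]
      constructor
      · intro hx
        by_cases hi : π x = i
        · exact Or.inl ⟨hx, hi⟩
        · exact Or.inr ⟨hx, hW x hx, hi⟩
      · rintro (h | h) <;> exact h.1
  by_cases hne : ∀ i ∈ J, ∀ b, ∃ x ∈ W, π x = i ∧ s x = some b
  swap
  · push Not at hne
    obtain ⟨i, hi, b, hb⟩ := hne
    -- The sort `some b` is missing over `i`, so all edges leaving this fibre have the opposite
    -- sort.
    refine hsplit i hi (!b) fun x hx y hy hxi hyi ha => ?_
    obtain ⟨b', h1, -, -⟩ := (h.adj x hx y hy (by rw [hxi]; exact hyi.symm)).1 ha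
    have := hb x hx hxi
    rw [h1] at this ⊢
    cases b <;> cases b' <;> simp_all
  have hcardJ : Nat.card J = n := by rw [Nat.card_coe_set_eq, hJ]
  by_cases hP : IsPrime (Q.induce J) ∧ 3 ≤ n
  · obtain ⟨hP, hn⟩ := hP
    obtain ⟨⟨j, hj⟩⟩ : Nonempty J := by
      rw [← Finite.card_pos_iff]; omega
    classical
    let π' : V → J := fun x => if hx : π x ∈ J then ⟨π x, hx⟩ else ⟨j, hj⟩
    have hπ : ∀ x ∈ W, ((π' x : J) : ι) = π x := by
      intro x hx
      simp [π', hW x hx]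
    have hπne : ∀ x ∈ W, ∀ y ∈ W, π' x ≠ π' y → π x ≠ π y := by
      intro x hx y hy h1 h2
      apply h1
      apply Subtype.ext
      rw [hπ x hx, hπ y hy, h2]
    refine .prime (P := Q.induce J) (π := π') (s := s) hP (hP.four_le_card (by omega))
      ⟨?_, h.sort⟩ ?_ ?_
    · intro x hx y hy hxy
      rw [h.adj x hx y hy (hπne x hx y hy hxy)]
      simp only [SimpleGraph.comap_adj, Function.Embedding.subtype_apply, hπ x hx, hπ y hy]
    · rintro ⟨i, hi⟩ b
      obtain ⟨x, hx, h1, h2⟩ := hne i hi b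
      exact ⟨x, hx, Subtype.ext ((hπ x hx).trans h1), h2⟩
    · rintro ⟨i, hi⟩
      convert hT i hi using 1
      ext x
      simp only [Set.mem_inter_iff, Set.mem_preimage, Set.mem_singleton_iff]
      constructor
      · rintro ⟨hx, h1⟩
        exact ⟨hx, by rw [← hπ x hx, h1]⟩
      · rintro ⟨hx, h1⟩
        exact ⟨hx, Subtype.ext ((hπ x hx).trans h1)⟩
  by_cases hn : 3 ≤ n
  · -- a nontrivial module
    have hP' : ¬ IsPrime (Q.induce J) := fun h => hP ⟨h, hn⟩
    unfold IsPrime at hP'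
    push Not at hP'
    obtain ⟨I', hI', hI0, hI1, hI2⟩ := hP' (by omega)
    set I : Set ι := Subtype.val '' I' with hIdef
    have hIJ : I ⊆ J := by rintro _ ⟨x, -, rfl⟩; exact x.2
    have hmod : ∀ v ∈ J, v ∉ I → ∀ x ∈ I, ∀ y ∈ I, (Q.Adj v x ↔ Q.Adj v y) := by
      rintro v hv hvI _ ⟨x, hx, rfl⟩ _ ⟨y, hy, rfl⟩
      exact hI' ⟨v, hv⟩ (fun h => hvI ⟨_, h, rfl⟩) x hx y hy
    obtain ⟨i0, hi0⟩ : ∃ i0, i0 ∈ I := hI0.elim fun x hx => ⟨_, x, hx, rfl⟩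
    have hIlt : I.ncard < n := by
      rw [← hJ]
      refine Set.ncard_lt_ncard (hIJ.ssubset_of_ne fun h => hI2 ?_)
      ext x
      have : (x : ι) ∈ I := h.symm.subset x.2
      obtain ⟨y, hy, hxy⟩ := this
      rw [Subtype.ext hxy] at hy
      simp [hy]
    obtain ⟨i1, hi1, hi10⟩ : ∃ i1 ∈ I, i1 ≠ i0 := by
      by_contra hcon
      push Not at hcon
      refine hI1 ⟨i0, hIJ hi0⟩ ?_
      ext x
      constructor
      · intro hx
        exact Subtype.ext (hcon x ⟨x, hx, rfl⟩)
      · intro hx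
        obtain ⟨y, hy, h⟩ := hi0
        rwa [hx, ← Subtype.ext (a1 := y) (a2 := ⟨i0, _⟩) h]
    classical
    -- The fibres over the module `I` are merged over the representative `i0`. The merged fibre is
    -- provable by `hsub`, and the new index set has lost `i1`.
    let π' : V → ι := fun x => if π x ∈ I then i0 else π x
    have hπ'I : ∀ x, π x ∈ I → π' x = i0 := fun x hx => by simp [π', hx]
    have hπ'n : ∀ x, π x ∉ I → π' x = π x := fun x hx => by simp [π', hx]
    let J' : Set ι := (J \ I) ∪ {i0}
    have hJ'lt : J'.ncard < n := by
      rw [← hJ]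
      refine Set.ncard_lt_ncard (Set.ssubset_iff_subset_ne.2 ⟨?_, ?_⟩)
      · rintro x (hx | rfl)
        · exact hx.1
        · exact hIJ hi0
      · intro h
        have : i1 ∈ J' := h ▸ hIJ hi1
        rcases this with h | h
        · exact h.2 hi1
        · exact hi10 h
    refine ih _ hJ'lt J' π' W rfl ?_ ⟨?_, h.sort⟩ ?_
    · intro x hx
      by_cases hxI : π x ∈ I
      · rw [hπ'I x hxI]; exact Or.inr rfl
      · rw [hπ'n x hxI]; exact Or.inl ⟨hW x hx, hxI⟩
    · intro x hx y hy hxy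
      by_cases hxI : π x ∈ I
      · by_cases hyI : π y ∈ I
        · exact absurd ((hπ'I x hxI).trans (hπ'I y hyI).symm) hxy
        · have hne' : π x ≠ π y := fun h => hyI (h ▸ hxI)
          rw [h.adj x hx y hy hne', hπ'I x hxI, hπ'n y hyI, Q.adj_comm, Q.adj_comm i0,
            hmod (π y) (hW y hy) hyI _ hxI _ hi0]
      · by_cases hyI : π y ∈ I
        · have hne' : π x ≠ π y := fun h => hxI (h ▸ hyI)
          rw [h.adj x hx y hy hne', hπ'n x hxI, hπ'I y hyI,
            hmod (π x) (hW x hx) hxI _ hyI _ hi0]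
        · rw [hπ'n x hxI, hπ'n y hyI] at hxy ⊢
          exact h.adj x hx y hy hxy
    · rintro i (hi | rfl)
      · convert hT i hi.1 using 1
        ext x
        simp only [Set.mem_inter_iff, Set.mem_preimage, Set.mem_singleton_iff]
        by_cases hxI : π x ∈ I
        · rw [hπ'I x hxI]
          refine and_congr_right fun _ => ⟨fun h => ?_, fun h => ?_⟩
          · exact absurd (h ▸ hi0) hi.2
          · exact absurd (h ▸ hxI) hi.2
        · rw [hπ'n x hxI]
      · convert hsub I hIJ hIlt using 1
        ext x
        simp only [Set.mem_inter_iff, Set.mem_preimage, Set.mem_singleton_iff]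
        refine and_congr_right fun _ => ?_
        by_cases hxI : π x ∈ I
        · simp [hπ'I x hxI, hxI]
        · rw [hπ'n x hxI]
          exact ⟨fun h => h ▸ hi0, fun h => absurd h hxI⟩
  -- At most two indices remain, so all edges leaving the fibre over `i` have the one sort
  -- determined by adjacency in `Q`.
  · rcases J.eq_empty_or_nonempty with rfl | ⟨i, hi⟩
    · obtain rfl : W = ∅ := by
        ext x
        exact ⟨fun hx => hW x hx, fun hx => hx.elim⟩
      exact .empty
    · by_cases hb : ∀ j ∈ J, j ≠ i → Q.Adj i j
      · refine hsplit i hi true fun x hx y hy hxi hyi ha => ?_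
        obtain ⟨b', h1, -, h3⟩ := (h.adj x hx y hy (by rw [hxi]; exact hyi.symm)).1 ha
        have := hb (π y) (hW y hy) hyi
        rw [hxi] at h3
        rw [h1, h3.1 this]
      · push Not at hb
        obtain ⟨j, hj, hji, hnadj⟩ := hb
        refine hsplit i hi false fun x hx y hy hxi hyi ha => ?_
        obtain ⟨b', h1, -, h3⟩ := (h.adj x hx y hy (by rw [hxi]; exact hyi.symm)).1 ha
        obtain hyj : π y = j := by
          by_contra hyj
          have h3 : ({i, j, π y} : Set ι).ncard = 3 :=
            Set.ncard_eq_three.2 ⟨i, j, π y, hji.symm, hyi.symm, fun h => hyj h.symm, rfl⟩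
          have : ({i, j, π y} : Set ι).ncard ≤ J.ncard :=
            Set.ncard_le_ncard (by
              rintro z (rfl | rfl | rfl)
              exacts [hi, hj, hW y hy])
          omega
        rw [hxi, hyj] at h3
        cases b' with
        | false => exact h1
        | true => exact absurd (h3.2 rfl) hnadj

/-- The prime rule is admissible for all finite graphs, without non-emptiness conditions. -/
theorem Seq.composed {ι : Type} [Finite ι] {E : SimpleGraph V} {lab : V → Atom 𝒱}
    {Q : SimpleGraph ι} {π : V → ι} {s : V → Option Bool} {W : Set V}
    (h : IsComposed E Q π s W) (hT : ∀ i, Seq E lab (W ∩ π ⁻¹' {i})) : Seq E lab W :=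
  Seq.composed_aux _ Set.univ π W rfl (fun _ _ => Set.mem_univ _) h fun i _ => hT i

end Sequents

end GraphLogic

namespace GraphLogic

/-! ### Cuts in context, and cuts against a plug rule. -/

section Cut

variable {𝒱 : Type u} {V : Type}

/-- The configuration of a cut in context: `M` is a module of the graph on `Q ∪ M` with set of
neighbours `S`, its dual copy `φ ⁻¹' M` is a module of the graph on `R ∪ φ ⁻¹' M` with set of
neighbours `S'`, and the graph on `Q ∪ R` has `F ⊆ R` in the place of `M`. -/
structure IsCut (E : SimpleGraph V) (lab : V → Atom 𝒱) (φ : V → V) (Q M R S S' F : Set V) :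
    Prop where
  disjQM : ∀ x ∈ Q, x ∉ M
  disjQR : ∀ x ∈ Q, x ∉ R
  disjRM : ∀ x ∈ R, x ∉ M
  disjQN : ∀ x ∈ Q, φ x ∉ M
  disjRN : ∀ x ∈ R, φ x ∉ M
  disjMN : ∀ x ∈ M, φ x ∉ M
  modM : ∀ q ∈ Q, ∀ m ∈ M, (E.Adj q m ↔ q ∈ S)
  modN : ∀ r ∈ R, ∀ m ∈ M, (E.Adj r (φ m) ↔ r ∈ S')
  cross : ∀ q ∈ Q, ∀ r ∈ R, (E.Adj q r ↔ q ∈ S ∧ r ∈ F)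
  sep : ∀ r ∈ R, ∀ r' ∈ R, r ∈ F → r' ∉ F → ¬ E.Adj r r'
  sub : ∀ r ∈ R, r ∈ S' → r ∈ F
  dual : ∀ x ∈ M, ∀ y ∈ M, x ≠ y → (E.Adj (φ x) (φ y) ↔ ¬ E.Adj x y)
  label : ∀ x ∈ M, lab (φ x) = (lab x).dual

/-- In a normal cut the irrelevant edges are those that the two copies of `M` suggest. -/
structure IsNormalCut (E : SimpleGraph V) (lab : V → Atom 𝒱) (φ : V → V) (Q M R S S' F : Set V) :
    Prop extends IsCut E lab φ Q M R S S' F where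
  adjQN : ∀ q ∈ Q, ∀ m ∈ M, (E.Adj q (φ m) ↔ q ∈ S)
  adjRM : ∀ r ∈ R, ∀ m ∈ M, (E.Adj r m ↔ r ∈ S')

/-- No proper part of `M` is isolated from the rest of `M`. -/
def Conn (E : SimpleGraph V) (M : Set V) : Prop :=
  ∀ Z : Set V, (∃ x ∈ M, x ∈ Z) → (∃ x ∈ M, x ∉ Z) → ∃ x ∈ M, ∃ y ∈ M, x ∈ Z ∧ y ∉ Z ∧ E.Adj x y

/-- The last rule is a prime rule with `M` as one of the two compositions. -/
def PrimePrincipal (E : SimpleGraph V) (lab : V → Atom 𝒱) (W M : Set V) : Prop :=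
  ∃ (ι : Type) (_ : Finite ι) (P : SimpleGraph ι) (π : V → ι) (s : V → Option Bool) (b : Bool),
    IsPrime P ∧ 4 ≤ Nat.card ι ∧ IsComposed E P π s W ∧ (∀ i b, ∃ x ∈ W, π x = i ∧ s x = some b) ∧
      (∀ i, Seq E lab (W ∩ π ⁻¹' {i})) ∧ ∀ x, x ∈ M ↔ x ∈ W ∧ s x = some b

/-- The last rule is an axiom with `M` as one of its two vertices. -/
def AxPrincipal (E : SimpleGraph V) (lab : V → Atom 𝒱) (Q M : Set V) : Prop :=
  ∃ x y, Q = {y} ∧ M = {x} ∧ ¬ E.Adj y x ∧ lab y = (lab x).dual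

/-- The cut rule for modules with fewer than `k` vertices, and for modules with `k` vertices in
contexts with fewer than `l` vertices. -/
def CutBelow (lab : V → Atom 𝒱) (φ : V → V) (k l : ℕ) : Prop :=
  ∀ (E : SimpleGraph V) (Q M R S S' F : Set V), IsCut E lab φ Q M R S S' F →
    (M.ncard < k ∨ M.ncard = k ∧ Q.ncard + R.ncard < l) →
    Seq E lab (Q ∪ M) → Seq E lab (R ∪ φ ⁻¹' M) → Seq E lab (Q ∪ R)

variable {E : SimpleGraph V} {lab : V → Atom 𝒱} {φ : V → V} {Q M R S S' F : Set V}

theorem IsCut.mono (h : IsCut E lab φ Q M R S S' F) {Q' : Set V} (hQ : Q' ⊆ Q) :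
    IsCut E lab φ Q' M R S S' F where
  disjQM x hx := h.disjQM x (hQ hx)
  disjQR x hx := h.disjQR x (hQ hx)
  disjRM := h.disjRM
  disjQN x hx := h.disjQN x (hQ hx)
  disjRN := h.disjRN
  disjMN := h.disjMN
  modM q hq := h.modM q (hQ hq)
  modN := h.modN
  cross q hq := h.cross q (hQ hq)
  sep := h.sep
  sub := h.sub
  dual := h.dual
  label := h.label

/-- The image of `M` in `P` is a module with at least two elements, hence everything; complementing
`P` does not change its modules. A vertex `x` of sort `some b` outside `M` would then see all other
fibres alike. So `{π x}ᶜ` would be a module, nontrivial since `P` has at least four vertices. -/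
theorem IsPrime.module_eq {ι : Type} [Finite ι] {P : SimpleGraph ι} (hP : IsPrime P)
    (hcard : 4 ≤ Nat.card ι) {π : V → ι} {s : V → Option Bool} {W : Set V}
    (h : IsComposed E P π s W) (hne : ∀ i b, ∃ x ∈ W, π x = i ∧ s x = some b) {b : Bool}
    (hM : ∀ x ∈ M, x ∈ W ∧ s x = some b)
    (hmod : ∀ v ∈ W, s v = some b → v ∉ M → ∀ x ∈ M, ∀ y ∈ M, (E.Adj v x ↔ E.Adj v y))
    {x₀ y₀ : V} (hx₀ : x₀ ∈ M) (hy₀ : y₀ ∈ M) (hne₀ : π x₀ ≠ π y₀) {x : V} (hx : x ∈ W)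
    (hs : s x = some b) : x ∈ M := by
  have hadj : ∀ x ∈ W, ∀ y ∈ W, s x = some b → s y = some b → π x ≠ π y →
      (E.Adj x y ↔ (P.Adj (π x) (π y) ↔ b = true)) := by
    intro x hx y hy h1 h2 h3
    rw [h.adj x hx y hy h3]
    constructor
    · rintro ⟨b', h4, -, h5⟩
      obtain rfl : b = b' := by simpa using h1.symm.trans h4
      exact h5
    · intro h4
      exact ⟨b, h1, h2, h4⟩
  have hI : ∀ i, ∃ m ∈ M, π m = i := by
    have hm : IsModule P {i | ∃ m ∈ M, π m = i} := by
      rintro v hv _ ⟨m, hm, rfl⟩ _ ⟨m', hm', rfl⟩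
      obtain ⟨x, hx, rfl, hsx⟩ := hne v b
      have hxM : x ∉ M := fun hxM => hv ⟨x, hxM, rfl⟩
      have h1 : π x ≠ π m := fun h => hv ⟨m, hm, h.symm⟩
      have h2 : π x ≠ π m' := fun h => hv ⟨m', hm', h.symm⟩
      have h3 := hadj x hx m (hM m hm).1 hsx (hM m hm).2 h1
      have h4 := hadj x hx m' (hM m' hm').1 hsx (hM m' hm').2 h2
      have h5 := hmod x hx hsx hxM m hm m' hm'
      rw [h3, h4] at h5
      tauto
    rcases hP.2 _ hm with h | ⟨i, h⟩ | h
    · have : π x₀ ∈ (∅ : Set ι) := h ▸ ⟨x₀, hx₀, rfl⟩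
      exact this.elim
    · have h1 : π x₀ ∈ ({i} : Set ι) := h ▸ ⟨x₀, hx₀, rfl⟩
      have h2 : π y₀ ∈ ({i} : Set ι) := h ▸ ⟨y₀, hy₀, rfl⟩
      exact absurd (h1.trans h2.symm) hne₀
    · intro i
      have : i ∈ (Set.univ : Set ι) := Set.mem_univ i
      rw [← h] at this
      exact this
  by_contra hxM
  have hm : IsModule P {π x}ᶜ := by
    intro v hv i hi j hj
    obtain rfl : v = π x := by simpa using hv
    obtain ⟨m, hm, rfl⟩ := hI i
    obtain ⟨m', hm', rfl⟩ := hI j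
    have h3 := hadj x hx m (hM m hm).1 hs (hM m hm).2 fun h => hi h.symm
    have h4 := hadj x hx m' (hM m' hm').1 hs (hM m' hm').2 fun h => hj h.symm
    have h5 := hmod x hx hs hxM m hm m' hm'
    rw [h3, h4] at h5
    tauto
  have hc : ({π x}ᶜ : Set ι).ncard = Nat.card ι - 1 := by
    rw [Set.ncard_compl, Set.ncard_singleton]
  rcases hP.2 _ hm with h | ⟨i, h⟩ | h
  · rw [h, Set.ncard_empty] at hc; omega
  · rw [h, Set.ncard_singleton] at hc; omega
  · rw [h, Set.ncard_univ] at hc; omega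

/-- The cut is moved into the premise on `W`, whose context is smaller, and the plug with `B` is
redone afterwards. -/
theorem IsNormalCut.plug_within [Finite V] {W B K S₀ : Set V}
    (h : IsNormalCut E lab φ Q M R S S' F)
    (ih : CutBelow lab φ M.ncard (Q.ncard + R.ncard)) (hM : M.Nonempty)
    (hT' : Seq E lab (R ∪ φ ⁻¹' M)) (hp : IsPlug E W B K S₀) (hB : B.Nonempty)
    (hTW : Seq E lab W) (hTB : Seq E lab B) (hX : Q ∪ M = W ∪ B) (hMW : M ⊆ W) :
    Seq E lab (Q ∪ R) := by
  have hmem : ∀ x, (x ∈ Q ∨ x ∈ M) ↔ (x ∈ W ∨ x ∈ B) := fun x => by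
    rw [← Set.mem_union, hX, Set.mem_union]
  have hBQ : ∀ x ∈ B, x ∈ Q := fun x hx => by
    rcases (hmem x).2 (Or.inr hx) with h1 | h1
    · exact h1
    · exact absurd hx (hp.disj x (hMW h1))
  have hlt : (Q ∩ W).ncard < Q.ncard := by
    obtain ⟨b, hb⟩ := hB
    exact Set.ncard_lt_ncard (Set.ssubset_iff_of_subset Set.inter_subset_left |>.2
      ⟨b, hBQ b hb, fun h' => hp.disj b h'.2 hb⟩)
  have hTA : Seq E lab ((Q ∩ W) ∪ R) := by
    refine ih E _ M R S S' F (h.mono Set.inter_subset_left) (Or.inr ⟨rfl, by omega⟩) ?_ hT'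
    convert hTW using 1
    ext x
    have := hmem x
    have := h.disjQM x
    have := hp.disj x
    have := @hMW x
    simp only [Set.mem_union, Set.mem_inter_iff]
    tauto
  obtain ⟨m₀, hm₀⟩ := hM
  refine Seq.plug_of hTA hTB
    -- `F` takes the place of `M`, so it joins `K` as soon as some vertex of `M` is in `K`. If `M`
    -- is only partly in `K`, being a module forces that no edge runs between `W` and `B`, and the
    -- choice is harmless.
    (K := {x | (x ∈ W ∧ x ∈ K) ∨ (x ∈ R ∧ x ∈ F ∧ ∃ m ∈ M, m ∈ K)}) (S := S₀) ⟨?_, ?_, ?_⟩ ?_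
  · rintro x (hx | hx) hxB
    · exact hp.disj x hx.2 hxB
    · exact h.disjQR x (hBQ x hxB) hx
  · rintro x (hx | hx) b hb
    · rw [hp.adj x hx.2 b hb]
      have := h.disjQR x hx.1
      have := hx.2
      simp only [Set.mem_ofPred_eq]
      tauto
    · have hbQ := hBQ b hb
      have hxW : x ∉ W := fun hxW => by
        rcases (hmem x).2 (Or.inl hxW) with h1 | h1
        · exact h.disjQR x h1 hx
        · exact h.disjRM x hx h1
      rw [E.adj_comm, h.cross b hbQ x hx]
      have hS : ∀ m ∈ M, (b ∈ S ↔ m ∈ K ∧ b ∈ S₀) := fun m hm => by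
        rw [← h.modM b hbQ m hm, E.adj_comm, hp.adj m (hMW hm) b hb]
      simp only [Set.mem_ofPred_eq]
      constructor
      · rintro ⟨h1, h2⟩
        have := (hS m₀ hm₀).1 h1
        exact ⟨Or.inr ⟨hx, h2, m₀, hm₀, this.1⟩, this.2⟩
      · rintro ⟨h1 | ⟨-, h1, m, hm, h2⟩, h3⟩
        · exact absurd h1.1 hxW
        · exact ⟨(hS m hm).2 ⟨h2, h3⟩, h1⟩
  · have hmix : ∀ x ∈ Q, x ∈ W → ∀ y ∈ R, E.Adj x y →
        y ∈ F ∧ ∀ m ∈ M, (x ∈ K ↔ m ∈ K) := by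
      intro x hxQ hxW y hy hxy
      obtain ⟨h1, h2⟩ := (h.cross x hxQ y hy).1 hxy
      refine ⟨h2, fun m hm => ?_⟩
      have hxm := (h.modM x hxQ m hm).2 h1
      constructor
      · intro h3
        by_contra h4
        exact hp.sep x hxW m (hMW hm) h3 h4 hxm
      · intro h3
        by_contra h4
        exact hp.sep m (hMW hm) x hxW h3 h4 hxm.symm
    have hRW : ∀ x ∈ R, x ∉ W := fun x hx hxW => by
      rcases (hmem x).2 (Or.inl hxW) with h1 | h1
      · exact h.disjQR x h1 hx
      · exact h.disjRM x hx h1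
    rintro x (hx | hx) y (hy | hy) hxK hyK hxy
    · rcases hxK with hxK | hxK
      · exact hp.sep x hx.2 y hy.2 hxK.2 (fun h' => hyK (Or.inl ⟨hy.2, h'⟩)) hxy
      · exact h.disjQR x hx.1 hxK.1
    · obtain ⟨h1, h2⟩ := hmix x hx.1 hx.2 y hy hxy
      rcases hxK with hxK | hxK
      · exact hyK (Or.inr ⟨hy, h1, m₀, hm₀, (h2 m₀ hm₀).1 hxK.2⟩)
      · exact h.disjQR x hx.1 hxK.1
    · obtain ⟨h1, h2⟩ := hmix y hy.1 hy.2 x hx hxy.symm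
      rcases hxK with hxK | ⟨-, -, m, hm, hmK⟩
      · exact hRW x hx hxK.1
      · exact hyK (Or.inl ⟨hy.2, (h2 m hm).2 hmK⟩)
    · rcases hxK with hxK | ⟨-, h1, h2⟩
      · exact hRW x hx hxK.1
      · exact h.sep x hx y hy h1 (fun h' => hyK (Or.inr ⟨hy, h', h2⟩)) hxy
  · ext x
    have := hmem x
    have := hBQ x
    have := @hMW x
    have := h.disjQM x
    simp only [Set.mem_union, Set.mem_inter_iff]
    tauto

/-- Here the cut moves into the premise on `B`. Since `F` replaces `M`, it becomes a neighbour of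
the plugged part `K` exactly when `M` was one. -/
theorem IsNormalCut.plug_outside [Finite V] {W B K S₀ : Set V}
    (h : IsNormalCut E lab φ Q M R S S' F)
    (ih : CutBelow lab φ M.ncard (Q.ncard + R.ncard)) (hM : M.Nonempty)
    (hT' : Seq E lab (R ∪ φ ⁻¹' M)) (hp : IsPlug E W B K S₀) (hW : W.Nonempty)
    (hTW : Seq E lab W) (hTB : Seq E lab B) (hX : Q ∪ M = W ∪ B) (hMB : M ⊆ B) :
    Seq E lab (Q ∪ R) := by
  have hmem : ∀ x, (x ∈ Q ∨ x ∈ M) ↔ (x ∈ W ∨ x ∈ B) := fun x => by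
    rw [← Set.mem_union, hX, Set.mem_union]
  have hWQ : ∀ x ∈ W, x ∈ Q := fun x hx => by
    rcases (hmem x).2 (Or.inl hx) with h1 | h1
    · exact h1
    · exact absurd (hMB h1) (hp.disj x hx)
  have hlt : (Q ∩ B).ncard < Q.ncard := by
    obtain ⟨w, hw⟩ := hW
    exact Set.ncard_lt_ncard (Set.ssubset_iff_of_subset Set.inter_subset_left |>.2
      ⟨w, hWQ w hw, fun h' => hp.disj w hw h'.2⟩)
  have hTA : Seq E lab ((Q ∩ B) ∪ R) := by
    refine ih E _ M R S S' F (h.mono Set.inter_subset_left) (Or.inr ⟨rfl, by omega⟩) ?_ hT'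
    convert hTB using 1
    ext x
    have := hmem x
    have := h.disjQM x
    have := hp.disj x
    have := @hMB x
    simp only [Set.mem_union, Set.mem_inter_iff]
    tauto
  obtain ⟨m₀, hm₀⟩ := hM
  refine Seq.plug_of hTW hTA (K := K)
    (S := {x | (x ∈ Q ∧ x ∈ S₀) ∨ (x ∈ R ∧ x ∈ F ∧ m₀ ∈ S₀)}) ⟨?_, ?_, hp.sep⟩ ?_
  · rintro x hx (hxB | hxB)
    · exact hp.disj x hx hxB.2
    · exact h.disjQR x (hWQ x hx) hxB
  · rintro w hw x (hx | hx)
    · rw [hp.adj w hw x hx.2]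
      have := h.disjQR x hx.1
      have := hx.1
      simp only [Set.mem_ofPred_eq]
      tauto
    · rw [h.cross w (hWQ w hw) x hx, ← h.modM w (hWQ w hw) m₀ hm₀, hp.adj w hw m₀ (hMB hm₀)]
      have := h.disjQR x
      simp only [Set.mem_ofPred_eq]
      tauto
  · ext x
    have := hmem x
    have := hWQ x
    have := @hMB x
    have := h.disjQM x
    simp only [Set.mem_union, Set.mem_inter_iff]
    tauto

-- When the plug divides `M`, two cuts on the proper parts `M ∩ W` and `M ∩ B` replace the cut on
-- `M`. What the first cut leaves over becomes part of the right-hand context of the second. This is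
-- why cuts need the general form with a set `F` that is plugged into the left context.
set_option maxHeartbeats 1000000 in
theorem IsNormalCut.plug_crossing [Finite V] (hφ : Function.Involutive φ) {W B K S₀ : Set V}
    (h : IsNormalCut E lab φ Q M R S S' F) (hS : (∃ q ∈ Q, q ∈ S) ∨ Conn E M)
    (ih : CutBelow lab φ M.ncard (Q.ncard + R.ncard))
    (hT' : Seq E lab (R ∪ φ ⁻¹' M)) (hp : IsPlug E W B K S₀)
    (hTW : Seq E lab W) (hTB : Seq E lab B) (hX : Q ∪ M = W ∪ B) (hMW : ¬ M ⊆ W)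
    (hMB : ¬ M ⊆ B) : Seq E lab (Q ∪ R) := by
  have hmem : ∀ x, (x ∈ Q ∨ x ∈ M) ↔ (x ∈ W ∨ x ∈ B) := fun x => by
    rw [← Set.mem_union, hX, Set.mem_union]
  obtain ⟨y₀, hy₀M, hy₀B⟩ : ∃ y ∈ M, y ∈ B := by
    obtain ⟨y, hy, hyW⟩ := Set.not_subset.1 hMW
    exact ⟨y, hy, ((hmem y).1 (Or.inr hy)).resolve_left hyW⟩
  obtain ⟨x₀, hx₀M, hx₀W⟩ : ∃ x ∈ M, x ∈ W := by
    obtain ⟨y, hy, hyB⟩ := Set.not_subset.1 hMB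
    exact ⟨y, hy, ((hmem y).1 (Or.inr hy)).resolve_right hyB⟩
  have hdisj : ∀ x, x ∈ W → x ∉ B := hp.disj
  -- The vertices of `W` outside `K` have no edges to the rest of `W ∪ B`. But `M` also meets `B`,
  -- and it has a common neighbour in `Q` or is connected, so none of its vertices can be among
  -- them.
  have hMK : ∀ x ∈ M, x ∈ W → x ∈ K := by
    intro l hlM hlW
    by_contra hlK
    rcases hS with ⟨q, hq, hqS⟩ | hC
    · have h1 := (h.modM q hq l hlM).2 hqS
      have h2 := (h.modM q hq y₀ hy₀M).2 hqS
      rcases (hmem q).1 (Or.inl hq) with hqW | hqB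
      · have h3 := ((hp.adj q hqW y₀ hy₀B).1 h2).1
        exact hp.sep q hqW l hlW h3 hlK h1
      · exact hlK ((hp.adj l hlW q hqB).1 h1.symm).1
    · obtain ⟨x, hx, y, hy, ⟨hxW, hxK⟩, hyZ, hxy⟩ := hC {x | x ∈ W ∧ x ∉ K} ⟨l, hlM, hlW, hlK⟩
        ⟨y₀, hy₀M, fun h' => hdisj _ h'.1 hy₀B⟩
      rcases (hmem y).1 (Or.inr hy) with hyW | hyB
      · have hyK : y ∈ K := by
          by_contra hyK
          exact hyZ ⟨hyW, hyK⟩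
        exact hp.sep y hyW x hxW hyK hxK hxy.symm
      · exact hxK ((hp.adj x hxW y hyB).1 hxy).1
  have hx₀K := hMK x₀ hx₀M hx₀W
  have hlt : (M ∩ W).ncard < M.ncard := Set.ncard_lt_ncard
    (Set.ssubset_iff_of_subset Set.inter_subset_left |>.2
      ⟨y₀, hy₀M, fun h' => hdisj _ h'.2 hy₀B⟩)
  have hlt' : (M ∩ B).ncard < M.ncard := Set.ncard_lt_ncard
    (Set.ssubset_iff_of_subset Set.inter_subset_left |>.2
      ⟨x₀, hx₀M, fun h' => hdisj _ hx₀W h'.2⟩)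
  have hQS : ∀ x ∈ Q, x ∈ W → x ∈ S → x ∈ K := by
    intro x hx hxW hxS
    by_contra hxK
    exact hp.sep x₀ hx₀W x hxW hx₀K hxK ((h.modM x hx x₀ hx₀M).2 hxS).symm
  have hTA : Seq E lab ((Q ∩ W) ∪ (R ∪ φ ⁻¹' (M ∩ B))) := by
    -- The dual copy of `M ∩ B` stays in the right context. Adjacency is complemented there, so its
    -- neighbours of the dual of `M ∩ W` are those whose originals lie outside `S₀`.
    refine ih E (Q ∩ W) (M ∩ W) (R ∪ φ ⁻¹' (M ∩ B)) S
      {x | (x ∈ R ∧ x ∈ S') ∨ (φ x ∈ M ∧ φ x ∉ S₀)} {x | (x ∈ R ∧ x ∈ F) ∨ φ x ∈ M}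
      ?_ (Or.inl hlt) ?_ ?_
    · constructor
      · exact fun x hx hxM => h.disjQM x hx.1 hxM.1
      · rintro x hx (hxR | hxN)
        · exact h.disjQR x hx.1 hxR
        · exact h.disjQN x hx.1 hxN.1
      · rintro x (hxR | hxN) hxM
        · exact h.disjRM x hxR hxM.1
        · exact h.disjMN x hxM.1 hxN.1
      · exact fun x hx hxM => h.disjQN x hx.1 hxM.1
      · rintro x (hxR | hxN) hxM
        · exact h.disjRN x hxR hxM.1
        · exact hdisj _ hxM.2 hxN.2
      · exact fun x hx hxM => h.disjMN x hx.1 hxM.1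
      · exact fun q hq m hm => h.modM q hq.1 m hm.1
      · rintro r (hr | hr) m hm
        · rw [h.modN r hr m hm.1]
          have := h.disjRN r hr
          simp only [Set.mem_ofPred_eq]
          tauto
        · have h1 : φ r ≠ m := fun h' => hdisj _ hm.2 (h' ▸ hr.2)
          have h2 := h.dual _ hr.1 m hm.1 h1
          rw [hφ] at h2
          rw [h2, E.adj_comm, hp.adj m hm.2 _ hr.2]
          have := hMK m hm.1 hm.2
          have h3 := hr.1
          have h4 : r ∉ R := fun h' => h.disjRN r h' hr.1
          simp only [Set.mem_ofPred_eq]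
          tauto
      · rintro q hq r (hr | hr)
        · rw [h.cross q hq.1 r hr]
          have := h.disjRN r hr
          simp only [Set.mem_ofPred_eq]
          tauto
        · have := h.adjQN q hq.1 _ hr.1
          rw [hφ] at this
          rw [this]
          have h3 := hr.1
          simp only [Set.mem_ofPred_eq]
          tauto
      · rintro r (hr | hr) r' (hr' | hr') h1 h2 hrr
        · rcases h1 with h1 | h1
          · exact h.sep r hr r' hr' h1.2 (fun h3 => h2 (Or.inl ⟨hr', h3⟩)) hrr
          · exact h.disjRN r hr h1
        · exact h2 (Or.inr hr'.1)
        · have := h.modN r' hr' _ hr.1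
          rw [hφ] at this
          exact h2 (Or.inl ⟨hr', h.sub r' hr' (this.1 hrr.symm)⟩)
        · exact h2 (Or.inr hr'.1)
      · rintro r (hr | hr) (h1 | h1)
        · exact Or.inl ⟨hr, h.sub r hr h1.2⟩
        · exact Or.inr h1.1
        · exact Or.inr hr.1
        · exact Or.inr h1.1
      · exact fun x hx y hy => h.dual x hx.1 y hy.1
      · exact fun x hx => h.label x hx.1
    · convert hTW using 1
      ext x
      have := hmem x
      have := hdisj x
      simp only [Set.mem_union, Set.mem_inter_iff]
      tauto
    · convert hT' using 1
      ext x
      have := hmem (φ x)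
      simp only [Set.mem_union, Set.mem_inter_iff, Set.mem_preimage]
      tauto
  have hTC : Seq E lab ((Q ∩ B) ∪ (R ∪ (Q ∩ W))) := by
    -- The first conclusion is now the right premise. `Q ∩ W` moves to the right context, and its
    -- part in `K` joins `F` because it is attached to `B` as `M ∩ W` was.
    refine ih E (Q ∩ B) (M ∩ B) (R ∪ (Q ∩ W)) S
      {x | (x ∈ R ∧ x ∈ S') ∨ (x ∈ Q ∧ x ∈ S)} {x | (x ∈ R ∧ x ∈ F) ∨ (x ∈ Q ∧ x ∈ K)}
      ?_ (Or.inl hlt') ?_ ?_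
    · constructor
      · exact fun x hx hxM => h.disjQM x hx.1 hxM.1
      · rintro x hx (hxR | hxN)
        · exact h.disjQR x hx.1 hxR
        · exact hdisj _ hxN.2 hx.2
      · rintro x (hxR | hxN) hxM
        · exact h.disjRM x hxR hxM.1
        · exact h.disjQM x hxN.1 hxM.1
      · exact fun x hx hxM => h.disjQN x hx.1 hxM.1
      · rintro x (hxR | hxN) hxM
        · exact h.disjRN x hxR hxM.1
        · exact h.disjQN x hxN.1 hxM.1
      · exact fun x hx hxM => h.disjMN x hx.1 hxM.1
      · exact fun q hq m hm => h.modM q hq.1 m hm.1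
      · rintro r (hr | hr) m hm
        · rw [h.modN r hr m hm.1]
          have := h.disjQR r
          simp only [Set.mem_ofPred_eq]
          tauto
        · rw [h.adjQN r hr.1 m hm.1]
          have := h.disjQR r hr.1
          have := hr.1
          simp only [Set.mem_ofPred_eq]
          tauto
      · rintro q hq r (hr | hr)
        · rw [h.cross q hq.1 r hr]
          have := h.disjQR r
          simp only [Set.mem_ofPred_eq]
          tauto
        · rw [E.adj_comm, hp.adj r hr.2 q hq.2]
          have h1 : q ∈ S ↔ q ∈ S₀ := by
            rw [← h.modM q hq.1 x₀ hx₀M, E.adj_comm, hp.adj x₀ hx₀W q hq.2]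
            exact and_iff_right hx₀K
          have := h.disjQR r hr.1
          have := hr.1
          simp only [Set.mem_ofPred_eq]
          tauto
      · rintro r (hr | hr) r' (hr' | hr') h1 h2 hrr
        · rcases h1 with h1 | h1
          · exact h.sep r hr r' hr' h1.2 (fun h3 => h2 (Or.inl ⟨hr', h3⟩)) hrr
          · exact h.disjQR r h1.1 hr
        · have := (h.cross r' hr'.1 r hr).1 hrr.symm
          exact h2 (Or.inr ⟨hr'.1, hQS r' hr'.1 hr'.2 this.1⟩)
        · have := (h.cross r hr.1 r' hr').1 hrr
          exact h2 (Or.inl ⟨hr', this.2⟩)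
        · rcases h1 with h1 | h1
          · exact h.disjQR r hr.1 h1.1
          · exact hp.sep r hr.2 r' hr'.2 h1.2 (fun h3 => h2 (Or.inr ⟨hr'.1, h3⟩)) hrr
      · rintro r (hr | hr) (h1 | h1)
        · exact Or.inl ⟨hr, h.sub r hr h1.2⟩
        · exact absurd hr (h.disjQR r h1.1)
        · exact absurd h1.1 (h.disjQR r hr.1)
        · exact Or.inr ⟨hr.1, hQS r hr.1 hr.2 h1.2⟩
      · exact fun x hx y hy => h.dual x hx.1 y hy.1
      · exact fun x hx => h.label x hx.1
    · convert hTB using 1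
      ext x
      have := hmem x
      have := hdisj x
      simp only [Set.mem_union, Set.mem_inter_iff]
      tauto
    · convert hTA using 1
      ext x
      simp only [Set.mem_union, Set.mem_inter_iff, Set.mem_preimage]
      tauto
  convert hTC using 1
  ext x
  have := hmem x
  simp only [Set.mem_union, Set.mem_inter_iff]
  tauto

end Cut

end GraphLogic

namespace GraphLogic

/-! ### Prime rules against a cut, and the symmetry of cuts. -/

section Cut

variable {𝒱 : Type u} {V : Type}
variable {E : SimpleGraph V} {lab : V → Atom 𝒱} {φ : V → V} {Q M R S S' F : Set V}

/-- A common neighbour or connectedness forces `M` into one sort. If `M` lies over one vertex of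
`P`, the cut is done in that fibre. Otherwise `M` is a module meeting two fibres, and by
`IsPrime.module_eq` it is a whole component of the rule. -/
theorem IsNormalCut.prime_step [Finite V] {ι : Type} [Finite ι] {P : SimpleGraph ι} {π : V → ι}
    {s : V → Option Bool} (h : IsNormalCut E lab φ Q M R S S' F)
    (hS : (∃ q ∈ Q, q ∈ S) ∨ Conn E M) (hM : M.Nonempty)
    (ih : CutBelow lab φ M.ncard (Q.ncard + R.ncard))
    (hT' : Seq E lab (R ∪ φ ⁻¹' M)) (hP : IsPrime P) (hcard : 4 ≤ Nat.card ι)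
    (hc : IsComposed E P π s (Q ∪ M)) (hne : ∀ i b, ∃ x ∈ Q ∪ M, π x = i ∧ s x = some b)
    (hT : ∀ i, Seq E lab ((Q ∪ M) ∩ π ⁻¹' {i})) :
    Seq E lab (Q ∪ R) ∨ PrimePrincipal E lab (Q ∪ M) M := by
  obtain ⟨m₀, hm₀⟩ := hM
  have hs : ∀ x ∈ M, s x = s m₀ := by
    intro x hx
    by_contra hne
    rcases hS with ⟨q, hq, hqS⟩ | hC
    · have h1 := (h.modM q hq x hx).2 hqS
      have h2 := (h.modM q hq m₀ hm₀).2 hqS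
      exact hne ((hc.sort q (Or.inl hq) x (Or.inr hx) h1).symm.trans
        (hc.sort q (Or.inl hq) m₀ (Or.inr hm₀) h2))
    · obtain ⟨y, hy, z, hz, h1, h2, h3⟩ := hC {z | s z = s x} ⟨x, hx, rfl⟩
        ⟨m₀, hm₀, fun h' => hne (Eq.symm h')⟩
      exact h2 ((hc.sort y (Or.inr hy) z (Or.inr hz) h3).symm.trans h1)
  by_cases hπ : ∀ x ∈ M, π x = π m₀
  · left
    have hlt : (Q ∩ π ⁻¹' {π m₀}).ncard < Q.ncard := by
      have : Nontrivial ι := Finite.one_lt_card_iff_nontrivial.1 (by omega)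
      obtain ⟨j, hj⟩ := exists_ne (π m₀)
      obtain ⟨x, hx, hxj, -⟩ := hne j true
      refine Set.ncard_lt_ncard (Set.ssubset_iff_of_subset Set.inter_subset_left |>.2
        ⟨x, ?_, fun h' => hj (hxj.symm.trans h'.2)⟩)
      exact hx.resolve_right fun hxM => hj (hxj.symm.trans (hπ x hxM))
    have hTA : Seq E lab ((Q ∩ π ⁻¹' {π m₀}) ∪ R) := by
      refine ih E _ M R S S' F (h.mono Set.inter_subset_left) (Or.inr ⟨rfl, by omega⟩) ?_ hT'
      convert hT (π m₀) using 1
      rw [Set.union_inter_distrib_right]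
      congr 1
      exact (Set.inter_eq_left.2 hπ).symm
    classical
    -- All of `R` is put over the vertex that carried `M`: `F` inherits the sort of `M`, and the
    -- rest, isolated from `F` and from `Q`, gets the sort `none`. Some fibre may lose a sort, so
    -- `Seq.composed` is needed instead of the prime rule.
    set π' : V → ι := fun x => if x ∈ R then π m₀ else π x with hπ'
    set s' : V → Option Bool :=
      fun x => if x ∈ R then (if x ∈ F then s m₀ else none) else s x with hs'
    have hπQ : ∀ x ∈ Q, π' x = π x := fun x hx => if_neg (h.disjQR x hx)
    have hsQ : ∀ x ∈ Q, s' x = s x := fun x hx => if_neg (h.disjQR x hx)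
    have hπR : ∀ x ∈ R, π' x = π m₀ := fun x hx => if_pos hx
    have hsR : ∀ x ∈ R, s' x = if x ∈ F then s m₀ else none := fun x hx => if_pos hx
    have hQR : ∀ q ∈ Q, ∀ r ∈ R, π' q ≠ π' r →
        (E.Adj q r ↔ ∃ b, s' q = some b ∧ s' r = some b ∧
          (P.Adj (π' q) (π' r) ↔ b = true)) := by
      intro q hq r hr hqr
      rw [h.cross q hq r hr, ← h.modM q hq m₀ hm₀]
      rw [hπQ q hq, hπR r hr] at hqr
      rw [hc.adj q (Or.inl hq) m₀ (Or.inr hm₀) hqr, hπQ q hq, hπR r hr, hsQ q hq, hsR r hr]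
      by_cases hrF : r ∈ F <;> simp [hrF]
    have hQRs : ∀ q ∈ Q, ∀ r ∈ R, E.Adj q r → s' q = s' r := by
      intro q hq r hr hqr
      obtain ⟨h1, h2⟩ := (h.cross q hq r hr).1 hqr
      rw [hsQ q hq, hsR r hr, if_pos h2]
      exact hc.sort q (Or.inl hq) m₀ (Or.inr hm₀) ((h.modM q hq m₀ hm₀).2 h1)
    refine Seq.composed (Q := P) (π := π') (s := s') ⟨?_, ?_⟩ fun i => ?_
    · rintro x (hx | hx) y (hy | hy) hxy
      · rw [hπQ x hx, hπQ y hy] at hxy ⊢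
        rw [hsQ x hx, hsQ y hy]
        exact hc.adj x (Or.inl hx) y (Or.inl hy) hxy
      · exact hQR x hx y hy hxy
      · rw [E.adj_comm, hQR y hy x hx hxy.symm, P.adj_comm]
        exact exists_congr fun b => by tauto
      · exact absurd ((hπR x hx).trans (hπR y hy).symm) hxy
    · rintro x (hx | hx) y (hy | hy) hxy
      · rw [hsQ x hx, hsQ y hy]
        exact hc.sort x (Or.inl hx) y (Or.inl hy) hxy
      · exact hQRs x hx y hy hxy
      · exact (hQRs y hy x hx hxy.symm).symm
      · rw [hsR x hx, hsR y hy]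
        by_cases hxF : x ∈ F <;> by_cases hyF : y ∈ F
        · simp [hxF, hyF]
        · exact absurd hxy (h.sep x hx y hy hxF hyF)
        · exact absurd hxy.symm (h.sep y hy x hx hyF hxF)
        · simp [hxF, hyF]
    · by_cases hi : i = π m₀
      · subst hi
        convert hTA using 1
        ext x
        have h1 := hπQ x
        have h2 := hπR x
        simp only [Set.mem_inter_iff, Set.mem_union, Set.mem_preimage, Set.mem_singleton_iff]
        by_cases hxR : x ∈ R
        · simp [hxR, h2 hxR]
        · by_cases hxQ : x ∈ Q
          · simp [hxR, hxQ, h1 hxQ]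
          · simp [hxR, hxQ]
      · convert hT i using 1
        ext x
        have h1 := hπQ x
        have h2 := hπR x
        have h3 := hπ x
        have h4 := h.disjRM x
        simp only [Set.mem_inter_iff, Set.mem_union, Set.mem_preimage, Set.mem_singleton_iff]
        by_cases hxR : x ∈ R
        · have := h.disjQR x
          simp only [h2 hxR, hxR]
          exact ⟨fun h' => absurd h'.2.symm hi, fun h' => absurd hxR
            (h'.1.elim (h.disjQR x) fun h' hxR => h4 hxR h')⟩
        · by_cases hxQ : x ∈ Q
          · simp [hxR, hxQ, h1 hxQ]
          · simp only [hxQ, hxR, false_or, false_and, false_iff]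
            rintro ⟨hxM, rfl⟩
            exact hi (h3 hxM)
  · right
    push Not at hπ
    obtain ⟨m₁, hm₁, hπm⟩ := hπ
    obtain ⟨b, hb⟩ : ∃ b, s m₀ = some b := by
      by_contra hnone
      -- If `M` had sort `none`, its edges would stay inside fibres; a common neighbour or
      -- connectedness would then put `M` into one fibre.
      have hno : ∀ x ∈ Q ∪ M, ∀ y ∈ M, π x ≠ π y → ¬ E.Adj x y := by
        intro x hx y hy hxy ha
        obtain ⟨b, -, h2, -⟩ := (hc.adj x hx y (Or.inr hy) hxy).1 ha
        exact hnone ⟨b, (hs y hy).symm.trans h2⟩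
      rcases hS with ⟨q, hq, hqS⟩ | hC
      · have h1 : π q = π m₀ := by
          by_contra h'
          exact hno q (Or.inl hq) m₀ hm₀ h' ((h.modM q hq m₀ hm₀).2 hqS)
        have h2 : π q = π m₁ := by
          by_contra h'
          exact hno q (Or.inl hq) m₁ hm₁ h' ((h.modM q hq m₁ hm₁).2 hqS)
        exact hπm (h2.symm.trans h1)
      · obtain ⟨y, hy, z, hz, h1, h2, h3⟩ := hC {z | π z = π m₀} ⟨m₀, hm₀, rfl⟩
          ⟨m₁, hm₁, hπm⟩
        exact hno y (Or.inr hy) z hz (fun h' => h2 (h'.symm.trans h1)) h3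
    refine ⟨ι, inferInstance, P, π, s, b, hP, hcard, hc, hne, hT, fun x => ?_⟩
    have hMs : ∀ x ∈ M, x ∈ Q ∪ M ∧ s x = some b := fun x hx => ⟨Or.inr hx, (hs x hx).trans hb⟩
    refine ⟨hMs x, fun hx => ?_⟩
    refine hP.module_eq hcard hc hne hMs ?_ hm₁ hm₀ hπm hx.1 hx.2
    intro v hv _ hvM y hy z hz
    have hvQ := hv.resolve_right hvM
    rw [h.modM v hvQ y hy, h.modM v hvQ z hz]

/-- One step of cut reduction on the left premise: either the cut can be eliminated by the induction
hypothesis, or `M` is principal. -/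
theorem IsNormalCut.step [Finite V] (hφ : Function.Involutive φ)
    (h : IsNormalCut E lab φ Q M R S S' F) (hS : (∃ q ∈ Q, q ∈ S) ∨ Conn E M)
    (hM : M.Nonempty) (ih : CutBelow lab φ M.ncard (Q.ncard + R.ncard))
    (hT : Seq E lab (Q ∪ M)) (hT' : Seq E lab (R ∪ φ ⁻¹' M)) :
    Seq E lab (Q ∪ R) ∨ PrimePrincipal E lab (Q ∪ M) M ∨ AxPrincipal E lab Q M := by
  generalize hX : Q ∪ M = X at hT
  cases hT with
  | empty =>
    obtain ⟨m, hm⟩ := hM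
    have : m ∈ (∅ : Set V) := hX ▸ Or.inr hm
    exact this.elim
  | @ax x y hne hxy hl =>
    right; right
    have hmem : ∀ z, (z ∈ Q ∨ z ∈ M) ↔ (z = x ∨ z = y) := fun z => by
      rw [← Set.mem_union, hX]; rfl
    have hd := h.disjQM
    by_cases hxM : x ∈ M
    · by_cases hyM : y ∈ M
      · exfalso
        have hQ : ∀ q ∉ M, q ∉ Q := by
          intro q hq hqQ
          rcases (hmem q).1 (Or.inl hqQ) with rfl | rfl <;> contradiction
        rcases hS with ⟨q, hq, -⟩ | hC
        · exact hQ q (hd q hq) hq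
        · obtain ⟨a, ha, b, hb, h1, h2, h3⟩ := hC {x} ⟨x, hxM, rfl⟩ ⟨y, hyM, hne.symm⟩
          obtain rfl : a = x := h1
          obtain rfl : b = y := ((hmem b).1 (Or.inr hb)).resolve_left h2
          exact hxy h3
      · have hyQ : y ∈ Q := ((hmem y).2 (Or.inr rfl)).resolve_right hyM
        refine ⟨x, y, ?_, ?_, fun h' => hxy h'.symm, hl⟩
        · ext z
          refine ⟨fun hz => ?_, fun hz => hz ▸ hyQ⟩
          exact ((hmem z).1 (Or.inl hz)).resolve_left fun h' => hd z hz (h' ▸ hxM)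
        · ext z
          refine ⟨fun hz => ?_, fun hz => hz ▸ hxM⟩
          exact ((hmem z).1 (Or.inr hz)).resolve_right fun h' => hyM (h' ▸ hz)
    · have hxQ : x ∈ Q := ((hmem x).2 (Or.inl rfl)).resolve_right hxM
      have hyM : y ∈ M := by
        obtain ⟨m, hm⟩ := hM
        rcases (hmem m).1 (Or.inr hm) with rfl | rfl
        · contradiction
        · exact hm
      refine ⟨y, x, ?_, ?_, hxy, by rw [hl, Atom.dual_dual]⟩
      · ext z
        refine ⟨fun hz => ?_, fun hz => hz ▸ hxQ⟩
        exact ((hmem z).1 (Or.inl hz)).resolve_right fun h' => hd z hz (h' ▸ hyM)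
      · ext z
        refine ⟨fun hz => ?_, fun hz => hz ▸ hyM⟩
        exact ((hmem z).1 (Or.inr hz)).resolve_left fun h' => hxM (h' ▸ hz)
  | @plug W B K S₀ hp hW hB hTW hTB =>
    left
    by_cases hMW : M ⊆ W
    · exact h.plug_within ih hM hT' hp hB hTW hTB hX hMW
    by_cases hMB : M ⊆ B
    · exact h.plug_outside ih hM hT' hp hW hTW hTB hX hMB
    exact h.plug_crossing hφ hS ih hT' hp hTW hTB hX hMW hMB
  | prime hP hcard hc hne hT =>
    subst hX
    rcases h.prime_step hS hM ih hT' hP hcard hc hne hT with h | h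
    · exact Or.inl h
    · exact Or.inr (Or.inl h)

/-- If `M` has no neighbours in `Q`, there are no edges between `Q` and `R`. The two premises then
play symmetric roles, with nothing plugged into the other context. -/
theorem IsNormalCut.swap (hφ : Function.Involutive φ) (h : IsNormalCut E lab φ Q M R S S' F)
    (hS : ∀ q ∈ Q, q ∉ S) : IsNormalCut E lab φ R (φ ⁻¹' M) Q S' S ∅ where
  disjQM := h.disjRN
  disjQR x hx hx' := h.disjQR x hx' hx
  disjRM := h.disjQN
  disjQN x hx hx' := h.disjRM x hx (by simpa [hφ x] using hx')
  disjRN x hx hx' := h.disjQM x hx (by simpa [hφ x] using hx')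
  disjMN x hx hx' := h.disjMN _ hx (by simpa [hφ x] using hx')
  modM r hr m hm := by simpa [hφ m] using h.modN r hr _ hm
  modN q hq m hm := h.modM q hq _ hm
  cross r hr q hq := by
    rw [E.adj_comm, h.cross q hq r hr]
    simp [hS q hq]
  sep _ _ _ _ h' := h'.elim
  sub q hq hq' := absurd hq' (hS q hq)
  dual x hx y hy hxy := by
    have := h.dual _ hx _ hy (fun h' => hxy (hφ.injective h'))
    rw [hφ, hφ] at this
    rw [this, not_not]
  label x hx := by
    have := h.label _ hx
    rw [hφ] at this
    rw [this, Atom.dual_dual]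
  adjQN r hr m hm := h.adjRM r hr _ hm
  adjRM q hq m hm := by simpa [hφ m] using h.adjQN q hq _ hm

/-- The complement of a disconnected graph is connected: all edges across the split are present, and
two vertices on one side are joined through any vertex on the other. -/
theorem Conn.of_dual (hd : ∀ x ∈ M, ∀ y ∈ M, x ≠ y → (E.Adj (φ x) (φ y) ↔ ¬ E.Adj x y))
    (hφ : Function.Involutive φ) (h : ¬ Conn E M) : Conn E (φ ⁻¹' M) := by
  unfold Conn at h
  push Not at h
  obtain ⟨Z, ⟨a, ha, haZ⟩, ⟨b, hb, hbZ⟩, hZ⟩ := h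
  have hcross : ∀ x, φ x ∈ M → ∀ y, φ y ∈ M → φ x ∈ Z → φ y ∉ Z → E.Adj x y := by
    intro x hx y hy h1 h2
    have h3 := hd _ hx _ hy fun h' => h2 (h' ▸ h1)
    rw [hφ, hφ] at h3
    exact h3.2 (hZ _ hx _ hy h1 h2)
  rintro Y ⟨x, hx, hxY⟩ ⟨y, hy, hyY⟩
  have hx' : φ x ∈ M := hx
  have hy' : φ y ∈ M := hy
  have haM : φ (φ a) ∈ M := by rwa [hφ]
  have hbM : φ (φ b) ∈ M := by rwa [hφ]
  have haZ' : φ (φ a) ∈ Z := by rwa [hφ]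
  have hbZ' : φ (φ b) ∉ Z := by rwa [hφ]
  by_cases hxZ : φ x ∈ Z <;> by_cases hyZ : φ y ∈ Z
  · by_cases hbY : φ b ∈ Y
    · exact ⟨_, hbM, y, hy, hbY, hyY, (hcross _ hy' _ hbM hyZ hbZ').symm⟩
    · exact ⟨x, hx, _, hbM, hxY, hbY, hcross _ hx' _ hbM hxZ hbZ'⟩
  · exact ⟨x, hx, y, hy, hxY, hyY, hcross _ hx' _ hy' hxZ hyZ⟩
  · exact ⟨x, hx, y, hy, hxY, hyY, (hcross _ hy' _ hx' hyZ hxZ).symm⟩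
  · by_cases haY : φ a ∈ Y
    · exact ⟨_, haM, y, hy, haY, hyY, hcross _ haM _ hy' haZ' hyZ⟩
    · exact ⟨x, hx, _, haM, hxY, haY, (hcross _ haM _ hx' haZ' hxZ).symm⟩

/-- The two sides of a cut whose formulas are both principal in prime rules have matching classes. -/
theorem IsComposed.class_of_dual {ι κ : Type} [Finite ι] [Finite κ] {P : SimpleGraph ι}
    {P' : SimpleGraph κ} {π : V → ι} {π' : V → κ} {s s' : V → Option Bool} {W W' N : Set V}
    {b b' : Bool}
    (hd : ∀ x ∈ M, ∀ y ∈ M, x ≠ y → (E.Adj (φ x) (φ y) ↔ ¬ E.Adj x y))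
    (hφ : Function.Involutive φ) (hc : IsComposed E P π s W) (hP' : IsPrime P')
    (hcard' : 4 ≤ Nat.card κ) (hc' : IsComposed E P' π' s' W')
    (hne' : ∀ i b, ∃ x ∈ W', π' x = i ∧ s' x = some b)
    (hM : ∀ x, x ∈ M ↔ x ∈ W ∧ s x = some b) (hN : ∀ x, x ∈ N ↔ x ∈ W' ∧ s' x = some b')
    (hMN : N = φ ⁻¹' M) (hne : ∃ x ∈ M, ∃ y ∈ M, π x ≠ π y)
    {x y : V} (hx : x ∈ M) (hy : y ∈ M) (hxy : π x = π y) : π' (φ x) = π' (φ y) := by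
  subst hMN
  by_contra hcon
  -- The dual of a fibre of `π` is a module of `N`. If it meets two fibres of `π'`, it is all of
  -- `N`, and then `M` lies over a single vertex, contrary to `hne`.
  have key : ∀ z ∈ W', s' z = some b' → z ∈ {z | z ∈ φ ⁻¹' M ∧ π (φ z) = π x} := by
    intro z hz hsz
    refine hP'.module_eq hcard' hc' hne' (M := {z | z ∈ φ ⁻¹' M ∧ π (φ z) = π x})
      (fun v hv => (hN v).1 hv.1) ?_ (x₀ := φ x) (y₀ := φ y) ?_ ?_ hcon hz hsz
    · rintro v hv hsv hvC u ⟨hu, huC⟩ w ⟨hw, hwC⟩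
      have hvM : φ v ∈ M := (hN v).2 ⟨hv, hsv⟩
      have hvC' : π (φ v) ≠ π x := fun h' => hvC ⟨hvM, h'⟩
      have hadj : ∀ u, φ u ∈ M → π (φ u) = π x →
          (E.Adj v u ↔ ¬ (P.Adj (π (φ v)) (π x) ↔ b = true)) := by
        intro u hu huC
        have h1 := hd _ hvM _ hu fun h' => hvC' ((congrArg π h').trans huC)
        rw [hφ, hφ] at h1
        rw [h1, hc.adj _ ((hM _).1 hvM).1 _ ((hM _).1 hu).1 (by rwa [huC]), huC,
          ((hM _).1 hvM).2, ((hM _).1 hu).2]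
        simp
      rw [hadj u hu huC, hadj w hw hwC]
    · exact ⟨by simpa [hφ x] using hx, by rw [hφ]⟩
    · exact ⟨by simpa [hφ y] using hy, by rw [hφ, hxy]⟩
  have key' : ∀ z ∈ M, π z = π x := by
    intro z hz
    have h1 : φ z ∈ φ ⁻¹' M := by simpa [hφ z] using hz
    have := (key _ ((hN _).1 h1).1 ((hN _).1 h1).2).2
    rwa [hφ] at this
  obtain ⟨u, hu, v, hv, huv⟩ := hne
  exact huv ((key' u hu).trans (key' v hv).symm)

/-- If the dual of `M` splits into two parts without edges between them, then in `M` the parts are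
completely joined. So both are proper modules of `M`, and by `IsPrime.module_eq` each lies over one
vertex of `P`. This leaves at most two vertices for `P`. -/
theorem PrimePrincipal.conn_dual (hφ : Function.Involutive φ)
    (hd : ∀ x ∈ M, ∀ y ∈ M, x ≠ y → (E.Adj (φ x) (φ y) ↔ ¬ E.Adj x y)) {W : Set V}
    (h : PrimePrincipal E lab W M) : Conn E (φ ⁻¹' M) := by
  obtain ⟨ι, _, P, π, s, b, hP, hcard, hc, hne, -, hM⟩ := h
  rintro Z ⟨x, hx, hxZ⟩ ⟨y, hy, hyZ⟩
  by_contra hcon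
  push Not at hcon
  have hcross : ∀ u ∈ M, ∀ v ∈ M, φ u ∈ Z → φ v ∉ Z → E.Adj u v := by
    intro u hu v hv h1 h2
    have h3 := hcon (φ u) (by simpa [hφ u] using hu) (φ v) (by simpa [hφ v] using hv) h1 h2
    rw [hd u hu v hv fun h' => h2 (h' ▸ h1)] at h3
    exact not_not.1 h3
  have hside : ∀ Y : Set V, (∀ u ∈ M, ∀ v ∈ M, u ∈ Y → v ∉ Y → E.Adj u v) →
      (∃ u ∈ M, u ∉ Y) → ∀ u ∈ M, ∀ v ∈ M, u ∈ Y → v ∈ Y → π u = π v := by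
    rintro Y hY ⟨w, hw, hwY⟩ u hu v hv huY hvY
    by_contra huv
    have := hP.module_eq (M := M ∩ Y) hcard hc hne (fun x hx => (hM x).1 hx.1) ?_
      ⟨hu, huY⟩ ⟨hv, hvY⟩ huv ((hM w).1 hw).1 ((hM w).1 hw).2
    · exact hwY this.2
    · rintro z hz hsz hzY p ⟨hp, hpY⟩ q ⟨hq, hqY⟩
      have hzM : z ∈ M := (hM z).2 ⟨hz, hsz⟩
      have hzY' : z ∉ Y := fun h' => hzY ⟨hzM, h'⟩
      exact ⟨fun _ => (hY q hq z hzM hqY hzY').symm, fun _ => (hY p hp z hzM hpY hzY').symm⟩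
  have h1 := hside (φ ⁻¹' Z) hcross ⟨φ y, hy, by simpa [hφ y] using hyZ⟩
  have h2 := hside (φ ⁻¹' Z)ᶜ (fun u hu v hv h1 h2 =>
    (hcross v hv u hu (not_not.1 h2) h1).symm) ⟨φ x, hx, by simpa [hφ x] using hxZ⟩
  have hall : ∀ i, i = π (φ x) ∨ i = π (φ y) := by
    intro i
    obtain ⟨z, hz, rfl, hsz⟩ := hne i b
    have hzM := (hM z).2 ⟨hz, hsz⟩
    by_cases hzZ : φ z ∈ Z
    · exact Or.inl (h1 z hzM _ hx hzZ (by simpa [hφ x] using hxZ))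
    · exact Or.inr (h2 z hzM _ hy hzZ (by simpa [hφ y] using hyZ))
  have h3 : Nat.card ι ≤ 2 := by
    rw [← Set.ncard_univ]
    refine (Set.ncard_le_ncard (t := {π (φ x), π (φ y)}) fun i _ => hall i).trans ?_
    exact (Set.ncard_insert_le _ _).trans (by simp)
  omega

/-- Pairs between `Q` and `φ ⁻¹' M`, and between `R` and `M`, occur in neither premise nor in the
conclusion, so their adjacency can be chosen freely. Below, `C` marks these pairs and `A` the edges
wanted among them. -/
theorem IsNormalCut.exists_of_isCut (h : IsCut E lab φ Q M R S S' F)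
    (hφ : Function.Involutive φ) :
    ∃ E', IsNormalCut E' lab φ Q M R S S' F ∧
      (∀ x ∈ Q ∪ M, ∀ y ∈ Q ∪ M, (E'.Adj x y ↔ E.Adj x y)) ∧
      (∀ x ∈ R ∪ φ ⁻¹' M, ∀ y ∈ R ∪ φ ⁻¹' M, (E'.Adj x y ↔ E.Adj x y)) ∧
      (∀ x ∈ Q ∪ R, ∀ y ∈ Q ∪ R, (E'.Adj x y ↔ E.Adj x y)) := by
  let A : V → V → Prop := fun x y =>
    (x ∈ Q ∧ φ y ∈ M ∧ x ∈ S) ∨ (x ∈ R ∧ y ∈ M ∧ x ∈ S')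
  let C : V → V → Prop := fun x y => (x ∈ Q ∧ φ y ∈ M) ∨ (x ∈ R ∧ y ∈ M)
  let E' : SimpleGraph V :=
    { Adj := fun x y => x ≠ y ∧ (A x y ∨ A y x ∨ (E.Adj x y ∧ ¬ C x y ∧ ¬ C y x))
      symm := ⟨fun x y h' => ⟨h'.1.symm, by
        rcases h'.2 with h' | h' | ⟨h1, h2, h3⟩
        · exact Or.inr (Or.inl h')
        · exact Or.inl h'
        · exact Or.inr (Or.inr ⟨h1.symm, h3, h2⟩)⟩⟩
      loopless := ⟨fun x h' => h'.1 rfl⟩ }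
  have hAC : ∀ x y, A x y → C x y := by
    rintro x y (h' | h')
    · exact Or.inl ⟨h'.1, h'.2.1⟩
    · exact Or.inr ⟨h'.1, h'.2.1⟩
  have hold : ∀ x y, ¬ C x y → ¬ C y x → (E'.Adj x y ↔ E.Adj x y) := by
    intro x y h1 h2
    constructor
    · rintro ⟨-, h' | h' | h'⟩
      · exact absurd (hAC _ _ h') h1
      · exact absurd (hAC _ _ h') h2
      · exact h'.1
    · intro h'
      exact ⟨h'.ne, Or.inr (Or.inr ⟨h', h1, h2⟩)⟩
  have hQM : ∀ x ∈ Q ∪ M, ∀ y ∈ Q ∪ M, ¬ C x y := by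
    rintro x hx y hy (⟨h1, h2⟩ | ⟨h1, h2⟩)
    · rcases hy with hy | hy
      · exact h.disjQN y hy h2
      · exact h.disjMN y hy h2
    · rcases hx with hx | hx
      · exact h.disjQR x hx h1
      · exact h.disjRM x h1 hx
  have hRN : ∀ x ∈ R ∪ φ ⁻¹' M, ∀ y ∈ R ∪ φ ⁻¹' M, ¬ C x y := by
    rintro x hx y hy (⟨h1, h2⟩ | ⟨h1, h2⟩)
    · rcases hx with hx | hx
      · exact h.disjQR x h1 hx
      · exact h.disjQN x h1 hx
    · rcases hy with hy | hy
      · exact h.disjRM y hy h2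
      · exact h.disjMN y h2 hy
  have hQR : ∀ x ∈ Q ∪ R, ∀ y ∈ Q ∪ R, ¬ C x y := by
    rintro x hx y hy (⟨h1, h2⟩ | ⟨h1, h2⟩)
    · rcases hy with hy | hy
      · exact h.disjQN y hy h2
      · exact h.disjRN y hy h2
    · rcases hy with hy | hy
      · exact h.disjQM y hy h2
      · exact h.disjRM y hy h2
  have e1 : ∀ x ∈ Q ∪ M, ∀ y ∈ Q ∪ M, (E'.Adj x y ↔ E.Adj x y) :=
    fun x hx y hy => hold x y (hQM x hx y hy) (hQM y hy x hx)
  have e2 : ∀ x ∈ R ∪ φ ⁻¹' M, ∀ y ∈ R ∪ φ ⁻¹' M, (E'.Adj x y ↔ E.Adj x y) :=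
    fun x hx y hy => hold x y (hRN x hx y hy) (hRN y hy x hx)
  have e3 : ∀ x ∈ Q ∪ R, ∀ y ∈ Q ∪ R, (E'.Adj x y ↔ E.Adj x y) :=
    fun x hx y hy => hold x y (hQR x hx y hy) (hQR y hy x hx)
  have hN : ∀ m ∈ M, φ m ∈ φ ⁻¹' M := fun m hm => by simpa [hφ m] using hm
  refine ⟨E', { h with
    modM := fun q hq m hm => (e1 q (Or.inl hq) m (Or.inr hm)).trans (h.modM q hq m hm)
    modN := fun r hr m hm =>
      (e2 r (Or.inl hr) _ (Or.inr (hN m hm))).trans (h.modN r hr m hm)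
    cross := fun q hq r hr => (e3 q (Or.inl hq) r (Or.inr hr)).trans (h.cross q hq r hr)
    sep := fun r hr r' hr' h1 h2 h3 =>
      h.sep r hr r' hr' h1 h2 ((e3 r (Or.inr hr) r' (Or.inr hr')).1 h3)
    dual := fun x hx y hy hxy => by
      rw [e2 _ (Or.inr (hN x hx)) _ (Or.inr (hN y hy)), e1 x (Or.inr hx) y (Or.inr hy)]
      exact h.dual x hx y hy hxy
    adjQN := ?_
    adjRM := ?_ }, e1, e2, e3⟩
  · intro q hq m hm
    have hm' : φ (φ m) ∈ M := hN m hm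
    constructor
    · rintro ⟨-, (h' | h') | (h' | h') | h'⟩
      · exact h'.2.2
      · exact absurd h'.1 (h.disjQR q hq)
      · exact absurd h'.2.1 (h.disjQN q hq)
      · exact absurd h'.2.1 (h.disjQM q hq)
      · exact absurd (Or.inl ⟨hq, hm'⟩) h'.2.1
    · intro hqS
      exact ⟨fun h' => h.disjQN q hq (h' ▸ hm'), Or.inl (Or.inl ⟨hq, hm', hqS⟩)⟩
  · intro r hr m hm
    constructor
    · rintro ⟨-, (h' | h') | (h' | h') | h'⟩
      · exact absurd hr (h.disjQR r h'.1)
      · exact h'.2.2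
      · exact absurd hm (h.disjQM m h'.1)
      · exact absurd hm (h.disjRM m h'.1)
      · exact absurd (Or.inr ⟨hr, hm⟩) h'.2.1
    · intro hrS
      exact ⟨fun h' => h.disjRM r hr (h' ▸ hm), Or.inl (Or.inr ⟨hr, hm, hrS⟩)⟩

end Cut

end GraphLogic

namespace GraphLogic

/-! ### Principal cuts and cut admissibility. -/

section Cut

variable {𝒱 : Type u} {V : Type}
variable {E : SimpleGraph V} {lab : V → Atom 𝒱} {φ : V → V} {Q M R S S' F : Set V}

theorem IsComposed.not_adj_of_principal {ι : Type} {P : SimpleGraph ι} {π : V → ι}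
    {s : V → Option Bool} {b : Bool} (hc : IsComposed E P π s (Q ∪ M))
    (hM : ∀ x, x ∈ M ↔ x ∈ Q ∪ M ∧ s x = some b) (hd : ∀ x ∈ Q, x ∉ M) :
    ∀ q ∈ Q, ∀ m ∈ M, ¬ E.Adj q m := by
  intro q hq m hm ha
  have := hc.sort q (Or.inl hq) m (Or.inr hm) ha
  exact hd q hq ((hM q).2 ⟨Or.inl hq, this.trans ((hM m).1 hm).2⟩)

/-- The fibres of `M` and of its dual correspond, and this bijection identifies `P` with `P'` up to
complement. The component of the right rule dual to `φ ⁻¹' M` can therefore take the place of `M` in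
the left rule. What remains is one smaller cut per fibre, recombined by `Seq.composed`. -/
theorem IsNormalCut.prime_prime [Finite V] (hφ : Function.Involutive φ)
    (h : IsNormalCut E lab φ Q M R S S' F)
    (ih : CutBelow lab φ M.ncard (Q.ncard + R.ncard))
    (h₁ : PrimePrincipal E lab (Q ∪ M) M)
    (h₂ : PrimePrincipal E lab (R ∪ φ ⁻¹' M) (φ ⁻¹' M)) : Seq E lab (Q ∪ R) := by
  obtain ⟨ι, _, P, π, s, b, hP, hcard, hc, hne, hT, hM⟩ := h₁
  obtain ⟨κ, _, P', π', s', b', hP', hcard', hc', hne', hT', hN⟩ := h₂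
  have hQM := hc.not_adj_of_principal hM h.disjQM
  have hRN := hc'.not_adj_of_principal hN h.disjRN
  have hMne : ∀ i, ∃ m ∈ M, π m = i := by
    intro i
    obtain ⟨x, hx, h1, h2⟩ := hne i b
    exact ⟨x, (hM x).2 ⟨hx, h2⟩, h1⟩
  have hNne : ∀ j, ∃ n, φ n ∈ M ∧ π' n = j := by
    intro j
    obtain ⟨x, hx, h1, h2⟩ := hne' j b'
    exact ⟨x, (hN x).2 ⟨hx, h2⟩, h1⟩
  have hS : ∀ q ∈ Q, q ∉ S := by
    intro q hq hqS
    obtain ⟨i⟩ : Nonempty ι := Finite.card_pos_iff.1 (by omega)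
    obtain ⟨m, hm, -⟩ := hMne i
    exact hQM q hq m hm ((h.modM q hq m hm).2 hqS)
  have hsw := h.swap hφ hS
  have hQR : ∀ q ∈ Q, ∀ r ∈ R, ¬ E.Adj q r := fun q hq r hr ha =>
    hS q hq ((h.cross q hq r hr).1 ha).1
  have hι : Nontrivial ι := Finite.one_lt_card_iff_nontrivial.1 (by omega)
  have hκ : Nontrivial κ := Finite.one_lt_card_iff_nontrivial.1 (by omega)
  have hcl : ∀ x ∈ M, ∀ y ∈ M, (π x = π y ↔ π' (φ x) = π' (φ y)) := by
    intro x hx y hy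
    constructor
    · refine hc.class_of_dual h.dual hφ hP' hcard' hc' hne' hM hN rfl ?_ hx hy
      obtain ⟨i, j, hij⟩ := exists_pair_ne ι
      obtain ⟨u, hu, rfl⟩ := hMne i
      obtain ⟨v, hv, rfl⟩ := hMne j
      exact ⟨u, hu, v, hv, hij⟩
    · intro hxy
      have := hc'.class_of_dual hsw.dual hφ hP hcard hc hne hN hM
        (by ext z; simp [hφ z]) ?_ (x := φ x) (y := φ y) (by simpa [hφ x] using hx)
        (by simpa [hφ y] using hy) hxy
      · rwa [hφ, hφ] at this
      · obtain ⟨i, j, hij⟩ := exists_pair_ne κ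
        obtain ⟨u, hu, rfl⟩ := hNne i
        obtain ⟨v, hv, rfl⟩ := hNne j
        exact ⟨u, hu, v, hv, hij⟩
  -- A representative in each fibre of the dual; `j ↦ π (φ (ν j))` is the matching of the fibres.
  choose ν hνM hνπ using hNne
  have he : ∀ m ∈ M, π (φ (ν (π' (φ m)))) = π m := by
    intro m hm
    rw [hcl _ (hνM _) m hm, hφ, hνπ]
  have hadj : ∀ j k, j ≠ k → ((P'.Adj j k ↔ b' = true) ↔
      ¬ (P.Adj (π (φ (ν j))) (π (φ (ν k))) ↔ b = true)) := by
    intro j k hjk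
    have h1 : π (φ (ν j)) ≠ π (φ (ν k)) := by
      rw [Ne, hcl _ (hνM _) _ (hνM _), hφ, hφ, hνπ, hνπ]
      exact hjk
    have h2 := h.dual _ (hνM j) _ (hνM k) fun h' => h1 (congrArg π h')
    have h3 := (hN (ν j)).1 (hνM j)
    have h4 := (hN (ν k)).1 (hνM k)
    have h5 := (hM _).1 (hνM j)
    have h6 := (hM _).1 (hνM k)
    rw [hφ, hφ, hc'.adj _ h3.1 _ h4.1 (by rw [hνπ, hνπ]; exact hjk), hνπ, hνπ,
      hc.adj _ h5.1 _ h6.1 h1, h3.2, h4.2, h5.2, h6.2] at h2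
    simpa using h2
  classical
  set ρ : V → ι := fun x => if x ∈ R then π (φ (ν (π' x))) else π x with hρ
  -- In `R` only the sort opposite to `b'` can occur besides `none`. It becomes the sort `b` that
  -- `M` leaves vacant, since `Q` has no vertex of sort `b`.
  set t : V → Option Bool :=
    fun x => if x ∈ R then (if s' x = some (!b') then some b else none) else s x with ht
  have hρQ : ∀ x ∈ Q, ρ x = π x := fun x hx => if_neg (h.disjQR x hx)
  have htQ : ∀ x ∈ Q, t x = s x := fun x hx => if_neg (h.disjQR x hx)
  have hρR : ∀ x ∈ R, ρ x = π (φ (ν (π' x))) := fun x hx => if_pos hx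
  have htR : ∀ x ∈ R, t x = if s' x = some (!b') then some b else none := fun x hx => if_pos hx
  have hsQ : ∀ x ∈ Q, s x ≠ some b := fun x hx h' =>
    h.disjQM x hx ((hM x).2 ⟨Or.inl hx, h'⟩)
  have hsR : ∀ x ∈ R, s' x ≠ some b' := fun x hx h' =>
    h.disjRN x hx ((hN x).2 ⟨Or.inl hx, h'⟩)
  have hmix : ∀ q ∈ Q, ∀ r ∈ R, ∀ c, t q = some c → t r ≠ some c := by
    intro q hq r hr c h1 h2
    rw [htQ q hq] at h1
    rw [htR r hr] at h2
    split_ifs at h2 with h3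
    exact hsQ q hq (h1.trans h2.symm)
  refine Seq.composed (Q := P) (π := ρ) (s := t) ⟨?_, ?_⟩ fun i => ?_
  · rintro x (hx | hx) y (hy | hy) hxy
    · rw [hρQ x hx, hρQ y hy] at hxy ⊢
      rw [htQ x hx, htQ y hy]
      exact hc.adj x (Or.inl hx) y (Or.inl hy) hxy
    · refine iff_of_false (hQR x hx y hy) ?_
      rintro ⟨c, h1, h2, -⟩
      exact hmix x hx y hy c h1 h2
    · refine iff_of_false (fun h' => hQR y hy x hx h'.symm) ?_
      rintro ⟨c, h1, h2, -⟩
      exact hmix y hy x hx c h2 h1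
    · rw [hρR x hx, hρR y hy] at hxy ⊢
      have hxy' : π' x ≠ π' y := fun h' => hxy (by rw [h'])
      have h1 := hadj _ _ hxy'
      have hb : ∀ c d : Bool, c ≠ d → c = !d := by decide
      have hb' : (!b') = true ↔ ¬ b' = true := by simp
      rw [hc'.adj x (Or.inl hx) y (Or.inl hy) hxy', htR x hx, htR y hy]
      constructor
      · rintro ⟨c, h2, h3, h4⟩
        obtain rfl := hb c b' fun h' => hsR x hx (h2.trans (congrArg some h'))
        refine ⟨b, if_pos h2, if_pos h3, ?_⟩
        rw [hb'] at h4
        tauto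
      · rintro ⟨c, h2, h3, h4⟩
        split_ifs at h2 with h5
        split_ifs at h3 with h6
        obtain rfl : b = c := by simpa using h2
        refine ⟨_, h5, h6, ?_⟩
        rw [hb']
        tauto
  · rintro x (hx | hx) y (hy | hy) hxy
    · rw [htQ x hx, htQ y hy]
      exact hc.sort x (Or.inl hx) y (Or.inl hy) hxy
    · exact absurd hxy (hQR x hx y hy)
    · exact absurd hxy.symm (hQR y hy x hx)
    · rw [htR x hx, htR y hy, hc'.sort x (Or.inl hx) y (Or.inl hy) hxy]
  · obtain ⟨m, hm, rfl⟩ := hMne i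
    have hR : ∀ x, π (φ (ν (π' x))) = π m ↔ π' x = π' (φ m) := by
      intro x
      rw [hcl _ (hνM _) m hm, hφ, hνπ]
    have hlt : (M ∩ π ⁻¹' {π m}).ncard < M.ncard := by
      obtain ⟨j, hj⟩ := exists_ne (π m)
      obtain ⟨m', hm', rfl⟩ := hMne j
      exact Set.ncard_lt_ncard (Set.ssubset_iff_of_subset Set.inter_subset_left |>.2
        ⟨m', hm', fun h' => hj h'.2⟩)
    have := ih E (Q ∩ π ⁻¹' {π m}) (M ∩ π ⁻¹' {π m}) (R ∩ π' ⁻¹' {π' (φ m)}) ∅ ∅ ∅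
      { disjQM := fun x hx hx' => h.disjQM x hx.1 hx'.1
        disjQR := fun x hx hx' => h.disjQR x hx.1 hx'.1
        disjRM := fun x hx hx' => h.disjRM x hx.1 hx'.1
        disjQN := fun x hx hx' => h.disjQN x hx.1 hx'.1
        disjRN := fun x hx hx' => h.disjRN x hx.1 hx'.1
        disjMN := fun x hx hx' => h.disjMN x hx.1 hx'.1
        modM := fun q hq m hm => iff_of_false (hQM q hq.1 m hm.1) id
        modN := fun r hr m hm =>
          iff_of_false (hRN r hr.1 _ (by simpa [hφ m] using hm.1)) id
        cross := fun q hq r hr => iff_of_false (hQR q hq.1 r hr.1) fun h' => h'.1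
        sep := fun _ _ _ _ h' => h'.elim
        sub := fun _ _ h' => h'
        dual := fun x hx y hy => h.dual x hx.1 y hy.1
        label := fun x hx => h.label x hx.1 } (Or.inl hlt) ?_ ?_
    · convert this using 1
      ext x
      simp only [Set.mem_inter_iff, Set.mem_union, Set.mem_preimage, Set.mem_singleton_iff]
      by_cases hxR : x ∈ R
      · have : x ∉ Q := fun h' => h.disjQR x h' hxR
        simp [hxR, this, hρR x hxR, hR]
      · by_cases hxQ : x ∈ Q
        · simp [hxR, hxQ, hρQ x hxQ]
        · simp [hxR, hxQ]
    · rw [← Set.union_inter_distrib_right]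
      exact hT _
    · convert hT' (π' (φ m)) using 1
      rw [Set.union_inter_distrib_right]
      congr 1
      ext x
      simp only [Set.mem_inter_iff, Set.mem_preimage, Set.mem_singleton_iff]
      refine and_congr_right fun hx => ?_
      rw [hcl _ hx m hm, hφ]

theorem PrimePrincipal.nontrivial {W : Set V} (h : PrimePrincipal E lab W M) :
    M.Nontrivial := by
  obtain ⟨ι, _, P, π, s, b, -, hcard, -, hne, -, hM⟩ := h
  have : Nontrivial ι := Finite.one_lt_card_iff_nontrivial.1 (by omega)
  obtain ⟨i, j, hij⟩ := exists_pair_ne ι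
  obtain ⟨x, hx, rfl, hsx⟩ := hne i b
  obtain ⟨y, hy, rfl, hsy⟩ := hne j b
  exact ⟨x, (hM x).2 ⟨hx, hsx⟩, y, (hM y).2 ⟨hy, hsy⟩, fun h' => hij (congrArg π h')⟩

theorem Conn.of_subsingleton (h : M.Subsingleton) : Conn E M := by
  rintro Z ⟨x, hx, hxZ⟩ ⟨y, hy, hyZ⟩
  exact absurd (h hx hy ▸ hxZ) hyZ

/-- If `M` has a neighbour in the left context, it is not principal there and the left premise can
be reduced. Otherwise the cut is symmetric. Since `M` or its dual is connected, reduction can start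
on that side, and it ends with matching axioms or matching prime rules. -/
theorem IsNormalCut.seq [Finite V] (hφ : Function.Involutive φ)
    (h : IsNormalCut E lab φ Q M R S S' F) (ih : CutBelow lab φ M.ncard (Q.ncard + R.ncard))
    (hT : Seq E lab (Q ∪ M)) (hT' : Seq E lab (R ∪ φ ⁻¹' M)) : Seq E lab (Q ∪ R) := by
  rcases M.eq_empty_or_nonempty with rfl | hM
  · simp only [Set.union_empty, Set.preimage_empty] at hT hT'
    -- With nothing to cut, the conclusion is the right context plugged into the left one, with `F`
    -- in the hole.
    refine Seq.plug_of hT' hT (K := F) (S := S)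
      ⟨fun x hx hx' => h.disjQR x hx' hx, fun r hr q hq => ?_, h.sep⟩ (Set.union_comm _ _)
    rw [E.adj_comm, h.cross q hq r hr, and_comm]
  by_cases hS : ∃ q ∈ Q, q ∈ S
  · obtain ⟨q, hq, hqS⟩ := hS
    rcases h.step hφ (Or.inl ⟨q, hq, hqS⟩) hM ih hT hT' with h1 | h1 | h1
    · exact h1
    · obtain ⟨ι, _, P, π, s, b, -, -, hc, -, -, hM'⟩ := h1
      obtain ⟨m, hm⟩ := hM
      exact absurd ((h.modM q hq m hm).2 hqS) (hc.not_adj_of_principal hM' h.disjQM q hq m hm)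
    · obtain ⟨x, y, rfl, rfl, hxy, -⟩ := h1
      obtain rfl : q = y := hq
      exact absurd ((h.modM q rfl x rfl).2 hqS) hxy
  push Not at hS
  have hsw := h.swap hφ hS
  have hφφ : φ ⁻¹' (φ ⁻¹' M) = M := by ext z; simp [hφ z]
  have hcardN : (φ ⁻¹' M).ncard = M.ncard :=
    Set.ncard_preimage_of_injective_subset_range hφ.injective
      (fun x _ => ⟨φ x, hφ x⟩)
  have hN : (φ ⁻¹' M).Nonempty := hM.preimage hφ.surjective
  have ih' : CutBelow lab φ (φ ⁻¹' M).ncard (R.ncard + Q.ncard) := by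
    rwa [hcardN, add_comm]
  have hstep : Conn E (φ ⁻¹' M) → Seq E lab (Q ∪ R) ∨
      PrimePrincipal E lab (R ∪ φ ⁻¹' M) (φ ⁻¹' M) ∨ AxPrincipal E lab R (φ ⁻¹' M) := by
    intro hC
    have := hsw.step hφ (Or.inr hC) hN ih' hT' (by rwa [hφφ])
    rwa [Set.union_comm R Q] at this
  have hsub : (φ ⁻¹' M).Subsingleton → M.Subsingleton := fun h' x hx y hy =>
    hφ.injective (h' (by simpa [hφ x] using hx) (by simpa [hφ y] using hy))
  have hsub' : M.Subsingleton → (φ ⁻¹' M).Subsingleton := fun h' => h'.preimage hφ.injective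
  by_cases hC : Conn E M
  · rcases h.step hφ (Or.inr hC) hM ih hT hT' with h1 | h1 | h1
    · exact h1
    · rcases hstep (h1.conn_dual hφ h.dual) with h2 | h2 | h2
      · exact h2
      · exact h.prime_prime hφ ih h1 h2
      · obtain ⟨x, y, -, h3, -⟩ := h2
        exact absurd (hsub (h3 ▸ Set.subsingleton_singleton))
          (Set.not_subsingleton_iff.2 h1.nontrivial)
    · obtain ⟨x, y, hQ, hMx, -, hl⟩ := h1
      have hss := hsub' (hMx ▸ Set.subsingleton_singleton)
      rcases hstep (.of_subsingleton hss) with h2 | h2 | h2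
      · exact h2
      · exact absurd hss (Set.not_subsingleton_iff.2 h2.nontrivial)
      · obtain ⟨x', y', hR, hN', -, hl'⟩ := h2
        have hxM : x ∈ M := hMx ▸ rfl
        obtain rfl : φ x = x' := by
          have : φ x ∈ φ ⁻¹' M := by simpa [hφ x] using hxM
          rw [hN'] at this
          exact this
        have hyQ : y ∈ Q := hQ ▸ rfl
        have hyR : y' ∈ R := hR ▸ rfl
        rw [hQ, hR, Set.singleton_union]
        refine .ax (fun h' => h.disjQR y hyQ (h' ▸ hyR)) ?_ ?_
        · exact fun ha => hS y hyQ ((h.cross y hyQ y' hyR).1 ha).1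
        · rw [hl', hl, h.label x hxM]
  -- If `M` is disconnected, its dual is connected but cannot be principal: a principal dual, in a
  -- prime rule or an axiom, would make `M` connected.
  · have hCN := Conn.of_dual h.dual hφ hC
    rcases hstep hCN with h2 | h2 | h2
    · exact h2
    · exact absurd (hφφ ▸ h2.conn_dual hφ hsw.dual) hC
    · obtain ⟨x, y, -, h3, -⟩ := h2
      exact absurd (Conn.of_subsingleton (hsub (h3 ▸ Set.subsingleton_singleton))) hC

/-- Lexicographic induction on the size of the cut module and the size of the contexts. The graph
`E` is quantified inside `CutBelow`, which allows each cut to be normalised before it is reduced. -/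
theorem cutBelow [Finite V] (lab : V → Atom 𝒱) (hφ : Function.Involutive φ) (k l : ℕ) :
    CutBelow lab φ k l := by
  induction k using Nat.strong_induction_on generalizing l with
  | _ k ihk =>
  induction l using Nat.strong_induction_on with
  | _ l ihl =>
  intro E Q M R S S' F h hlt hT hT'
  obtain ⟨E', hn, e1, e2, e3⟩ := IsNormalCut.exists_of_isCut h hφ
  refine Seq.congr (hn.seq hφ ?_ (hT.congr e1) (hT'.congr e2)) fun x hx y hy =>
    (e3 x hx y hy).symm
  rcases hlt with hlt | ⟨rfl, hlt⟩
  · exact ihk _ hlt _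
  · exact ihl _ hlt

/-- Cut admissibility, for cuts inside contexts. -/
theorem IsCut.seq [Finite V] (hφ : Function.Involutive φ) (h : IsCut E lab φ Q M R S S' F)
    (hT : Seq E lab (Q ∪ M)) (hT' : Seq E lab (R ∪ φ ⁻¹' M)) : Seq E lab (Q ∪ R) :=
  cutBelow lab hφ (M.ncard + 1) 0 E Q M R S S' F h (Or.inl (Nat.lt_succ_self _)) hT hT'

end Cut

end GraphLogic

namespace GraphLogic

/-! ### Derivations give provable implications. -/

section Soundness

variable {𝒱 : Type u}

theorem LGraph.comp_adj_same {ι : Type} [Finite ι] {P : SimpleGraph ι} {H : ι → LGraph 𝒱} {i : ι}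
    {u v : (H i).V} : (LGraph.comp P H).graph.Adj ⟨i, u⟩ ⟨i, v⟩ ↔ (H i).graph.Adj u v := by
  constructor
  · rintro (⟨j, u', v', h1, h2, h3⟩ | h)
    · cases h1
      cases h2
      exact h3
    · exact absurd h P.irrefl
  · exact fun h => Or.inl ⟨i, u, v, rfl, rfl, h⟩

theorem LGraph.comp_adj_of_ne {ι : Type} [Finite ι] {P : SimpleGraph ι} {H : ι → LGraph 𝒱}
    {x y : Σ i, (H i).V} (h : x.1 ≠ y.1) :
    (LGraph.comp P H).graph.Adj x y ↔ P.Adj x.1 y.1 := by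
  constructor
  · rintro (⟨j, u', v', rfl, rfl, -⟩ | h')
    · exact absurd rfl h
    · exact h'
  · exact Or.inr

theorem Seq.cast {V : Type} {E : SimpleGraph V} {lab : V → Atom 𝒱} {W W' : Set V}
    (h : Seq E lab W) (hW : W = W') : Seq E lab W' := hW ▸ h

/-- The inclusion of a component into a composition. -/
def LGraph.compMk {ι : Type} [Finite ι] (P : SimpleGraph ι) (H : ι → LGraph 𝒱) (i : ι) :
    (H i).V → (LGraph.comp P H).V := fun x => ⟨i, x⟩

theorem LGraph.compMk_injective {ι : Type} [Finite ι] (P : SimpleGraph ι) (H : ι → LGraph 𝒱)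
    (i : ι) : Function.Injective (LGraph.compMk P H i) :=
  fun x y h => by cases h; rfl

/-- The graph of the linear implication from `G` to `H`. -/
def impGraph (G H : LGraph 𝒱) : SimpleGraph (G.V ⊕ H.V) := G.graphᶜ ⊕g H.graph

/-- The labelling of the linear implication from `G` to `H`. -/
def impLabel (G H : LGraph 𝒱) : G.V ⊕ H.V → Atom 𝒱 :=
  Sum.elim (fun v => (G.label v).dual) H.label

/-- The linear implication from `G` to `H` is provable. -/
def Imp (G H : LGraph 𝒱) : Prop := Seq (impGraph G H) (impLabel G H) Set.univ

@[simp] theorem impGraph_inl_inl {G H : LGraph 𝒱} {x y : G.V} :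
    (impGraph G H).Adj (.inl x) (.inl y) ↔ x ≠ y ∧ ¬ G.graph.Adj x y := Iff.rfl

@[simp] theorem impGraph_inr_inr {G H : LGraph 𝒱} {x y : H.V} :
    (impGraph G H).Adj (.inr x) (.inr y) ↔ H.graph.Adj x y := Iff.rfl

@[simp] theorem impGraph_inl_inr {G H : LGraph 𝒱} {x : G.V} {y : H.V} :
    ¬ (impGraph G H).Adj (.inl x) (.inr y) := Bool.false_ne_true

@[simp] theorem impGraph_inr_inl {G H : LGraph 𝒱} {x : H.V} {y : G.V} :
    ¬ (impGraph G H).Adj (.inr x) (.inl y) := Bool.false_ne_true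

/-- The sort of a vertex of an implication: negative on the left, positive on the right. -/
def impSort {α β : Type} : α ⊕ β → Option Bool :=
  Sum.elim (fun _ => some false) (fun _ => some true)

/-- The dual of `G` is a composition of single vertices via the complement of `G.graph`, and `H` is
one via `G.graph`. So one use of the generalised prime rule leaves only axioms. -/
theorem Imp.of_iso {G H : LGraph 𝒱} (f : G.Iso H) : Imp G H := by
  refine Seq.composed (Q := G.graph) (π := Sum.elim id f.toIso.symm) (s := impSort)
    ⟨?_, ?_⟩ fun i => ?_
  · rintro (x | x) - (y | y) - hxy
    · have : x ≠ y := hxy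
      simp [impSort, this]
    · simp [impSort]
    · simp [impSort]
    · simp [impSort, f.toIso.symm.map_adj_iff]
  · rintro (x | x) - (y | y) - hxy
    · rfl
    · exact absurd hxy impGraph_inl_inr
    · exact absurd hxy impGraph_inr_inl
    · rfl
  · have : (Set.univ ∩ Sum.elim id f.toIso.symm ⁻¹' {i} : Set (G.V ⊕ H.V)) =
        {Sum.inr (f.toIso i), Sum.inl i} := by
      ext (x | x)
      · simp
      · simp only [Set.univ_inter, Set.mem_preimage, Sum.elim_inr, Set.mem_singleton_iff,
          Set.mem_insert_iff, Sum.inr.injEq, reduceCtorEq, or_false]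
        exact f.toIso.toEquiv.symm_apply_eq
    rw [this]
    refine .ax Sum.inr_ne_inl impGraph_inr_inl ?_
    simp [impLabel, f.label_eq]

/-- The identity isomorphism. -/
def LGraph.Iso.refl (G : LGraph 𝒱) : G.Iso G := ⟨SimpleGraph.Iso.refl, fun _ => rfl⟩

theorem Imp.refl (G : LGraph 𝒱) : Imp G G := .of_iso (.refl G)

theorem Imp.comp {ι : Type} [Finite ι] (P : SimpleGraph ι) {A B : ι → LGraph 𝒱}
    (h : ∀ i, Imp (A i) (B i)) : Imp (LGraph.comp P A) (LGraph.comp P B) := by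
  refine Seq.composed (Q := P) (π := Sum.elim Sigma.fst Sigma.fst) (s := impSort)
    ⟨?_, ?_⟩ fun i => ?_
  · rintro (x | x) - (y | y) - hxy
    · have h1 : x ≠ y := fun h => hxy (congrArg Sigma.fst h)
      have h2 : x.1 ≠ y.1 := hxy
      refine (impGraph_inl_inl.trans
        (and_congr_right' (not_congr (LGraph.comp_adj_of_ne h2)))).trans ?_
      simp only [impSort, Sum.elim_inl]
      simp
      exact fun _ => h1
    · exact iff_of_false impGraph_inl_inr (by simp [impSort])
    · exact iff_of_false impGraph_inr_inl (by simp [impSort])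
    · have h2 : x.1 ≠ y.1 := hxy
      refine (impGraph_inr_inr.trans (LGraph.comp_adj_of_ne h2)).trans ?_
      simp [impSort]
  · rintro (x | x) - (y | y) - hxy
    · rfl
    · exact absurd hxy impGraph_inl_inr
    · exact absurd hxy impGraph_inr_inl
    · rfl
  · have := (h i).image (E' := impGraph (LGraph.comp P A) (LGraph.comp P B))
      (lab' := impLabel (LGraph.comp P A) (LGraph.comp P B))
      (Sum.map (LGraph.compMk P A i) (LGraph.compMk P B i)) ?_ ?_ ?_
    · refine this.cast (Eq.symm ?_)
      ext (⟨j, x⟩ | ⟨j, x⟩)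
      · constructor
        · intro hj
          obtain rfl : j = i := hj.2
          exact ⟨.inl x, trivial, rfl⟩
        · rintro ⟨z | z, -, hz⟩
          · exact ⟨trivial, (congrArg Sigma.fst (Sum.inl_injective hz)).symm⟩
          · exact absurd hz Sum.inr_ne_inl
      · constructor
        · intro hj
          obtain rfl : j = i := hj.2
          exact ⟨.inr x, trivial, rfl⟩
        · rintro ⟨z | z, -, hz⟩
          · exact absurd hz Sum.inl_ne_inr
          · exact ⟨trivial, (congrArg Sigma.fst (Sum.inr_injective hz)).symm⟩
    · exact (Function.Injective.sumMap (LGraph.compMk_injective _ _ _) (LGraph.compMk_injective _ _ _)).injOn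
    · rintro (x | x) - (y | y) -
      · exact and_congr (LGraph.compMk_injective _ _ _).ne_iff (not_congr LGraph.comp_adj_same)
      · exact Iff.rfl
      · exact Iff.rfl
      · exact LGraph.comp_adj_same
    · rintro (x | x) - <;> rfl

/-- A cut with isolated cut formula: the two implications are placed side by side, and `φ` exchanges
the positive and the negative copy of `H`. -/
theorem Imp.trans {G H K : LGraph 𝒱} (h₁ : Imp G H) (h₂ : Imp H K) : Imp G K := by
  let E : SimpleGraph ((G.V ⊕ H.V) ⊕ (H.V ⊕ K.V)) := impGraph G H ⊕g impGraph H K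
  let lab : (G.V ⊕ H.V) ⊕ (H.V ⊕ K.V) → Atom 𝒱 := Sum.elim (impLabel G H) (impLabel H K)
  let φ : (G.V ⊕ H.V) ⊕ (H.V ⊕ K.V) → (G.V ⊕ H.V) ⊕ (H.V ⊕ K.V) :=
    Sum.elim (Sum.elim (fun x => .inl (.inl x)) (fun x => .inr (.inl x)))
      (Sum.elim (fun x => .inl (.inr x)) (fun x => .inr (.inr x)))
  have hφ : Function.Involutive φ := by rintro ((x | x) | (x | x)) <;> rfl
  let Q : Set ((G.V ⊕ H.V) ⊕ (H.V ⊕ K.V)) := Set.range fun x => .inl (.inl x)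
  let M : Set ((G.V ⊕ H.V) ⊕ (H.V ⊕ K.V)) := Set.range fun x => .inl (.inr x)
  let R : Set ((G.V ⊕ H.V) ⊕ (H.V ⊕ K.V)) := Set.range fun x => .inr (.inr x)
  have hcut : IsCut E lab φ Q M R ∅ ∅ ∅ := by
    constructor
    case sep => exact fun _ _ _ _ h' => h'.elim
    case sub => exact fun _ _ h' => h'
    case dual =>
      rintro _ ⟨x, rfl⟩ _ ⟨y, rfl⟩ hxy
      have : x ≠ y := fun h' => hxy (by rw [h'])
      simp [φ, E, this]
    all_goals
      try rintro _ ⟨x, rfl⟩ _ ⟨y, rfl⟩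
      try rintro _ ⟨x, rfl⟩
      simp [φ, M, R, E, lab, impLabel]
  have h₁' : Seq E lab (Q ∪ M) := by
    convert h₁.image (E' := E) (lab' := lab) Sum.inl Sum.inl_injective.injOn ?_ ?_ using 1
    · ext ((x | x) | (x | x)) <;> simp [Q, M]
    · simp [E]
    · simp [lab]
  have h₂' : Seq E lab (R ∪ φ ⁻¹' M) := by
    convert h₂.image (E' := E) (lab' := lab) Sum.inr Sum.inr_injective.injOn ?_ ?_ using 1
    · ext ((x | x) | (x | x)) <;> simp [R, M, φ]
    · simp [E]
    · simp [lab]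
  refine (hcut.seq hφ h₁' h₂').pullback (Sum.map .inl .inr)
    (Function.Injective.sumMap Sum.inl_injective Sum.inr_injective).injOn ?_ ?_ ?_
  · ext ((x | x) | (x | x)) <;> simp [Q, R]
  · rintro (x | x) - (y | y) - <;> simp [E]
  · rintro (x | x) - <;> rfl

/-- Common to both super switches: the positive and negative copies of `A` form one identity, those
of `B` another, and a single plug connects them. -/
theorem Imp.plug_aux (A B : LGraph 𝒱) {E : SimpleGraph ((B.V ⊕ A.V) ⊕ (B.V ⊕ A.V))}
    {K S : Set ((B.V ⊕ A.V) ⊕ (B.V ⊕ A.V))}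
    {lab : (B.V ⊕ A.V) ⊕ (B.V ⊕ A.V) → Atom 𝒱}
    (hp : IsPlug E (Set.range (Sum.map .inr .inr)) (Set.range (Sum.map .inl .inl)) K S)
    (hA : ∀ x y : A.V ⊕ A.V, E.Adj (x.map .inr .inr) (y.map .inr .inr) ↔ (impGraph A A).Adj x y)
    (hB : ∀ x y : B.V ⊕ B.V, E.Adj (x.map .inl .inl) (y.map .inl .inl) ↔ (impGraph B B).Adj x y)
    (hlA : ∀ x : A.V ⊕ A.V, lab (x.map .inr .inr) = impLabel A A x)
    (hlB : ∀ x : B.V ⊕ B.V, lab (x.map .inl .inl) = impLabel B B x) :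
    Seq E lab Set.univ := by
  have h₁ := (Imp.refl A).image (E' := E) (lab' := lab) (Sum.map .inr .inr)
    (Function.Injective.sumMap Sum.inr_injective Sum.inr_injective).injOn
    (fun x _ y _ => hA x y) fun x _ => hlA x
  have h₂ := (Imp.refl B).image (E' := E) (lab' := lab) (Sum.map .inl .inl)
    (Function.Injective.sumMap Sum.inl_injective Sum.inl_injective).injOn
    (fun x _ y _ => hB x y) fun x _ => hlB x
  rw [Set.image_univ] at h₁ h₂
  refine Seq.plug_of h₁ h₂ hp ?_
  · ext ((x | x) | (x | x)) <;> simp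

theorem Imp.of_ssDown {G H : LGraph 𝒱} (h : ssDown G H) : Imp G H := by
  obtain ⟨B, A, S, -, -⟩ := h
  -- The conclusion has no edges between `B` and `A`. Only the negative copies are joined, by the
  -- complement of `S`.
  refine Imp.plug_aux A B (K := Set.range fun a => .inl (.inr a))
    (S := {x | ∃ b ∉ S, x = .inl (.inl b)}) ⟨?_, ?_, ?_⟩ ?_ ?_ ?_ ?_
  · rintro _ ⟨x | x, rfl⟩ ⟨y | y, hy⟩ <;> cases hy
  · rintro _ ⟨x | x, rfl⟩ _ ⟨y | y, rfl⟩
    · refine Iff.trans (b := Sum.inr x ≠ Sum.inl y ∧ y ∉ S) Iff.rfl ?_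
      simp
    · exact iff_of_false impGraph_inl_inr (by simp)
    · exact iff_of_false impGraph_inr_inl (by simp)
    · exact iff_of_false id (by simp)
  · rintro _ ⟨x | x, rfl⟩ _ ⟨y | y, rfl⟩ hx hy
    · exact absurd ⟨y, rfl⟩ hy
    · exact impGraph_inl_inr
    · exact impGraph_inr_inl
    · simp at hx
  · rintro (x | x) (y | y)
    · exact and_congr Sum.inr_injective.ne_iff Iff.rfl
    all_goals exact Iff.rfl
  · rintro (x | x) (y | y)
    · exact and_congr Sum.inl_injective.ne_iff Iff.rfl
    all_goals exact Iff.rfl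
  · rintro (x | x) <;> rfl
  · rintro (x | x) <;> rfl

theorem Imp.of_ssUp {G H : LGraph 𝒱} (h : ssUp G H) : Imp G H := by
  obtain ⟨B, A, S, -, -⟩ := h
  -- The dual of the tensor has no edges between `B` and `A`. Only the positive copies are joined,
  -- by `S`.
  refine Imp.plug_aux A B (K := Set.range fun a => .inr (.inr a))
    (S := {x | ∃ b ∈ S, x = .inr (.inl b)}) ⟨?_, ?_, ?_⟩ ?_ ?_ ?_ ?_
  · rintro _ ⟨x | x, rfl⟩ ⟨y | y, hy⟩ <;> cases hy
  · rintro _ ⟨x | x, rfl⟩ _ ⟨y | y, rfl⟩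
    · exact iff_of_false (fun h => h.2 (Set.mem_univ y)) (by simp)
    · exact iff_of_false impGraph_inl_inr (by simp)
    · exact iff_of_false impGraph_inr_inl (by simp)
    · refine Iff.trans (b := y ∈ S) Iff.rfl ?_
      simp
  · rintro _ ⟨x | x, rfl⟩ _ ⟨y | y, rfl⟩ hx hy
    · simp at hx
    · exact impGraph_inl_inr
    · exact impGraph_inr_inl
    · exact absurd ⟨y, rfl⟩ hy
  · rintro (x | x) (y | y)
    · exact and_congr Sum.inr_injective.ne_iff Iff.rfl
    all_goals exact Iff.rfl
  · rintro (x | x) (y | y)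
    · exact and_congr Sum.inl_injective.ne_iff Iff.rfl
    all_goals exact Iff.rfl
  · rintro (x | x) <;> rfl
  · rintro (x | x) <;> rfl

theorem Imp.of_aiDown {G H : LGraph 𝒱} (h : aiDown G H) : Imp G H := by
  obtain ⟨a⟩ := h
  have : (Set.univ : Set ((LGraph.empty (𝒱 := 𝒱)).V ⊕ ((LGraph.single a.dual).par (LGraph.single a)).V)) =
      {.inr (.inl ()), .inr (.inr ())} := by
    ext (x | (x | x))
    · exact x.elim
    · exact ⟨fun _ => Or.inl rfl, fun _ => trivial⟩
    · exact ⟨fun _ => Or.inr rfl, fun _ => trivial⟩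
  unfold Imp
  rw [this]
  refine .ax (fun h => by cases h) id ?_
  exact a.dual_dual.symm

theorem Imp.of_pDown {G H : LGraph 𝒱} (h : pDown G H) : Imp G H := by
  obtain ⟨P, -, -, M, N, -⟩ := h
  -- Between fibres, the dual of the premise has no edges, so its vertices get the sort `none`. Each
  -- fibre is the identity of `M i ⅋ N i`.
  refine Seq.composed (Q := P)
    (π := Sum.elim Sigma.fst (Sum.elim Sigma.fst Sigma.fst))
    (s := Sum.elim (fun _ => none) impSort) ⟨?_, ?_⟩ fun i => ?_
  · rintro (x | x | x) - (y | y | y) - hxy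
    · have h2 : x.1 ≠ y.1 := hxy
      exact iff_of_false (fun h => h.2 ((LGraph.comp_adj_of_ne h2).2 h2)) (by simp)
    · exact iff_of_false impGraph_inl_inr (by simp)
    · exact iff_of_false impGraph_inl_inr (by simp)
    · exact iff_of_false impGraph_inr_inl (by simp)
    · have h2 : x.1 ≠ y.1 := hxy
      refine Iff.trans (LGraph.comp_adj_of_ne (P := Pᶜ) (H := M) h2) ?_
      simp [impSort, h2]
    · exact iff_of_false id (by simp [impSort])
    · exact iff_of_false impGraph_inr_inl (by simp)
    · exact iff_of_false id (by simp [impSort])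
    · have h2 : x.1 ≠ y.1 := hxy
      refine Iff.trans (LGraph.comp_adj_of_ne (P := P) (H := N) h2) ?_
      simp [impSort]
  · rintro (x | x | x) - (y | y | y) - hxy
    all_goals first
      | rfl
      | exact absurd hxy impGraph_inl_inr
      | exact absurd hxy impGraph_inr_inl
      | exact hxy.elim
  · have := (Imp.refl ((M i).par (N i))).image
      (E' := impGraph (LGraph.comp ⊤ fun i => (M i).par (N i))
        ((LGraph.comp Pᶜ M).par (LGraph.comp P N)))
      (lab' := impLabel (LGraph.comp ⊤ fun i => (M i).par (N i))
        ((LGraph.comp Pᶜ M).par (LGraph.comp P N)))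
      (Sum.map (LGraph.compMk ⊤ (fun i => (M i).par (N i)) i)
        (Sum.map (LGraph.compMk Pᶜ M i) (LGraph.compMk P N i))) ?_ ?_ ?_
    · refine this.cast (Eq.symm ?_)
      ext (⟨j, x⟩ | ⟨j, x⟩ | ⟨j, x⟩)
      · constructor
        · intro hj
          obtain rfl : j = i := hj.2
          exact ⟨.inl x, trivial, rfl⟩
        · rintro ⟨z | z, -, hz⟩
          · exact ⟨trivial, (congrArg Sigma.fst (Sum.inl_injective hz)).symm⟩
          · exact absurd hz Sum.inr_ne_inl
      · constructor
        · intro hj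
          obtain rfl : j = i := hj.2
          exact ⟨.inr (.inl x), trivial, rfl⟩
        · rintro ⟨z | z | z, -, hz⟩
          · exact absurd hz Sum.inl_ne_inr
          · exact ⟨trivial, (congrArg Sigma.fst (Sum.inl_injective (Sum.inr_injective hz))).symm⟩
          · exact absurd (Sum.inr_injective hz) Sum.inr_ne_inl
      · constructor
        · intro hj
          obtain rfl : j = i := hj.2
          exact ⟨.inr (.inr x), trivial, rfl⟩
        · rintro ⟨z | z | z, -, hz⟩
          · exact absurd hz Sum.inl_ne_inr
          · exact absurd (Sum.inr_injective hz) Sum.inl_ne_inr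
          · exact ⟨trivial, (congrArg Sigma.fst (Sum.inr_injective (Sum.inr_injective hz))).symm⟩
    · exact (Function.Injective.sumMap (LGraph.compMk_injective _ _ _)
        (Function.Injective.sumMap (LGraph.compMk_injective _ _ _) (LGraph.compMk_injective _ _ _))).injOn
    · rintro (x | x | x) - (y | y | y) -
      · exact and_congr (LGraph.compMk_injective _ _ _).ne_iff (not_congr LGraph.comp_adj_same)
      all_goals first | exact Iff.rfl | exact LGraph.comp_adj_same
    · rintro (x | x | x) - <;> rfl

/-- Every derivation gives a provable implication. -/
theorem Imp.of_deriv {G H : LGraph 𝒱} (D : Deriv (GS 𝒱 ∪ {ssUp}) G H) : Imp G H := by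
  induction D with
  | graph G => exact .refl G
  | comp P D ih => exact .comp P ih
  | step D₁ r hr h D₂ ih₁ ih₂ =>
    refine ih₁.trans (.trans ?_ ih₂)
    rcases hr with (rfl | rfl | rfl) | rfl
    · exact .of_aiDown h
    · exact .of_ssDown h
    · exact .of_pDown h
    · exact .of_ssUp h
  | iso D₁ f D₂ ih₁ ih₂ => exact ih₁.trans ((Imp.of_iso f).trans ih₂)

theorem Provable.seq {G : LGraph 𝒱} (h : Provable (GS 𝒱 ∪ {ssUp}) G) :
    Seq G.graph G.label Set.univ := by
  obtain ⟨D⟩ := h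
  refine (Imp.of_deriv D).pullback Sum.inr Sum.inr_injective.injOn ?_ (by simp) fun _ _ => rfl
  ext (x | x)
  · exact x.elim
  · simp

end Soundness

end GraphLogic

namespace GraphLogic

/-! ### Good graphs and the translation of the plug rule. -/

section Analytic

variable {𝒱 : Type u}

theorem IsPrime.exists_ne {ι : Type} {R : SimpleGraph ι} (hR : IsPrime R) :
    ∃ x y : ι, x ≠ y := by
  have : Finite ι := Nat.finite_of_card_ne_zero (by have := hR.1; omega)
  have : Nontrivial ι := Finite.one_lt_card_iff_nontrivial.1 hR.1
  exact exists_pair_ne ι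

/-- A partition of a prime graph into modules is trivial. -/
theorem IsPrime.injective_or_const {ι κ : Type} {R : SimpleGraph ι} (hR : IsPrime R) (g : ι → κ)
    (h : ∀ x y z, g y = g z → g x ≠ g y → (R.Adj x y ↔ R.Adj x z)) :
    Function.Injective g ∨ ∃ k, ∀ x, g x = k := by
  by_cases hg : Function.Injective g
  · exact Or.inl hg
  right
  simp only [Function.Injective, not_forall] at hg
  obtain ⟨a, b, hab, hne⟩ := hg
  have hm : IsModule R {z | g z = g a} := by
    intro v hv x hx y hy
    have hx' : g x = g a := hx
    have hy' : g y = g a := hy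
    exact h v x y (hx'.trans hy'.symm) fun h' => hv (h'.trans hx')
  rcases hR.2 _ hm with h' | ⟨w, h'⟩ | h'
  · have : a ∈ (∅ : Set ι) := h' ▸ rfl
    exact this.elim
  · have h1 : a ∈ ({w} : Set ι) := h' ▸ rfl
    have h2 : b ∈ ({w} : Set ι) := h' ▸ hab.symm
    exact absurd (h1.trans h2.symm) hne
  · exact ⟨g a, fun x => by
      have : x ∈ (Set.univ : Set ι) := Set.mem_univ x
      rw [← h'] at this
      exact this⟩

/-- The inverse of a label-preserving isomorphism. -/
def LGraph.Iso.symm {G H : LGraph 𝒱} (f : G.Iso H) : H.Iso G where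
  toIso := f.toIso.symm
  label_eq v := by
    rw [← f.label_eq]
    exact congrArg _ (f.toIso.apply_symm_apply v)

variable {V : Type}

/-- Every prime induced subgraph of `X` is an induced subgraph of `E`. -/
def Good (E : SimpleGraph V) (X : LGraph 𝒱) : Prop :=
  ∀ (ι : Type) (R : SimpleGraph ι), IsPrime R → Nonempty (R ↪g X.graph) → Nonempty (R ↪g E)

theorem Good.of_iso {E : SimpleGraph V} {X Y : LGraph 𝒱} (h : Good E Y) (f : X.Iso Y) :
    Good E X :=
  fun ι R hR ⟨g⟩ => h ι R hR ⟨g.trans f.toIso.toEmbedding⟩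

theorem Good.of_subsingleton {E : SimpleGraph V} {X : LGraph 𝒱} (h : Subsingleton X.V) :
    Good E X := by
  rintro ι R hR ⟨g⟩
  obtain ⟨x, y, hxy⟩ := hR.exists_ne
  exact absurd (g.injective (Subsingleton.elim _ _)) hxy

/-- The fibres of a composition cut a prime induced subgraph into modules. So it meets each fibre at
most once, and embeds into `P`, or lies in one fibre. -/
theorem Good.comp {E : SimpleGraph V} {ι : Type} [Finite ι] {P : SimpleGraph ι}
    {X : ι → LGraph 𝒱}
    (hP : ∀ (κ : Type) (R : SimpleGraph κ), IsPrime R → Nonempty (R ↪g P) → Nonempty (R ↪g E))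
    (hX : ∀ i, Good E (X i)) : Good E (LGraph.comp P X) := by
  rintro κ R hR ⟨f⟩
  have hadj : ∀ x y, (f x).1 ≠ (f y).1 → (R.Adj x y ↔ P.Adj (f x).1 (f y).1) := fun x y hxy => by
    rw [← f.map_adj_iff]
    exact LGraph.comp_adj_of_ne hxy
  have hcl : ∀ x y z, (f y).1 = (f z).1 → (f x).1 ≠ (f y).1 → (R.Adj x y ↔ R.Adj x z) :=
    fun x y z hyz hxy => by rw [hadj x y hxy, hadj x z (hyz ▸ hxy), hyz]
  rcases hR.injective_or_const (fun x => (f x).1) hcl with h | ⟨i, h⟩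
  · refine hP κ R hR ⟨⟨⟨_, h⟩, fun {x y} => ?_⟩⟩
    by_cases hxy : x = y
    · subst hxy
      exact iff_of_false P.irrefl R.irrefl
    · exact (hadj x y (h.ne hxy)).symm
  · have hu : ∀ x, ∃ u, f x = ⟨i, u⟩ := by
      intro x
      rcases hfx : f x with ⟨j, u⟩
      obtain rfl : j = i := by
        have := h x
        rwa [hfx] at this
      exact ⟨u, rfl⟩
    choose u hu using hu
    refine hX i κ R hR ⟨⟨⟨u, fun x y hxy => f.injective ?_⟩, fun {x y} => ?_⟩⟩
    · rw [hu, hu, hxy]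
    · rw [← f.map_adj_iff, hu, hu]
      exact LGraph.comp_adj_same.symm

/-- There is a proof of `G` all of whose graphs are good. -/
def AnProvable (E : SimpleGraph V) (G : LGraph 𝒱) : Prop :=
  ∃ D : Proof (GS 𝒱 ∪ {ssUp}) G, ∀ X ∈ D.occurring, Good E X

theorem AnProvable.empty (E : SimpleGraph V) : AnProvable E (LGraph.empty (𝒱 := 𝒱)) :=
  ⟨.graph _, fun X hX => by
    obtain rfl : X = LGraph.empty := hX
    exact .of_subsingleton (inferInstanceAs (Subsingleton Empty))⟩

theorem AnProvable.step {E : SimpleGraph V} {G H : LGraph 𝒱} (h : AnProvable E G) {r : Rule 𝒱}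
    (hr : r ∈ GS 𝒱 ∪ {ssUp}) (hGH : r G H) (hH : Good E H) : AnProvable E H := by
  obtain ⟨D, hD⟩ := h
  refine ⟨.step D r hr hGH (.graph H), ?_⟩
  rintro X (hX | hX)
  · exact hD X hX
  · obtain rfl : X = H := hX
    exact hH

theorem AnProvable.of_iso {E : SimpleGraph V} {G H : LGraph 𝒱} (h : AnProvable E G)
    (f : G.Iso H) (hH : Good E H) : AnProvable E H := by
  obtain ⟨D, hD⟩ := h
  refine ⟨.iso D f (.graph H), ?_⟩
  rintro X (hX | hX)
  · exact hD X hX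
  · obtain rfl : X = H := hX
    exact hH

theorem AnProvable.comp {E : SimpleGraph V} {ι : Type} [Finite ι] {P : SimpleGraph ι}
    (hP : ∀ (κ : Type) (R : SimpleGraph κ), IsPrime R → Nonempty (R ↪g P) → Nonempty (R ↪g E))
    {A B : ι → LGraph 𝒱} (h : AnProvable E (LGraph.comp P A))
    (hAB : ∀ i, (∃ D : Deriv (GS 𝒱 ∪ {ssUp}) (A i) (B i), ∀ X ∈ D.occurring, Good E X)) :
    AnProvable E (LGraph.comp P B) := by
  obtain ⟨D, hD⟩ := h
  choose D' hD' using hAB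
  refine ⟨.iso D (.refl _) (.comp P D'), ?_⟩
  rintro X (hX | ⟨Y, hY, rfl⟩ | hX)
  · exact hD X hX
  · exact Good.comp hP fun i => hD' i _ (hY i)
  · obtain ⟨_, ⟨i, rfl⟩, hX⟩ := hX
    exact hD' i X hX

/-- The labelled graph induced by `E` on `W`. -/
def LGraph.on [Finite V] (E : SimpleGraph V) (lab : V → Atom 𝒱) (W : Set V) : LGraph 𝒱 where
  V := W
  finite := inferInstance
  graph := E.induce W
  label v := lab v

theorem Good.on [Finite V] (E : SimpleGraph V) (lab : V → Atom 𝒱) (W : Set V) :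
    Good E (LGraph.on E lab W) :=
  fun _ _ _ ⟨g⟩ => ⟨g.trans (SimpleGraph.Embedding.induce W)⟩

/-- An isomorphism onto an induced subgraph, from an embedding with the right range. -/
noncomputable def LGraph.isoOn [Finite V] {E : SimpleGraph V} {lab : V → Atom 𝒱} {W : Set V}
    (X : LGraph 𝒱) (p : X.V → V) (hp : Function.Injective p) (hr : ∀ v, v ∈ W ↔ ∃ x, p x = v)
    (hadj : ∀ x y, E.Adj (p x) (p y) ↔ X.graph.Adj x y) (hlab : ∀ x, lab (p x) = X.label x) :
    X.Iso (LGraph.on E lab W) where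
  toIso :=
    { toEquiv := Equiv.ofBijective (fun x => (⟨p x, (hr _).2 ⟨x, rfl⟩⟩ : W))
        ⟨fun x y h => hp (congrArg Subtype.val h), fun v => by
          obtain ⟨x, hx⟩ := (hr (show W from v).1).1 (show W from v).2
          exact ⟨x, Subtype.ext hx⟩⟩
      map_rel_iff' := fun {x y} => hadj x y }
  label_eq := hlab

/-- Induced subgraphs that agree are isomorphic. -/
noncomputable def LGraph.isoOnOfAgree [Finite V] {E E' : SimpleGraph V} {lab : V → Atom 𝒱}
    {W : Set V} (h : ∀ x ∈ W, ∀ y ∈ W, (E'.Adj x y ↔ E.Adj x y)) :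
    (LGraph.on E lab W).Iso (LGraph.on E' lab W) :=
  LGraph.isoOn _ Subtype.val Subtype.val_injective (fun v => ⟨fun hv => ⟨⟨v, hv⟩, rfl⟩, by
    rintro ⟨x, rfl⟩; exact x.2⟩) (fun x y => h x.1 x.2 y.1 y.2) fun _ => rfl

/-- An induced subgraph in which `A` is a module as a plugged graph. -/
noncomputable def LGraph.isoOnPlug [Finite V] {E E₁ : SimpleGraph V} {lab : V → Atom 𝒱}
    {W A B : Set V} (S : Set V) (hW : ∀ x, x ∈ W ↔ x ∈ A ∨ x ∈ B) (hd : ∀ x ∈ A, x ∉ B)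
    (hA : ∀ x ∈ A, ∀ y ∈ A, (E₁.Adj x y ↔ E.Adj x y))
    (hB : ∀ x ∈ B, ∀ y ∈ B, (E₁.Adj x y ↔ E.Adj x y))
    (hAB : ∀ b ∈ B, ∀ a ∈ A, (E₁.Adj b a ↔ b ∈ S)) :
    ((LGraph.on E lab B).plug (Subtype.val ⁻¹' S) (LGraph.on E lab A)).Iso
      (LGraph.on E₁ lab W) := by
  refine LGraph.isoOn _ (Sum.elim (fun x : B => (x : V)) (fun x : A => (x : V))) ?_ ?_ ?_ ?_
  · rintro (x | x) (y | y) hxy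
    · exact congrArg Sum.inl (Subtype.ext hxy)
    · exact absurd x.2 ((show x.1 = y.1 from hxy) ▸ hd y.1 y.2)
    · exact absurd y.2 ((show x.1 = y.1 from hxy) ▸ hd x.1 x.2)
    · exact congrArg Sum.inr (Subtype.ext hxy)
  · intro v
    rw [hW]
    constructor
    · rintro (hv | hv)
      · exact ⟨.inr ⟨v, hv⟩, rfl⟩
      · exact ⟨.inl ⟨v, hv⟩, rfl⟩
    · rintro ⟨x | x, rfl⟩
      · exact Or.inr x.2
      · exact Or.inl x.2
  · rintro (x | x) (y | y)
    · exact hB x.1 x.2 y.1 y.2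
    · exact hAB x.1 x.2 y.1 y.2
    · exact (E₁.adj_comm _ _).trans (hAB y.1 y.2 x.1 x.2)
    · exact hA x.1 x.2 y.1 y.2
  · rintro (x | x) <;> rfl

/-- The super switch on induced subgraphs of graphs on the same vertices. -/
theorem AnProvable.ssDown [Finite V] {E₀ E E₁ E₂ : SimpleGraph V} {lab : V → Atom 𝒱}
    {W A B : Set V} (S : Set V) (hW : ∀ x, x ∈ W ↔ x ∈ A ∨ x ∈ B) (hd : ∀ x ∈ A, x ∉ B)
    (hA₁ : ∀ x ∈ A, ∀ y ∈ A, (E₁.Adj x y ↔ E.Adj x y))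
    (hB₁ : ∀ x ∈ B, ∀ y ∈ B, (E₁.Adj x y ↔ E.Adj x y))
    (hAB₁ : ∀ b ∈ B, ∀ a ∈ A, (E₁.Adj b a ↔ b ∈ S))
    (hA₂ : ∀ x ∈ A, ∀ y ∈ A, (E₂.Adj x y ↔ E.Adj x y))
    (hB₂ : ∀ x ∈ B, ∀ y ∈ B, (E₂.Adj x y ↔ E.Adj x y))
    (hAB₂ : ∀ b ∈ B, ∀ a ∈ A, ¬ E₂.Adj b a)
    (h : AnProvable E₀ (LGraph.on E₁ lab W)) (hg₁ : Good E₀ (LGraph.on E₁ lab W))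
    (hg : Good E₀ (LGraph.on E₂ lab W)) : AnProvable E₀ (LGraph.on E₂ lab W) := by
  -- If a side condition of the rule fails, premise and conclusion are the same graph.
  by_cases hne : (∃ b ∈ B, b ∈ S) ∧ ∃ a, a ∈ A
  · obtain ⟨⟨b, hb, hbS⟩, a, ha⟩ := hne
    let f₁ := LGraph.isoOnPlug (lab := lab) S hW hd hA₁ hB₁ hAB₁
    let f₂ := LGraph.isoOnPlug (lab := lab) ∅ hW hd hA₂ hB₂ fun b hb a ha =>
      iff_of_false (hAB₂ b hb a ha) id
    refine AnProvable.of_iso ?_ f₂ hg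
    refine (h.of_iso f₁.symm (hg₁.of_iso f₁)).step (r := GraphLogic.ssDown)
      (Or.inl (Or.inr (Or.inl rfl))) ?_ (hg.of_iso f₂)
    refine .mk _ _ _ (fun h' => ?_) ⟨⟨a, ha⟩⟩
    have : (⟨b, hb⟩ : B) ∈ (∅ : Set B) := h' ▸ hbS
    exact this
  · have hno : ∀ b ∈ B, ∀ a ∈ A, ¬ E₁.Adj b a := fun b hb a ha hba =>
      hne ⟨⟨b, hb, (hAB₁ b hb a ha).1 hba⟩, a, ha⟩
    refine h.of_iso (LGraph.isoOnOfAgree fun x hx y hy => ?_) hg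
    rcases (hW x).1 hx with hx | hx <;> rcases (hW y).1 hy with hy | hy
    · rw [hA₁ x hx y hy, hA₂ x hx y hy]
    · exact iff_of_false (fun h => hAB₂ y hy x hx h.symm) fun h => hno y hy x hx h.symm
    · exact iff_of_false (hAB₂ x hx y hy) (hno x hx y hy)
    · rw [hB₁ x hx y hy, hB₂ x hx y hy]

/-- A graph `Y` together with a single vertex for each element of `B`. -/
def LGraph.withSingles (lab : V → Atom 𝒱) (B : Set V) (Y : LGraph 𝒱) : Option B → LGraph 𝒱
  | none => Y
  | some b => LGraph.single (lab b)

/-- After `B` is proved, all of `W` is proved inside a hole of `B` with the neighbours that `K` has;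
then `ss↓` moves `W \ K` out. The intermediate graph is good because its quotient `P`, with `W`
contracted to `w₀`, is an induced subgraph of `E`. -/
theorem AnProvable.plug [Finite V] {E : SimpleGraph V} {lab : V → Atom 𝒱} {W B K S : Set V}
    (hp : IsPlug E W B K S) (hW : W.Nonempty) (hTW : AnProvable E (LGraph.on E lab W))
    (hTB : AnProvable E (LGraph.on E lab B)) : AnProvable E (LGraph.on E lab (W ∪ B)) := by
  -- A representative of `W` that has the right neighbours in `B`: a vertex of `K` if there is one,
  -- any vertex otherwise, since then `W` and `B` are not connected.
  obtain ⟨w₀, hw₀, hw₀K⟩ : ∃ w ∈ W, w ∈ K ∨ ∀ w ∈ W, w ∉ K := by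
    by_cases h : ∃ w ∈ W, w ∈ K
    · obtain ⟨w, hw, hwK⟩ := h
      exact ⟨w, hw, Or.inl hwK⟩
    · obtain ⟨w, hw⟩ := hW
      exact ⟨w, hw, Or.inr fun w hw hwK => h ⟨w, hw, hwK⟩⟩
  let p : Option B → V := fun o => o.elim w₀ Subtype.val
  have hpinj : Function.Injective p := by
    rintro (_ | b) (_ | b') h
    · rfl
    · exact absurd b'.2 ((show w₀ = b' from h) ▸ hp.disj w₀ hw₀)
    · exact absurd b.2 ((show (b : V) = w₀ from h) ▸ hp.disj w₀ hw₀)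
    · exact congrArg some (Subtype.ext h)
  let P : SimpleGraph (Option B) := E.comap p
  have hP : ∀ (κ : Type) (R : SimpleGraph κ), IsPrime R → Nonempty (R ↪g P) →
      Nonempty (R ↪g E) := fun κ R _ ⟨g⟩ =>
    ⟨g.trans (SimpleGraph.Embedding.comap ⟨p, hpinj⟩ E)⟩
  have hsingle : ∀ Y, Good E Y → ∀ o, Good E (LGraph.withSingles lab B Y o) := by
    rintro Y hY (_ | b)
    · exact hY
    · exact .of_subsingleton (inferInstanceAs (Subsingleton Unit))
  let f₀ : (LGraph.comp P (LGraph.withSingles lab B LGraph.empty)).Iso (LGraph.on E lab B) := by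
    refine LGraph.isoOn _ (fun x => p x.1) ?_ ?_ ?_ ?_
    · rintro ⟨_ | b, x⟩ ⟨_ | b', y⟩ h
      · exact x.elim
      · exact x.elim
      · exact y.elim
      · obtain rfl : b = b' := Option.some_injective _ (hpinj h)
        rfl
    · intro v
      constructor
      · exact fun hv => ⟨⟨some ⟨v, hv⟩, ()⟩, rfl⟩
      · rintro ⟨⟨_ | b, x⟩, rfl⟩
        · exact x.elim
        · exact b.2
    · rintro ⟨_ | b, x⟩ ⟨_ | b', y⟩
      · exact x.elim
      · exact x.elim
      · exact y.elim
      · by_cases h : b = b'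
        · subst h
          exact iff_of_false E.irrefl (LGraph.comp P _).graph.irrefl
        · exact (LGraph.comp_adj_of_ne (P := P)
            (H := LGraph.withSingles lab B LGraph.empty)
            (x := ⟨some b, x⟩) (y := ⟨some b', y⟩) (fun h' => h (Option.some_injective _ h'))).symm
    · rintro ⟨_ | b, x⟩
      · exact x.elim
      · rfl
  have h₁ : AnProvable E (LGraph.comp P (LGraph.withSingles lab B (LGraph.on E lab W))) := by
    refine AnProvable.comp hP (A := LGraph.withSingles lab B LGraph.empty)
      (hTB.of_iso f₀.symm ((Good.on E lab B).of_iso f₀)) ?_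
    rintro (_ | b)
    · exact hTW
    · refine ⟨.graph _, fun X hX => ?_⟩
      obtain rfl : X = LGraph.single (lab b) := hX
      exact .of_subsingleton (inferInstanceAs (Subsingleton Unit))
  have hg₁ : Good E (LGraph.comp P (LGraph.withSingles lab B (LGraph.on E lab W))) :=
    .comp hP (hsingle _ (.on E lab W))
  classical
  let r : V → V := fun x => if x ∈ W then w₀ else x
  have hrW : ∀ x ∈ W, r x = w₀ := fun x hx => if_pos hx
  have hrB : ∀ x ∈ B, r x = x := fun x hx => if_neg fun h => hp.disj x h hx
  -- The intermediate graph: every vertex of `W` is attached to `B` as `w₀` is.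
  let E₁ : SimpleGraph V :=
    { Adj := fun x y => (x ∈ W ∧ y ∈ W ∧ E.Adj x y) ∨ E.Adj (r x) (r y)
      symm := ⟨fun x y h => h.imp (fun h => ⟨h.2.1, h.1, h.2.2.symm⟩) fun h => h.symm⟩
      loopless := ⟨fun x h => h.elim (fun h => E.irrefl h.2.2) E.irrefl⟩ }
  have hWW : ∀ x ∈ W, ∀ y ∈ W, (E₁.Adj x y ↔ E.Adj x y) := fun x hx y hy => by
    constructor
    · rintro (h | h)
      · exact h.2.2
      · rw [hrW x hx, hrW y hy] at h
        exact absurd h E.irrefl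
    · exact fun h => Or.inl ⟨hx, hy, h⟩
  have hBB : ∀ x ∈ B, ∀ y ∈ B, (E₁.Adj x y ↔ E.Adj x y) := fun x hx y hy => by
    constructor
    · rintro (h | h)
      · exact absurd hx (hp.disj x h.1)
      · rwa [hrB x hx, hrB y hy] at h
    · exact fun h => Or.inr (by rwa [hrB x hx, hrB y hy])
  have hBW : ∀ b ∈ B, ∀ w ∈ W, (E₁.Adj b w ↔ E.Adj b w₀) := fun b hb w hw => by
    constructor
    · rintro (h | h)
      · exact absurd hb (hp.disj b h.1)
      · rwa [hrB b hb, hrW w hw] at h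
    · exact fun h => Or.inr (by rwa [hrB b hb, hrW w hw])
  let f₁ : (LGraph.comp P (LGraph.withSingles lab B (LGraph.on E lab W))).Iso
      (LGraph.on E₁ lab (W ∪ B)) := by
    refine LGraph.isoOn _ (fun x => match x with
      | ⟨none, w⟩ => (show W from w : V)
      | ⟨some b, _⟩ => b) ?_ ?_ ?_ ?_
    · rintro ⟨_ | b, x⟩ ⟨_ | b', y⟩ h
      · have : x = y := Subtype.ext h
        rw [this]
      · exact absurd b'.2 ((show ((show W from x) : V) = b' from h) ▸ hp.disj _ x.2)
      · exact absurd b.2 ((show (b : V) = (show W from y) from h) ▸ hp.disj _ y.2)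
      · obtain rfl : b = b' := Subtype.ext h
        rfl
    · intro v
      constructor
      · rintro (hv | hv)
        · exact ⟨⟨none, (⟨v, hv⟩ : W)⟩, rfl⟩
        · exact ⟨⟨some ⟨v, hv⟩, ()⟩, rfl⟩
      · rintro ⟨⟨_ | b, x⟩, rfl⟩
        · exact Or.inl x.2
        · exact Or.inr b.2
    · rintro ⟨_ | b, x⟩ ⟨_ | b', y⟩
      · exact (hWW _ x.2 _ y.2).trans (LGraph.comp_adj_same (P := P)
          (H := LGraph.withSingles lab B (LGraph.on E lab W))
          (i := none) (u := x) (v := y)).symm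
      · refine ((E₁.adj_comm _ _).trans (hBW _ b'.2 _ x.2)).trans ((E.adj_comm _ _).trans ?_)
        exact (LGraph.comp_adj_of_ne (P := P)
          (H := LGraph.withSingles lab B (LGraph.on E lab W))
          (x := ⟨none, x⟩) (y := ⟨some b', y⟩) (Option.some_ne_none _).symm).symm
      · refine (hBW _ b.2 _ y.2).trans ?_
        exact (LGraph.comp_adj_of_ne (P := P)
          (H := LGraph.withSingles lab B (LGraph.on E lab W))
          (x := ⟨some b, x⟩) (y := ⟨none, y⟩) (Option.some_ne_none _)).symm
      · by_cases h : b = b'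
        · subst h
          exact iff_of_false E₁.irrefl (LGraph.comp P _).graph.irrefl
        · exact (hBB _ b.2 _ b'.2).trans (LGraph.comp_adj_of_ne (P := P)
            (H := LGraph.withSingles lab B (LGraph.on E lab W))
            (x := ⟨some b, x⟩) (y := ⟨some b', y⟩) (fun h' => h (Option.some_injective _ h'))).symm
    · rintro ⟨_ | b, x⟩ <;> rfl
  have hg₁' := hg₁.of_iso f₁.symm
  have h₂ := h₁.of_iso f₁ hg₁'
  rcases hw₀K with hw₀K | hno
  · refine h₂.ssDown (E := E) (A := W \ K) (B := (W ∩ K) ∪ B) {b | b ∈ B ∧ E.Adj b w₀}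
      ?_ ?_ ?_ ?_ ?_ (fun _ _ _ _ => Iff.rfl) (fun _ _ _ _ => Iff.rfl) ?_ hg₁' (.on E lab _)
    · intro x
      simp only [Set.mem_union, Set.mem_sdiff, Set.mem_inter_iff]
      tauto
    · rintro x hx (h | h)
      · exact hx.2 h.2
      · exact hp.disj x hx.1 h
    · exact fun x hx y hy => hWW x hx.1 y hy.1
    · rintro x (hx | hx) y (hy | hy)
      · exact hWW x hx.1 y hy.1
      · rw [E₁.adj_comm, hBW y hy x hx.1, E.adj_comm, hp.adj w₀ hw₀ y hy, hp.adj x hx.1 y hy]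
        have := hx.2
        tauto
      · rw [hBW x hx y hy.1, E.adj_comm, hp.adj w₀ hw₀ x hx, E.adj_comm, hp.adj y hy.1 x hx]
        have := hy.2
        tauto
      · exact hBB x hx y hy
    · rintro b (hb | hb) a ha
      · rw [hWW b hb.1 a ha.1]
        exact iff_of_false (hp.sep b hb.1 a ha.1 hb.2 ha.2) fun h => hp.disj b hb.1 h.1
      · rw [hBW b hb a ha.1]
        exact (and_iff_right hb).symm
    · rintro b (hb | hb) a ha h
      · exact hp.sep b hb.1 a ha.1 hb.2 ha.2 h
      · exact ha.2 ((hp.adj a ha.1 b hb).1 h.symm).1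
  · refine h₂.of_iso (LGraph.isoOnOfAgree ?_) (.on E lab _)
    have hnadj : ∀ w ∈ W, ∀ b ∈ B, ¬ E.Adj b w := fun w hw b hb h =>
      hno w hw ((hp.adj w hw b hb).1 h.symm).1
    rintro x (hx | hx) y (hy | hy)
    · exact (hWW x hx y hy).symm
    · exact iff_of_false (fun h => hnadj x hx y hy h.symm) fun h =>
        hnadj w₀ hw₀ y hy ((hBW y hy x hx).1 h.symm)
    · exact iff_of_false (hnadj y hy x hx) fun h => hnadj w₀ hw₀ x hx ((hBW x hx y hy).1 h)
    · exact (hBB x hx y hy).symm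

end Analytic

end GraphLogic

namespace GraphLogic

/-! ### Translation of the prime rule. -/

section Analytic

variable {𝒱 : Type u} {V : Type}

theorem nonempty_embedding_of_adj_iff {ι : Type} {R : SimpleGraph ι} {E : SimpleGraph V}
    (f : ι → V) (hf : Function.Injective f)
    (h : ∀ x y, x ≠ y → (E.Adj (f x) (f y) ↔ R.Adj x y)) : Nonempty (R ↪g E) := by
  refine ⟨⟨⟨f, hf⟩, fun {x y} => ?_⟩⟩
  by_cases hxy : x = y
  · subst hxy
    exact iff_of_false E.irrefl R.irrefl
  · exact h x y hxy

/-- The graph with the edges of `E` in the fibres of `π`, and the edges between the fibres given by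
`P` and the sorts `t`. -/
def composedGraph {ι : Type} (E : SimpleGraph V) (P : SimpleGraph ι) (π : V → ι)
    (t : V → Option Bool) : SimpleGraph V where
  Adj x y := (π x = π y ∧ E.Adj x y) ∨
    (π x ≠ π y ∧ ∃ b, t x = some b ∧ t y = some b ∧ (P.Adj (π x) (π y) ↔ b = true))
  symm := ⟨by
    rintro x y (⟨h, h'⟩ | ⟨h, b, hx, hy, h'⟩)
    · exact Or.inl ⟨h.symm, h'.symm⟩
    · exact Or.inr ⟨h.symm, b, hy, hx, (P.adj_comm _ _).trans h'⟩⟩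
  loopless := ⟨fun x h => h.elim (fun h => E.irrefl h.2) fun h => h.1 rfl⟩

theorem composedGraph_adj_of_eq {ι : Type} {E : SimpleGraph V} {P : SimpleGraph ι} {π : V → ι}
    {t : V → Option Bool} {x y : V} (h : π x = π y) :
    (composedGraph E P π t).Adj x y ↔ E.Adj x y :=
  ⟨fun h' => h'.elim (fun h' => h'.2) fun h' => absurd h h'.1, fun h' => Or.inl ⟨h, h'⟩⟩

theorem composedGraph_adj_of_ne {ι : Type} {E : SimpleGraph V} {P : SimpleGraph ι} {π : V → ι}
    {t : V → Option Bool} {x y : V} (h : π x ≠ π y) :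
    (composedGraph E P π t).Adj x y ↔
      ∃ b, t x = some b ∧ t y = some b ∧ (P.Adj (π x) (π y) ↔ b = true) :=
  ⟨fun h' => h'.elim (fun h' => absurd h'.1 h) fun h' => h'.2, fun h' => Or.inr ⟨h, h'⟩⟩

theorem composedGraph_congr {ι : Type} {E : SimpleGraph V} {P : SimpleGraph ι} {π : V → ι}
    {t t' : V → Option Bool} {x y : V} (hx : t x = t' x) (hy : t y = t' y) :
    (composedGraph E P π t).Adj x y ↔ (composedGraph E P π t').Adj x y := by
  simp only [composedGraph, hx, hy]

/-- No edge joins different sorts, so a prime induced subgraph has one sort or meets each sort at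
most once; in the latter case it has no edges. Within a sort `some b`, it lies in one fibre, where
nothing was changed, or meets each fibre at most once. Then it can be moved to vertices that had
sort `some b` from the start. -/
theorem IsComposed.good [Finite V] {ι : Type} {E : SimpleGraph V} {lab : V → Atom 𝒱}
    {P : SimpleGraph ι} {π : V → ι} {s t : V → Option Bool} {W : Set V} (h : IsComposed E P π s W)
    (hne : ∀ i b, ∃ x ∈ W, π x = i ∧ s x = some b) (ht : ∀ x b, s x = some b → t x = some b)
    (ht' : ∀ x y, s x = s y → π x = π y → t x = t y) :
    Good E (LGraph.on (composedGraph E P π t) lab W) := by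
  rintro κ R hR ⟨f⟩
  let q : κ → V := fun x => (f x).1
  have hqW : ∀ x, q x ∈ W := fun x => (f x).2
  have hq : Function.Injective q := fun x y hxy => f.injective (Subtype.ext hxy)
  have hadj : ∀ x y, R.Adj x y ↔ (composedGraph E P π t).Adj (q x) (q y) := fun x y =>
    f.map_adj_iff.symm
  have htE : ∀ x ∈ W, ∀ y ∈ W, E.Adj x y → t x = t y := fun x hx y hy hxy => by
    by_cases hπ : π x = π y
    · exact ht' x y (h.sort x hx y hy hxy) hπ
    · obtain ⟨b, h1, h2, -⟩ := (h.adj x hx y hy hπ).1 hxy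
      rw [ht x b h1, ht y b h2]
  have htC : ∀ x ∈ W, ∀ y ∈ W, (composedGraph E P π t).Adj x y → t x = t y := by
    rintro x hx y hy (hxy | ⟨-, b, h1, h2, -⟩)
    · exact htE x hx y hy hxy.2
    · rw [h1, h2]
  have hcl : ∀ x y z, t (q y) = t (q z) → t (q x) ≠ t (q y) → (R.Adj x y ↔ R.Adj x z) :=
    fun x y z hyz hxy => by
      rw [hadj, hadj]
      exact iff_of_false (fun h' => hxy (htC _ (hqW x) _ (hqW y) h'))
        fun h' => hxy ((htC _ (hqW x) _ (hqW z) h').trans hyz.symm)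
  rcases hR.injective_or_const (fun x => t (q x)) hcl with hinj | ⟨_ | b, hc⟩
  · refine nonempty_embedding_of_adj_iff q hq fun x y hxy => ?_
    rw [hadj]
    exact iff_of_false (fun h' => hxy (hinj (htE _ (hqW x) _ (hqW y) h')))
      fun h' => hxy (hinj (htC _ (hqW x) _ (hqW y) h'))
  · refine nonempty_embedding_of_adj_iff q hq fun x y hxy => ?_
    rw [hadj]
    by_cases hπ : π (q x) = π (q y)
    · exact (composedGraph_adj_of_eq hπ).symm
    · rw [composedGraph_adj_of_ne hπ, h.adj _ (hqW x) _ (hqW y) hπ]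
      refine iff_of_false ?_ ?_
      · rintro ⟨b, h1, -⟩
        have := (hc x).symm.trans (ht _ b h1)
        cases this
      · rintro ⟨b, h1, -⟩
        have := (hc x).symm.trans h1
        cases this
  · have hadj' : ∀ x y, π (q x) ≠ π (q y) →
        (R.Adj x y ↔ (P.Adj (π (q x)) (π (q y)) ↔ b = true)) := fun x y hxy => by
      rw [hadj, composedGraph_adj_of_ne hxy]
      constructor
      · rintro ⟨b', h1, -, h2⟩
        have := (hc x).symm.trans h1
        cases this
        exact h2
      · exact fun h' => ⟨b, hc x, hc y, h'⟩
    have hcl' : ∀ x y z, π (q y) = π (q z) → π (q x) ≠ π (q y) → (R.Adj x y ↔ R.Adj x z) :=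
      fun x y z hyz hxy => by rw [hadj' x y hxy, hadj' x z (hyz ▸ hxy), hyz]
    rcases hR.injective_or_const (fun x => π (q x)) hcl' with hinj | ⟨i, hi⟩
    -- These representatives induce in `E` a copy of `P` or of its complement, depending on `b`.
    · choose v hvW hvπ hvs using fun i => hne i b
      refine nonempty_embedding_of_adj_iff (fun x => v (π (q x))) (fun x y hxy => hinj ?_)
        fun x y hxy => ?_
      · have := congrArg π hxy
        rwa [hvπ, hvπ] at this
      · have hπ : π (q x) ≠ π (q y) := fun h' => hxy (hinj h')
        rw [hadj' x y hπ, h.adj _ (hvW _) _ (hvW _) (by rwa [hvπ, hvπ]), hvπ, hvπ]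
        constructor
        · rintro ⟨b', h1, -, h2⟩
          have := (hvs _).symm.trans h1
          cases this
          exact h2
        · exact fun h' => ⟨b, hvs _, hvs _, h'⟩
    · refine nonempty_embedding_of_adj_iff q hq fun x y _ => ?_
      rw [hadj]
      exact (composedGraph_adj_of_eq ((hi x).trans (hi y).symm)).symm

/-- A prime complete graph is an edge. -/
theorem IsPrime.nonempty_embedding_of_embedding_top {ι κ : Type} {R : SimpleGraph κ}
    (hR : IsPrime R) {E : SimpleGraph V} {u v : V} (huv : E.Adj u v)
    (f : R ↪g (⊤ : SimpleGraph ι)) : Nonempty (R ↪g E) := by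
  classical
  obtain ⟨a, b, hab⟩ := hR.exists_ne
  have hadj : ∀ x y, x ≠ y → R.Adj x y := fun x y hxy =>
    f.map_adj_iff.1 ((SimpleGraph.top_adj _ _).2 (f.injective.ne hxy))
  have hm : IsModule R {a, b} := fun v hv x hx y hy =>
    iff_of_true (hadj _ _ fun h => hv (h ▸ hx)) (hadj _ _ fun h => hv (h ▸ hy))
  have hall : ∀ x, x = a ∨ x = b := by
    rcases hR.2 _ hm with h | ⟨w, h⟩ | h
    · exact absurd (h ▸ Or.inl rfl : a ∈ (∅ : Set κ)) id
    · have h1 : a ∈ ({w} : Set κ) := h ▸ Or.inl rfl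
      have h2 : b ∈ ({w} : Set κ) := h ▸ Or.inr rfl
      exact absurd (h1.trans h2.symm) hab
    · exact fun x => (h ▸ Set.mem_univ x : x ∈ ({a, b} : Set κ))
  have hba : b ≠ a := hab.symm
  refine nonempty_embedding_of_adj_iff (fun x => if x = a then u else v) ?_ ?_
  · intro x y hxy
    rcases hall x with rfl | rfl <;> rcases hall y with rfl | rfl
    · rfl
    · simp only [if_true, if_neg hba] at hxy
      exact absurd hxy huv.ne
    · simp only [if_true, if_neg hba] at hxy
      exact absurd hxy.symm huv.ne
    · rfl
  · intro x y hxy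
    refine iff_of_true ?_ (hadj x y hxy)
    rcases hall x with rfl | rfl <;> rcases hall y with rfl | rfl
    · exact absurd rfl hxy
    · simpa only [if_true, if_neg hba] using huv
    · simpa only [if_true, if_neg hba] using huv.symm
    · exact absurd rfl hxy

/-- The prime rule for graphs without vertices of sort `none`. -/
theorem AnProvable.prime_of_sorted [Finite V] {ι : Type} [Finite ι] {E : SimpleGraph V}
    {lab : V → Atom 𝒱} {P : SimpleGraph ι} {π : V → ι} {t : V → Option Bool} {W : Set V}
    (hP : IsPrime P) (hcard : 4 ≤ Nat.card ι) {u v : V} (huv : E.Adj u v)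
    (htE : ∀ x ∈ W, ∀ y ∈ W, E.Adj x y → t x = t y)
    (htb : ∀ x, t x = some false ∨ t x = some true)
    (hne : ∀ i, ∃ x ∈ W, π x = i ∧ t x = some false)
    (hT : ∀ i, AnProvable E (LGraph.on E lab (W ∩ π ⁻¹' {i})))
    (hg : Good E (LGraph.on (composedGraph E P π t) lab W)) :
    AnProvable E (LGraph.on (composedGraph E P π t) lab W) := by
  let w : Bool → ι → Set V := fun b i => {x | x ∈ W ∧ π x = i ∧ t x = some b}
  let M : ι → LGraph 𝒱 := fun i => LGraph.on E lab (w false i)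
  let N : ι → LGraph 𝒱 := fun i => LGraph.on E lab (w true i)
  have h₁ : ∀ i, AnProvable E ((M i).par (N i)) := fun i => by
    let f : ((M i).par (N i)).Iso (LGraph.on E lab (W ∩ π ⁻¹' {i})) := by
      refine LGraph.isoOnPlug (A := w true i) (B := w false i) ∅ ?_ ?_
        (fun _ _ _ _ => Iff.rfl) (fun _ _ _ _ => Iff.rfl) ?_
      · intro x
        constructor
        · rintro ⟨hx, hi⟩
          exact (htb x).symm.imp (fun h => ⟨hx, hi, h⟩) fun h => ⟨hx, hi, h⟩
        · rintro (h | h)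
          · exact ⟨h.1, h.2.1⟩
          · exact ⟨h.1, h.2.1⟩
      · intro x hx hx'
        have := hx.2.2.symm.trans hx'.2.2
        cases this
      · intro x hx y hy
        refine iff_of_false (fun h => ?_) id
        have := (hx.2.2.symm.trans (htE x hx.1 y hy.1 h)).trans hy.2.2
        cases this
    exact (hT i).of_iso f.symm ((Good.on E lab _).of_iso f)
  -- The premise of `p↓` is composed via a complete graph, whose only prime induced subgraph is an
  -- edge; `E` has one by `huv`.
  have hP' : ∀ (κ : Type) (R : SimpleGraph κ), IsPrime R →
      Nonempty (R ↪g (⊤ : SimpleGraph ι)) → Nonempty (R ↪g E) := fun κ R hR ⟨g⟩ =>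
    hR.nonempty_embedding_of_embedding_top huv g
  have h₂ : AnProvable E (LGraph.comp (⊤ : SimpleGraph ι) fun _ => LGraph.empty (𝒱 := 𝒱)) := by
    refine (AnProvable.empty E).of_iso
      ⟨⟨⟨fun x => x.elim, fun x => x.2.elim, fun x => x.elim, fun x => x.2.elim⟩,
        fun {x} => x.elim⟩, fun x => x.elim⟩ (.of_subsingleton ⟨fun x => x.2.elim⟩)
  have h₃ : AnProvable E (LGraph.comp (⊤ : SimpleGraph ι) fun i => (M i).par (N i)) :=
    .comp hP' h₂ h₁
  let val : ∀ b i, (LGraph.on E lab (w b i)).V → V := fun b i => Subtype.val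
  have hval : ∀ b i x, val b i x ∈ w b i := fun b i => Subtype.property
  let p : ((LGraph.comp Pᶜ M).par (LGraph.comp P N)).V → V :=
    Sum.elim (fun x => val false x.1 x.2) (fun x => val true x.1 x.2)
  have hdis : ∀ i j x y, val false i x ≠ val true j y := fun i j x y h => by
    have := (hval false i x).2.2.symm.trans ((congrArg t h).trans (hval true j y).2.2)
    cases this
  have hsame : ∀ b i j x y, val b i x = val b j y →
      (⟨i, x⟩ : Σ i, (LGraph.on E lab (w b i)).V) = ⟨j, y⟩ := fun b i j x y h => by
    obtain rfl : i = j :=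
      (hval b i x).2.1.symm.trans ((congrArg π h).trans (hval b j y).2.1)
    have : x = y := Subtype.ext h
    rw [this]
  have hC : ∀ (b : Bool) (Q : SimpleGraph ι),
      (∀ i j, i ≠ j → (Q.Adj i j ↔ (P.Adj i j ↔ b = true))) →
      ∀ x y : Σ i, (LGraph.on E lab (w b i)).V,
      (composedGraph E P π t).Adj (val b x.1 x.2) (val b y.1 y.2) ↔
        (LGraph.comp Q fun i => LGraph.on E lab (w b i)).graph.Adj x y := by
    rintro b Q hQ ⟨i, x⟩ ⟨j, y⟩
    have hx := hval b i x
    have hy := hval b j y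
    by_cases hij : i = j
    · subst hij
      refine (composedGraph_adj_of_eq (hx.2.1.trans hy.2.1.symm)).trans ?_
      exact (LGraph.comp_adj_same (P := Q) (H := fun i => LGraph.on E lab (w b i))
        (u := x) (v := y)).symm
    · have hπ : π (val b i x) ≠ π (val b j y) := by
        rw [hx.2.1, hy.2.1]
        exact hij
      refine (composedGraph_adj_of_ne hπ).trans (Iff.trans ?_
        (LGraph.comp_adj_of_ne (P := Q) (H := fun i => LGraph.on E lab (w b i))
          (x := ⟨i, x⟩) (y := ⟨j, y⟩) hij).symm)
      rw [hQ i j hij, hx.2.1, hy.2.1, hx.2.2, hy.2.2]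
      constructor
      · rintro ⟨b', h1, -, h2⟩
        cases h1
        exact h2
      · exact fun h => ⟨b, rfl, rfl, h⟩
  let f : ((LGraph.comp Pᶜ M).par (LGraph.comp P N)).Iso
      (LGraph.on (composedGraph E P π t) lab W) := by
    refine LGraph.isoOn _ p ?_ ?_ ?_ ?_
    · rintro (x | x) (y | y) hxy
      · exact congrArg Sum.inl (hsame false _ _ _ _ hxy)
      · exact absurd hxy (hdis _ _ _ _)
      · exact absurd hxy.symm (hdis _ _ _ _)
      · exact congrArg Sum.inr (hsame true _ _ _ _ hxy)
    · intro v
      constructor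
      · intro hv
        rcases htb v with h | h
        · exact ⟨.inl ⟨π v, ⟨v, hv, rfl, h⟩⟩, rfl⟩
        · exact ⟨.inr ⟨π v, ⟨v, hv, rfl, h⟩⟩, rfl⟩
      · rintro ⟨x | x, rfl⟩
        · exact (hval false x.1 x.2).1
        · exact (hval true x.1 x.2).1
    · have hno : ∀ i j x y, ¬ (composedGraph E P π t).Adj (val false i x) (val true j y) := by
        rintro i j x y h
        have hx := hval false i x
        have hy := hval true j y
        have : t (val false i x) = t (val true j y) := by
          rcases h with h | ⟨-, b, h1, h2, -⟩
          · exact htE _ hx.1 _ hy.1 h.2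
          · rw [h1, h2]
        have := (hx.2.2.symm.trans this).trans hy.2.2
        cases this
      rintro (x | x) (y | y)
      · refine hC false Pᶜ (fun i j hij => ?_) x y
        rw [SimpleGraph.compl_adj]
        simp [hij]
      · exact iff_of_false (hno _ _ _ _) id
      · exact iff_of_false (fun h => hno _ _ _ _ h.symm) id
      · exact hC true P (fun i j hij => by simp) x y
    · rintro (x | x) <;> rfl
  refine AnProvable.of_iso (h₃.step (r := pDown) (Or.inl (Or.inr (Or.inr rfl)))
    (.mk P hP hcard M N fun i => ?_) (hg.of_iso f)) f hg
  obtain ⟨x, hx, hi, ht⟩ := hne i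
  exact ⟨⟨x, hx, hi, ht⟩⟩

open Classical in
/-- The sorts `s`, where the sort `none` is replaced by `some false` over `J`. -/
noncomputable def sortOver {ι : Type} (π : V → ι) (s : V → Option Bool) (J : Set ι) (x : V) :
    Option Bool :=
  if s x = none ∧ π x ∈ J then some false else s x

/-- The rule `p↓` leaves no room for vertices of sort `none`. They are first counted as vertices of
sort `some false`, so that `p↓` applies, and are then moved out by `ss↓`, one fibre at a time. -/
theorem AnProvable.prime [Finite V] {ι : Type} [Finite ι] {E : SimpleGraph V}
    {lab : V → Atom 𝒱} {P : SimpleGraph ι} {π : V → ι} {s : V → Option Bool} {W : Set V}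
    (hP : IsPrime P) (hcard : 4 ≤ Nat.card ι) (h : IsComposed E P π s W)
    (hne : ∀ i b, ∃ x ∈ W, π x = i ∧ s x = some b)
    (hT : ∀ i, AnProvable E (LGraph.on E lab (W ∩ π ⁻¹' {i}))) :
    AnProvable E (LGraph.on E lab W) := by
  classical
  let t : Set ι → V → Option Bool := sortOver π s
  have ht : ∀ J x b, s x = some b → t J x = some b := fun J x b hx => by
    have : ¬ (s x = none ∧ π x ∈ J) := fun h' => by
      have := h'.1.symm.trans hx
      cases this
    exact (if_neg this).trans hx
  have htJ : ∀ J x, s x = none → π x ∈ J → t J x = some false := fun J x hx hJ => if_pos ⟨hx, hJ⟩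
  have htJ' : ∀ J x, s x = none → π x ∉ J → t J x = none := fun J x hx hJ =>
    (if_neg fun h' => hJ h'.2).trans hx
  have ht' : ∀ J x y, s x = s y → π x = π y → t J x = t J y := fun J x y hs hπ => by
    simp only [t, sortOver, hs, hπ]
  have hg : ∀ J, Good E (LGraph.on (composedGraph E P π (t J)) lab W) := fun J =>
    h.good hne (ht J) (ht' J)
  obtain ⟨i, j, hij⟩ := hP.exists_ne
  obtain ⟨u, v, huv⟩ : ∃ u v, E.Adj u v := by
    -- Two distinct vertices of `P` are adjacent in `P` or in its complement; `b` selects the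
    -- composition that contains the edge.
    obtain ⟨b, hb⟩ : ∃ b : Bool, P.Adj i j ↔ b = true := ⟨decide (P.Adj i j), by simp⟩
    obtain ⟨x, hx, rfl, hxs⟩ := hne i b
    obtain ⟨y, hy, rfl, hys⟩ := hne j b
    exact ⟨x, y, (h.adj x hx y hy hij).2 ⟨b, hxs, hys, hb⟩⟩
  -- `K` collects the fibres whose vertices of sort `none` have already been moved out.
  have hstep : ∀ K : Finset ι,
      AnProvable E (LGraph.on (composedGraph E P π (t {j | j ∉ K})) lab W) := by
    intro K
    induction K using Finset.induction_on with
    | empty =>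
      refine .prime_of_sorted hP hcard huv (fun x hx y hy hxy => ?_) (fun x => ?_) (fun i => ?_) hT
        (hg _)
      · by_cases hπ : π x = π y
        · exact ht' _ x y (h.sort x hx y hy hxy) hπ
        · obtain ⟨b, h1, h2, -⟩ := (h.adj x hx y hy hπ).1 hxy
          rw [ht _ x b h1, ht _ y b h2]
      · rcases hs : s x with _ | _ | _
        · exact Or.inl (htJ _ x hs (Finset.notMem_empty _))
        · exact Or.inl (ht _ x _ hs)
        · exact Or.inr (ht _ x _ hs)
      · obtain ⟨x, hx, hi, hs⟩ := hne i false
        exact ⟨x, hx, hi, ht _ x _ hs⟩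
    | @insert i K hi ih =>
      have hsame : ∀ x, ¬ (s x = none ∧ π x = i) →
          t {j | j ∉ K} x = t {j | j ∉ insert i K} x := fun x hx => by
        rcases hs : s x with _ | b
        · have hπ : π x ≠ i := fun h' => hx ⟨hs, h'⟩
          by_cases hK : π x ∈ K
          · rw [htJ' {j | j ∉ K} x hs (fun h' => h' hK),
              htJ' {j | j ∉ insert i K} x hs (fun h' => h' (Finset.mem_insert_of_mem hK))]
          · rw [htJ {j | j ∉ K} x hs hK,
              htJ {j | j ∉ insert i K} x hs (fun h' => (Finset.mem_insert.1 h').elim hπ hK)]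
        · rw [ht _ x b hs, ht _ x b hs]
      refine ih.ssDown (E := composedGraph E P π (t {j | j ∉ insert i K}))
        (A := {x | x ∈ W ∧ s x = none ∧ π x = i}) (B := {x | x ∈ W ∧ ¬ (s x = none ∧ π x = i)})
        -- While counted as `some false`, the vertices of `A` have the neighbours given by the
        -- complement of `P`.
        {x | π x ≠ i ∧ t {j | j ∉ K} x = some false ∧ ¬ P.Adj (π x) i}
        ?_ ?_ ?_ ?_ ?_ (fun _ _ _ _ => Iff.rfl) (fun _ _ _ _ => Iff.rfl) ?_ (hg _) (hg _)
      · intro x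
        simp only [Set.mem_ofPred_eq]
        tauto
      · exact fun x hx hx' => hx'.2 hx.2
      · intro x hx y hy
        have hπ : π x = π y := hx.2.2.trans hy.2.2.symm
        rw [composedGraph_adj_of_eq hπ, composedGraph_adj_of_eq hπ]
      · exact fun x hx y hy => composedGraph_congr (hsame x hx.2) (hsame y hy.2)
      · rintro b ⟨hbW, hb⟩ a ⟨haW, hs, hπ⟩
        by_cases hbi : π b = i
        · rw [composedGraph_adj_of_eq (hbi.trans hπ.symm)]
          exact iff_of_false (fun h' => hb ⟨(h.sort b hbW a haW h').trans hs, hbi⟩)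
            fun h' => h'.1 hbi
        · rw [composedGraph_adj_of_ne (by rwa [hπ]), htJ _ a hs (by rw [hπ]; exact hi), hπ]
          constructor
          · rintro ⟨c, h1, h2, h3⟩
            cases h2
            exact ⟨hbi, h1, fun h' => Bool.false_ne_true (h3.1 h')⟩
          · exact fun h' => ⟨false, h'.2.1, rfl, iff_of_false h'.2.2 Bool.false_ne_true⟩
      · rintro b ⟨hbW, hb⟩ a ⟨haW, hs, hπ⟩ h'
        by_cases hbi : π b = i
        · rw [composedGraph_adj_of_eq (hbi.trans hπ.symm)] at h'
          exact hb ⟨(h.sort b hbW a haW h').trans hs, hbi⟩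
        · rw [composedGraph_adj_of_ne (by rwa [hπ])] at h'
          obtain ⟨c, -, h2, -⟩ := h'
          rw [htJ' {j | j ∉ insert i K} a hs
            (fun h' => h' (by rw [hπ]; exact Finset.mem_insert_self i K))] at h2
          cases h2
  have := Fintype.ofFinite ι
  refine (hstep Finset.univ).of_iso (LGraph.isoOnOfAgree fun x hx y hy => ?_) (.on E lab W)
  have hts : ∀ x, t {j | j ∉ Finset.univ} x = s x := fun x =>
    if_neg fun h' => h'.2 (Finset.mem_univ _)
  by_cases hπ : π x = π y
  · exact (composedGraph_adj_of_eq hπ).symm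
  · rw [composedGraph_adj_of_ne hπ, h.adj x hx y hy hπ, hts, hts]

theorem Seq.anProvable [Finite V] {E : SimpleGraph V} {lab : V → Atom 𝒱} {W : Set V}
    (h : Seq E lab W) : AnProvable E (LGraph.on E lab W) := by
  induction h with
  | empty =>
    refine (AnProvable.empty E).of_iso (LGraph.isoOn _ (fun x => x.elim) (fun x => x.elim)
      (fun v => iff_of_false id fun h => h.choose.elim) (fun x => x.elim) fun x => x.elim)
      (.on E lab _)
  | @ax x y hne h hl =>
    let f : ((LGraph.single (lab x).dual).par (LGraph.single (lab x))).Iso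
        (LGraph.on E lab {x, y}) := by
      refine LGraph.isoOn _ (Sum.elim (fun _ => y) (fun _ => x)) ?_ ?_ ?_ ?_
      · rintro (_ | _) (_ | _) hxy
        · rfl
        · exact absurd hxy.symm hne
        · exact absurd hxy hne
        · rfl
      · intro v
        constructor
        · rintro (rfl | rfl)
          · exact ⟨.inr (), rfl⟩
          · exact ⟨.inl (), rfl⟩
        · rintro ⟨_ | _, rfl⟩
          · exact Or.inr rfl
          · exact Or.inl rfl
      · rintro (_ | _) (_ | _)
        · exact iff_of_false E.irrefl id
        · exact iff_of_false (fun h' => h h'.symm) id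
        · exact iff_of_false h id
        · exact iff_of_false E.irrefl id
      · rintro (_ | _)
        · exact hl
        · rfl
    exact ((AnProvable.empty E).step (r := aiDown) (Or.inl (Or.inl rfl)) (.mk (lab x))
      ((Good.on E lab _).of_iso f)).of_iso f (.on E lab _)
  | plug h hW _ _ _ ihW ihB => exact .plug h hW ihW ihB
  | prime hP hcard h hne _ ih => exact .prime hP hcard h hne ih

end Analytic

end GraphLogic

namespace GraphLogic

/-! ### Connectors and prime induced subgraphs. -/

section Decomposition

variable {𝒱 : Type u}

/-- A quotient of a graph with at least two vertices by a partition into modules has itself a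
prime such quotient. -/
theorem exists_isPrime_quotient {V : Type} (E : SimpleGraph V) {κ : Type} [Finite κ]
    (Q : SimpleGraph κ) (f : V → κ) (hf : Function.Surjective f) (hκ : Nontrivial κ)
    (hQ : ∀ x y, f x ≠ f y → (E.Adj x y ↔ Q.Adj (f x) (f y))) :
    ∃ (κ' : Type) (_ : Finite κ') (Q' : SimpleGraph κ') (f' : V → κ'), IsPrime Q' ∧
      Function.Surjective f' ∧ ∀ x y, f' x ≠ f' y → (E.Adj x y ↔ Q'.Adj (f' x) (f' y)) := by
  induction hn : Nat.card κ using Nat.strong_induction_on generalizing κ with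
  | _ n ih =>
  by_cases hp : IsPrime Q
  · exact ⟨κ, inferInstance, Q, f, hp, hf, hQ⟩
  obtain ⟨M, hM, hM₀, hM₁, hM₂⟩ : ∃ M, IsModule Q M ∧ M ≠ ∅ ∧ (∀ x, M ≠ {x}) ∧ M ≠ Set.univ := by
    by_contra h
    refine hp ⟨Finite.one_lt_card_iff_nontrivial.2 hκ, fun M hM => ?_⟩
    by_contra h'
    push Not at h'
    exact h ⟨M, hM, h'.1.ne_empty, h'.2.1, h'.2.2⟩
  obtain ⟨m, hm⟩ := Set.nonempty_iff_ne_empty.2 hM₀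
  obtain ⟨m', hm', hne⟩ : ∃ m' ∈ M, m' ≠ m := by
    by_contra h
    push Not at h
    exact hM₁ m (Set.eq_singleton_iff_unique_mem.2 ⟨hm, h⟩)
  obtain ⟨j, hj⟩ := (Set.ne_univ_iff_exists_notMem M).1 hM₂
  classical
  -- Contracting the nontrivial module `M` to `m` drops `m'`, so the quotient shrinks; `j` keeps it
  -- nontrivial.
  let g : κ → {i // i = m ∨ i ∉ M} := fun i =>
    if hi : i ∈ M then ⟨m, Or.inl rfl⟩ else ⟨i, Or.inr hi⟩
  have hg : ∀ i ∈ M, (g i : κ) = m := fun i hi => by simp only [g, dif_pos hi]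
  have hg' : ∀ i ∉ M, (g i : κ) = i := fun i hi => by simp only [g, dif_neg hi]
  have hgs : Function.Surjective g := by
    rintro ⟨i, hi⟩
    refine ⟨i, Subtype.ext ?_⟩
    rcases hi with rfl | hi
    · exact hg i hm
    · exact hg' i hi
  refine ih _ ?_ (Q.induce {i | i = m ∨ i ∉ M}) (g ∘ f) (hgs.comp hf) ?_ (fun x y hxy => ?_) rfl
  · rw [← hn]
    exact Finite.card_subtype_lt (x := m') fun h => h.elim hne fun h => h hm'
  · exact ⟨⟨m, Or.inl rfl⟩, ⟨j, Or.inr hj⟩, fun h => hj (by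
      have := congrArg Subtype.val h
      change m = j at this
      rwa [← this])⟩
  · rw [hQ x y fun h => hxy (congrArg g h)]
    change _ ↔ Q.Adj (g (f x)) (g (f y))
    by_cases hx : f x ∈ M <;> by_cases hy : f y ∈ M
    · exact absurd (Subtype.ext ((hg _ hx).trans (hg _ hy).symm)) hxy
    · rw [hg _ hx, hg' _ hy, Q.adj_comm, hM _ hy _ hx _ hm, Q.adj_comm]
    · rw [hg' _ hx, hg _ hy, hM _ hx _ hy _ hm]
    · rw [hg' _ hx, hg' _ hy]

/-- The graph induced on all vertices. -/
def LGraph.onUniv (G : LGraph 𝒱) : (LGraph.on G.graph G.label Set.univ).Iso G where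
  toIso := ⟨Equiv.Set.univ G.V, Iff.rfl⟩
  label_eq _ := rfl

/-- The composition of a graph from the classes of a partition into modules. -/
noncomputable def LGraph.isoQuotient (G : LGraph 𝒱) {κ : Type} [Finite κ] {Q : SimpleGraph κ}
    {f : G.V → κ} (hQ : ∀ x y, f x ≠ f y → (G.graph.Adj x y ↔ Q.Adj (f x) (f y))) :
    (LGraph.comp Q fun i => LGraph.on G.graph G.label (f ⁻¹' {i})).Iso
      (LGraph.on G.graph G.label Set.univ) := by
  let val : ∀ i, (LGraph.on G.graph G.label (f ⁻¹' {i})).V → G.V := fun i => Subtype.val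
  have hval : ∀ i x, f (val i x) = i := fun i => Subtype.property
  refine LGraph.isoOn _ (fun x => val x.1 x.2) ?_
    (fun v => iff_of_true (Set.mem_univ v) ⟨⟨f v, ⟨v, rfl⟩⟩, rfl⟩) ?_ fun _ => rfl
  · rintro ⟨i, x⟩ ⟨j, y⟩ h
    obtain rfl : i = j := (hval i x).symm.trans ((congrArg f h).trans (hval j y))
    have : x = y := Subtype.ext h
    rw [this]
  · rintro ⟨i, x⟩ ⟨j, y⟩
    by_cases hij : i = j
    · subst hij
      exact (LGraph.comp_adj_same (P := Q)
        (H := fun i => LGraph.on G.graph G.label (f ⁻¹' {i})) (u := x) (v := y)).symm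
    · refine Iff.trans ?_ (LGraph.comp_adj_of_ne (P := Q)
        (H := fun i => LGraph.on G.graph G.label (f ⁻¹' {i})) (x := ⟨i, x⟩) (y := ⟨j, y⟩) hij).symm
      have := hQ (val i x) (val j y) (by rwa [hval, hval])
      rwa [hval, hval] at this

/-- Relative to a prime quotient of `G`, a prime induced subgraph embeds into the quotient or lies
in one class. That class is smaller than `G`, so the search continues inside it. -/
theorem IsPrime.exists_connector {ι : Type} {P : SimpleGraph ι} (hP : IsPrime P) (G : LGraph 𝒱)
    (q : P ↪g G.graph) :
    ∃ (κ : Type) (Q : SimpleGraph κ), IsConnector Q G ∧ Nonempty (P ↪g Q) := by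
  induction hn : Nat.card G.V using Nat.strong_induction_on generalizing G with
  | _ n ih =>
  have hG : Nontrivial G.V := by
    obtain ⟨x, y, hxy⟩ := hP.exists_ne
    exact ⟨q x, q y, q.injective.ne hxy⟩
  obtain ⟨κ, _, Q, f, hQp, hf, hQ⟩ :=
    exists_isPrime_quotient G.graph G.graph id Function.surjective_id hG fun _ _ _ => Iff.rfl
  let A : κ → LGraph 𝒱 := fun i => LGraph.on G.graph G.label (f ⁻¹' {i})
  have hA : ∀ i, (A i).IsNonempty := fun i => by
    obtain ⟨x, hx⟩ := hf i
    exact ⟨⟨x, hx⟩⟩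
  have e : G.Iso (LGraph.comp Q A) :=
    let a := (LGraph.isoQuotient G hQ).symm
    let b := G.onUniv.symm
    ⟨b.toIso.trans a.toIso, fun v => (a.label_eq _).trans (b.label_eq v)⟩
  have hadj : ∀ x y, f (q x) ≠ f (q y) → (P.Adj x y ↔ Q.Adj (f (q x)) (f (q y))) :=
    fun x y hxy => by rw [← hQ _ _ hxy, q.map_adj_iff]
  have hcl : ∀ x y z, f (q y) = f (q z) → f (q x) ≠ f (q y) → (P.Adj x y ↔ P.Adj x z) :=
    fun x y z hyz hxy => by rw [hadj x y hxy, hadj x z (hyz ▸ hxy), hyz]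
  rcases hP.injective_or_const (fun x => f (q x)) hcl with h | ⟨i, h⟩
  · exact ⟨κ, Q, .root hQp A hA e, nonempty_embedding_of_adj_iff _ h fun x y hxy =>
      (hadj x y (h.ne hxy)).symm⟩
  · obtain ⟨j, hj⟩ : ∃ j, j ≠ i := by
      obtain ⟨x, y, hxy⟩ := hQp.exists_ne
      by_cases hx : x = i
      · exact ⟨y, fun hy => hxy (hx.trans hy.symm)⟩
      · exact ⟨x, hx⟩
    obtain ⟨v, hv⟩ := hf j
    have hlt : Nat.card (A i).V < n := by
      rw [← hn]
      exact Finite.card_subtype_lt (x := v) fun h' => hj (hv.symm.trans h')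
    obtain ⟨κ', Q', hQ', hPQ'⟩ := ih _ hlt (A i)
      ⟨⟨fun x => ⟨q x, h x⟩, fun x y hxy => q.injective (congrArg Subtype.val hxy)⟩,
        q.map_rel_iff⟩ rfl
    exact ⟨κ', Q', .child Q hQp A hA e i hQ', hPQ'⟩

/-- One vertex chosen from each non-empty component of a composition via `P` induces a copy of `P`.
-/
theorem IsConnector.isPrime_and_embedding {ι : Type} {P : SimpleGraph ι} {G : LGraph 𝒱}
    (h : IsConnector P G) : IsPrime P ∧ Nonempty (P ↪g G.graph) := by
  induction h with
  | root hP A hA e =>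
    refine ⟨hP, ?_⟩
    obtain ⟨g⟩ : Nonempty (P ↪g (LGraph.comp P A).graph) :=
      nonempty_embedding_of_adj_iff (fun i => LGraph.compMk P A i (hA i).some)
        (fun i j hij => congrArg Sigma.fst hij) fun i j hij =>
        LGraph.comp_adj_of_ne (P := P) (H := A) hij
    exact ⟨g.trans e.symm.toIso.toEmbedding⟩
  | @child κ _ G Q hQ A hA e k h ih =>
    obtain ⟨hP, ⟨g⟩⟩ := ih
    let c : (A k).graph ↪g (LGraph.comp Q A).graph :=
      ⟨⟨LGraph.compMk Q A k, LGraph.compMk_injective Q A k⟩, LGraph.comp_adj_same⟩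
    exact ⟨hP, ⟨(g.trans c).trans e.symm.toIso.toEmbedding⟩⟩

end Decomposition

end GraphLogic

theorem mainTheorem5 {𝒱 : Type u} (G : GraphLogic.LGraph 𝒱)
    (hG : GraphLogic.Provable (GraphLogic.GS 𝒱 ∪ {GraphLogic.ssUp}) G) :
    ∃ D : GraphLogic.Proof (GraphLogic.GS 𝒱 ∪ {GraphLogic.ssUp}) G,
      ∀ H ∈ D.occurring, ∀ (ι : Type) (P : SimpleGraph ι),
        GraphLogic.IsConnector P H → GraphLogic.IsSubconnector P G := by
  -- The ambient graph is `G.graph` itself, with respect to which `G` is trivially good.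
  obtain ⟨D, hD⟩ := hG.seq.anProvable.of_iso G.onUniv fun _ _ _ h => h
  refine ⟨D, fun H hH ι P hPH => ?_⟩
  obtain ⟨hP, hPe⟩ := hPH.isPrime_and_embedding
  obtain ⟨q⟩ := hD H hH ι P hP hPe
  exact ⟨hP, hP.exists_connector G q⟩
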